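/- Fix an integer $p\ge 2$ and put $q=e^{i\pi/p}$, $\xi=1-q^2$, $\langle n\rangle=\frac{q^{2n}-1}{q^2-1}$, $\langle n\rangle!=\langle1\rangle\cdots\langle n\rangle$, $\binom{m}{n}_{q}=\frac{\langle m\rangle!}{\langle n\rangle!\,\langle m-n\rangle!}$. **Setting.** Work in the braided category of complex vector spaces graded by the charge group $\mathbb Z/4p$, with braiding $v\otimes w\mapsto q^{\alpha\beta/2}\,w\otimes v$ for $v,w$ of charges $\alpha,\beta$. The rank-1 Nichols algebra $B_p$ has basis $F(0),\dots,F(p-1)$, $F(r)$ of charge $-2r$, with $F(r)F(s)=\binom{r+s}{r}_qF(r+s)$ (so $F(r)=F^r/\langle r\rangle!$ with $F=F(1)$, $F^p=0$) and $\Delta F(r)=\sum_{s=0}^rF(s)\otimes F(r-s)$; in particular the braiding of $F$ with itself is $q^2$. Yetter–Drinfeld modules are the left–left ones over $B_p$ in this category; their tensor product carries the diagonal action and coaction, and morphisms preserve charge, action and coaction. **Simple modules.** For $1\le r\le p$ and $\nu\in\mathbb Z/4$ let $X(r)_\nu$ have basis $V^a_0,\dots,V^a_{r-1}$, where $a=r-1-\nu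 p \bmod 4p$ and $V^a_s$ has charge $a-2s$, with $F\triangleright V^a_s=\xi\langle s-a\rangle\langle s+1\rangle V^a_{s+1}$ and $\delta V^a_s=\sum_{j=0}^sF(j)\otimes V^a_{s-j}$. **Two-vertex modules.** For integers $a,b$ let $\mathbb V^{a,b}$ have basis $V^{a,b}_{s,t}$ ($0\le s,t\le p-1$), of charge $a+b-2s-2t$, with $$F\triangleright V^{a,b}_{s,t}=\xi\langle s+2t-a-b\rangle\langle s+1\rangle V^{a,b}_{s+1,t}+\xi q^{2s-a}\langle t-b\rangle\langle t+1\rangle V^{a,b}_{s,t+1},\qquad \delta V^{a,b}_{s,t}=\sum_{j=0}^sF(j)\otimes V^{a,b}_{s-j,t}.$$ The fusion map is $V^a_s\otimes V^b_t\mapsto\sum_{i=0}^tq^{-ai}\binom{s+i}{s}_qV^{a,b}_{s+i,t-i}$. **The modules $P[r]_\nu$.** For $1\le r\le p-1$ and $\nu\in\mathbb Z/4$ let $a=p-1$, $b=p-r-\nu p$, $\ell=p-r$, and let $T\in\mathbb V^{a,b}$ be obtained from $F^{\ell-1}\triangleright V^{a,b}_{0,0}$ by replacing each $V^{a,b}_{s,t}$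 with $V^{a,b}_{s+1,t}$. Then $P[r]_\nu\subset\mathbb V^{a,b}$ is the submodule generated by $T$ under the action and coaction. Put $P[p]_\nu=X(p)_\nu$. **Theorem.** 1. Each $X(r)_\nu$ ($1\le r\le p$) is a simple Yetter–Drinfeld module of dimension $r$. 2. For $1\le r\le p-1$, $P[r]_\nu$ is an indecomposable Yetter–Drinfeld module of dimension $2p$ with the structure of subquotients $$\begin{array}{ccc}&X(r)_\nu&\\ X(p-r)_{\nu-1}&&X(p-r)_{\nu+1}\\ &X(r)_\nu&\end{array}$$ That is, it has submodules $B,L,R$ with $L\cap R=B$, $B\cong X(r)_\nu$, $L/B\cong X(p-r)_{\nu-1}$, $R/B\cong X(p-r)_{\nu+1}$, $P[r]_\nu/(L+R)\cong X(r)_\nu$, and its only submodules are $0,B,L,R,L+R,P[r]_\nu$. The extension of left by bottom ($L$) and that of top by right ($P[r]_\nu/L$) split as comodules but not as modules; the extension of right by bottom ($R$) and that of top by left ($P[r]_\nu/R$) split as modules but not as comodules. 3. For all $1\le r_1,r_2\le p$ and $\nu_1,\nu_2\in\mathbb Z/4$, $X(r_1)_{\nu_1}\otimes X(r_2)_{\nu_2}$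 is a Yetter–Drinfeld module, which the fusion map (with $a=r_1-1-\nu_1p$, $b=r_2-1-\nu_2p$) identifies, by an injective morphism, with the fusion product inside $\mathbb V^{a,b}$. There is an isomorphism of Yetter–Drinfeld modules $$X(r_1)_{\nu_1}\otimes X(r_2)_{\nu_2}\;\cong\bigoplus_{\substack{s=|r_1-r_2|+1\\ \text{step}=2}}^{p-1-|r_1+r_2-p|}X(s)_{\nu_1+\nu_2}\;\oplus\bigoplus_{\substack{s=2p-r_1-r_2+1\\ \text{step}=2}}^{p}P[s]_{\nu_1+\nu_2}.$$ -/

import Mathlib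

open scoped TensorProduct

noncomputable section

namespace RankOneNichols

/-! ### Scalars -/

/-- The primitive `2p`-th root of unity `q = exp(iπ/p)`. -/
def q (p : ℕ) : ℂ := Complex.exp (Complex.I * Real.pi / p)

/-- `⟨n⟩ = (q^{2n} - 1)/(q^2 - 1)` for an integer `n`. -/
def qint (p : ℕ) (n : ℤ) : ℂ := ((q p) ^ (2 * n) - 1) / ((q p) ^ 2 - 1)

/-- `⟨n⟩! = ⟨1⟩ ⋯ ⟨n⟩`. -/
def qfac (p n : ℕ) : ℂ := ∏ i ∈ Finset.range n, qint p (i + 1)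

/-- The `q`-binomial coefficient `⟨m+n⟩! / (⟨m⟩! ⟨n⟩!)`; it is used only for `m, n < p`, where the
denominator does not vanish, and it is `0` for `m, n < p ≤ m + n`. -/
def qbinom (p m n : ℕ) : ℂ := qfac p (m + n) / (qfac p m * qfac p n)

/-- `ξ = 1 - q^2`. -/
def xi (p : ℕ) : ℂ := 1 - (q p) ^ 2

/-! ### The ambient braided category

Objects are complex vector spaces graded by the charge group `ℤ/4p`.  The grading is given by the
projections onto the homogeneous components.  Elements `v`, `w` of charges `α`, `β` are braided as
`v ⊗ w ↦ q^{αβ/2} w ⊗ v`. -/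

/-- `q^{αβ/2}`. -/
def bichar (p : ℕ) (α β : ZMod (4 * p)) : ℂ :=
  Complex.exp (Complex.I * Real.pi * (α.val * β.val) / (2 * p))

/-- The homogeneous projections of the space with basis `ι` whose `i`-th basis vector has
charge `deg i`. -/
def projOf {p : ℕ} {ι : Type} [Fintype ι] [DecidableEq ι] (deg : ι → ZMod (4 * p))
    (α : ZMod (4 * p)) : (ι → ℂ) →ₗ[ℂ] (ι → ℂ) :=
  (Pi.basisFun ℂ ι).constr ℂ fun i => if deg i = α then Pi.single i 1 else 0

section Braiding

variable {p : ℕ} [NeZero p]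
variable {A V W D : Type} [AddCommGroup A] [Module ℂ A] [AddCommGroup V] [Module ℂ V]
  [AddCommGroup W] [Module ℂ W] [AddCommGroup D] [Module ℂ D]

/-- The braiding `Ψ : V ⊗ W → W ⊗ V` of two graded spaces. -/
def braid (πV : ZMod (4 * p) → V →ₗ[ℂ] V) (πW : ZMod (4 * p) → W →ₗ[ℂ] W) :
    V ⊗[ℂ] W →ₗ[ℂ] W ⊗[ℂ] V :=
  ∑ α : ZMod (4 * p), ∑ β : ZMod (4 * p),
    bichar p α β • ((TensorProduct.comm ℂ V W).toLinearMap ∘ₗ TensorProduct.map (πV α) (πW β))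

/-- `id ⊗ Ψ ⊗ id : (A ⊗ V) ⊗ (W ⊗ D) → (A ⊗ W) ⊗ (V ⊗ D)`. -/
def midBraid (A D : Type) [AddCommGroup A] [Module ℂ A] [AddCommGroup D] [Module ℂ D]
    (πV : ZMod (4 * p) → V →ₗ[ℂ] V) (πW : ZMod (4 * p) → W →ₗ[ℂ] W) :
    (A ⊗[ℂ] V) ⊗[ℂ] (W ⊗[ℂ] D) →ₗ[ℂ] (A ⊗[ℂ] W) ⊗[ℂ] (V ⊗[ℂ] D) :=
  (TensorProduct.assoc ℂ A W (V ⊗[ℂ] D)).symm.toLinearMap ∘ₗ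
  ((TensorProduct.assoc ℂ W V D).toLinearMap ∘ₗ (braid πV πW).rTensor D ∘ₗ
    (TensorProduct.assoc ℂ V W D).symm.toLinearMap).lTensor A ∘ₗ
  (TensorProduct.assoc ℂ A V (W ⊗[ℂ] D)).toLinearMap

end Braiding

/-! ### The braided Hopf algebra `B_p` -/

/-- The `p`-dimensional space `B_p` with basis the divided powers `F(0), …, F(p-1)`. -/
abbrev Nich (p : ℕ) : Type := Fin p → ℂ

namespace Nich

/-- `F(r) = F^r/⟨r⟩!`, and `F(r) = 0` for `r ≥ p`. -/
def F (p r : ℕ) : Nich p := fun i => if i.val = r then 1 else 0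

/-- `F(r)` has charge `-2r`; hence `Ψ(F(r) ⊗ F(s)) = q^{2rs} F(s) ⊗ F(r)`. -/
def proj (p : ℕ) : ZMod (4 * p) → Nich p →ₗ[ℂ] Nich p :=
  projOf fun r : Fin p => ((-2 * (r.val : ℤ) : ℤ) : ZMod (4 * p))

/-- `F(r) F(s) = ⟨r+s choose r⟩ F(r+s)`; the unit is `F(0)`. -/
def mul (p : ℕ) : Nich p ⊗[ℂ] Nich p →ₗ[ℂ] Nich p :=
  TensorProduct.lift <| (Pi.basisFun ℂ (Fin p)).constr ℂ fun r =>
    (Pi.basisFun ℂ (Fin p)).constr ℂ fun s => qbinom p r.val s.val • F p (r.val + s.val)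

/-- `Δ F(r) = ∑_{s=0}^r F(s) ⊗ F(r-s)`. -/
def comul (p : ℕ) : Nich p →ₗ[ℂ] Nich p ⊗[ℂ] Nich p :=
  (Pi.basisFun ℂ (Fin p)).constr ℂ fun r =>
    ∑ s ∈ Finset.range (r.val + 1), F p s ⊗ₜ[ℂ] F p (r.val - s)

/-- `ε(F(r)) = δ_{r,0}`. -/
def counit (p : ℕ) : Nich p →ₗ[ℂ] ℂ :=
  (Pi.basisFun ℂ (Fin p)).constr ℂ fun r => if r.val = 0 then 1 else 0

end Nich

/-! ### Yetter--Drinfeld modules -/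

/-- The data of a (left--left) Yetter--Drinfeld `B_p`-module: a space with a `ℤ/4p`-grading, an
action and a coaction.  The axioms are those of `IsYD`. -/
structure YDData (p : ℕ) where
  carrier : Type
  [grp : AddCommGroup carrier]
  [mod : Module ℂ carrier]
  proj : ZMod (4 * p) → carrier →ₗ[ℂ] carrier
  act : Nich p ⊗[ℂ] carrier →ₗ[ℂ] carrier
  coact : carrier →ₗ[ℂ] Nich p ⊗[ℂ] carrier

attribute [instance] YDData.grp YDData.mod

/-- `Y` is a left--left Yetter--Drinfeld `B_p`-module in the category of `ℤ/4p`-graded spaces. -/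
structure IsYD {p : ℕ} [NeZero p] (Y : YDData p) : Prop where
  proj_comp : ∀ α β, Y.proj α ∘ₗ Y.proj β = if α = β then Y.proj α else 0
  proj_sum : ∑ α, Y.proj α = LinearMap.id
  act_charge : ∀ α β, Y.proj (α + β) ∘ₗ Y.act ∘ₗ TensorProduct.map (Nich.proj p α) (Y.proj β) =
    Y.act ∘ₗ TensorProduct.map (Nich.proj p α) (Y.proj β)
  coact_charge : ∀ γ, Y.coact ∘ₗ Y.proj γ =
    (∑ α, TensorProduct.map (Nich.proj p α) (Y.proj (γ - α))) ∘ₗ Y.coact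
  one_act : ∀ y, Y.act (Nich.F p 0 ⊗ₜ[ℂ] y) = y
  mul_act : ∀ b c y, Y.act (Nich.mul p (b ⊗ₜ[ℂ] c) ⊗ₜ[ℂ] y) = Y.act (b ⊗ₜ[ℂ] Y.act (c ⊗ₜ[ℂ] y))
  counit_coact : (TensorProduct.lid ℂ Y.carrier).toLinearMap ∘ₗ
    (Nich.counit p).rTensor Y.carrier ∘ₗ Y.coact = LinearMap.id
  coassoc : (TensorProduct.assoc ℂ (Nich p) (Nich p) Y.carrier).toLinearMap ∘ₗ
    (Nich.comul p).rTensor Y.carrier ∘ₗ Y.coact = Y.coact.lTensor (Nich p) ∘ₗ Y.coact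
  /- `(m ⊗ id)(id ⊗ Ψ)(δ ⊗ id)(▸ ⊗ id)(id ⊗ Ψ)(Δ ⊗ id) = (m ⊗ ▸)(id ⊗ Ψ ⊗ id)(Δ ⊗ δ)`
  as maps `B_p ⊗ Y → B_p ⊗ Y`. -/
  yetterDrinfeld :
    (Nich.mul p).rTensor Y.carrier ∘ₗ
    (TensorProduct.assoc ℂ (Nich p) (Nich p) Y.carrier).symm.toLinearMap ∘ₗ
    (braid Y.proj (Nich.proj p)).lTensor (Nich p) ∘ₗ
    (TensorProduct.assoc ℂ (Nich p) Y.carrier (Nich p)).toLinearMap ∘ₗ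
    (Y.coact ∘ₗ Y.act).rTensor (Nich p) ∘ₗ
    (TensorProduct.assoc ℂ (Nich p) Y.carrier (Nich p)).symm.toLinearMap ∘ₗ
    (braid (Nich.proj p) Y.proj).lTensor (Nich p) ∘ₗ
    (TensorProduct.assoc ℂ (Nich p) (Nich p) Y.carrier).toLinearMap ∘ₗ
    (Nich.comul p).rTensor Y.carrier =
    TensorProduct.map (Nich.mul p) Y.act ∘ₗ
    midBraid (Nich p) Y.carrier (Nich.proj p) (Nich.proj p) ∘ₗ
    TensorProduct.map (Nich.comul p) Y.coact

/-- Morphisms preserve the charge and commute with the action and the coaction. -/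
structure IsHom {p : ℕ} {Y Z : YDData p} (f : Y.carrier →ₗ[ℂ] Z.carrier) : Prop where
  proj : ∀ α, f ∘ₗ Y.proj α = Z.proj α ∘ₗ f
  act : f ∘ₗ Y.act = Z.act ∘ₗ f.lTensor (Nich p)
  coact : Z.coact ∘ₗ f = f.lTensor (Nich p) ∘ₗ Y.coact

/-- Isomorphism of Yetter--Drinfeld modules. -/
def Iso {p : ℕ} (Y Z : YDData p) : Prop :=
  ∃ e : Y.carrier ≃ₗ[ℂ] Z.carrier, IsHom (Y := Y) (Z := Z) e.toLinearMap

/-- The tensor product of Yetter--Drinfeld modules: diagonal action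
`(▸ ⊗ ▸)(id ⊗ Ψ ⊗ id)(Δ ⊗ id ⊗ id)` and diagonal coaction
`(m ⊗ id ⊗ id)(id ⊗ Ψ ⊗ id)(δ ⊗ δ)`. -/
def tensor {p : ℕ} [NeZero p] (Y Z : YDData p) : YDData p where
  carrier := Y.carrier ⊗[ℂ] Z.carrier
  proj γ := ∑ α, TensorProduct.map (Y.proj α) (Z.proj (γ - α))
  act := TensorProduct.map Y.act Z.act ∘ₗ
    midBraid (Nich p) Z.carrier (Nich.proj p) Y.proj ∘ₗ
    (Nich.comul p).rTensor (Y.carrier ⊗[ℂ] Z.carrier)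
  coact := (Nich.mul p).rTensor (Y.carrier ⊗[ℂ] Z.carrier) ∘ₗ
    midBraid (Nich p) Z.carrier Y.proj (Nich.proj p) ∘ₗ
    TensorProduct.map Y.coact Z.coact

/-- The direct sum of a finite family of Yetter--Drinfeld modules. -/
def directSum {p : ℕ} {ι : Type} [Fintype ι] [DecidableEq ι] (Y : ι → YDData p) : YDData p where
  carrier := ∀ i, (Y i).carrier
  proj α := LinearMap.pi fun i => (Y i).proj α ∘ₗ LinearMap.proj i
  act := LinearMap.pi fun i => (Y i).act ∘ₗ (LinearMap.proj i).lTensor (Nich p)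
  coact := ∑ i, (LinearMap.single ℂ (fun i => (Y i).carrier) i).lTensor (Nich p) ∘ₗ
    (Y i).coact ∘ₗ LinearMap.proj i

/-! ### Submodules -/

/-- The map `B_p ⊗ V → V` that takes `∑_j F(j) ⊗ v_j` to `v_j`. -/
def coeff {p : ℕ} (V : Type) [AddCommGroup V] [Module ℂ V] (j : Fin p) :
    Nich p ⊗[ℂ] V →ₗ[ℂ] V :=
  (TensorProduct.lid ℂ V).toLinearMap ∘ₗ (LinearMap.proj j : Nich p →ₗ[ℂ] ℂ).rTensor V

section Sub

variable {p : ℕ} (Y : YDData p)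

/-- `W` is a graded subspace. -/
def Graded (W : Submodule ℂ Y.carrier) : Prop := ∀ α, ∀ w ∈ W, Y.proj α w ∈ W

/-- `W` is stable under the action. -/
def ActStable (W : Submodule ℂ Y.carrier) : Prop :=
  ∀ b : Nich p, ∀ w ∈ W, Y.act (b ⊗ₜ[ℂ] w) ∈ W

/-- `W` is stable under the coaction, `δ W ⊆ B_p ⊗ W`. -/
def CoactStable (W : Submodule ℂ Y.carrier) : Prop :=
  ∀ j : Fin p, ∀ w ∈ W, coeff Y.carrier j (Y.coact w) ∈ W

/-- `W` is a Yetter--Drinfeld submodule. -/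
structure IsSub (W : Submodule ℂ Y.carrier) : Prop where
  graded : Graded Y W
  act : ActStable Y W
  coact : CoactStable Y W

/-- The induced structure on a Yetter--Drinfeld submodule. -/
def sub (W : Submodule ℂ Y.carrier) (hW : IsSub Y W) : YDData p where
  carrier := W
  proj α := (Y.proj α).restrict (hW.graded α)
  act := (Y.act ∘ₗ W.subtype.lTensor (Nich p)).codRestrict W (by
    intro z
    induction z using TensorProduct.induction_on with
    | zero => simp
    | tmul b w => simpa using hW.act b w w.2
    | add x y hx hy => rw [map_add]; exact W.add_mem hx hy)
  coact := ∑ j : Fin p, TensorProduct.mk ℂ (Nich p) W (Nich.F p j.val) ∘ₗ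
    (coeff Y.carrier j ∘ₗ Y.coact).restrict (hW.coact j)

/-- The Yetter--Drinfeld submodule generated by a vector under the action and coaction. -/
def gen (v : Y.carrier) : Submodule ℂ Y.carrier := sInf {W | IsSub Y W ∧ v ∈ W}

theorem isSub_gen (v : Y.carrier) : IsSub Y (gen Y v) where
  graded α w hw := by
    simp only [gen, Submodule.mem_sInf, Set.mem_ofPred_eq] at hw ⊢
    exact fun W hW => hW.1.graded α w (hw W hW)
  act b w hw := by
    simp only [gen, Submodule.mem_sInf, Set.mem_ofPred_eq] at hw ⊢
    exact fun W hW => hW.1.act b w (hw W hW)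
  coact j w hw := by
    simp only [gen, Submodule.mem_sInf, Set.mem_ofPred_eq] at hw ⊢
    exact fun W hW => hW.1.coact j w (hw W hW)

/-- `Y` is a simple Yetter--Drinfeld module. -/
def IsSimpleYD : Prop :=
  Nontrivial Y.carrier ∧ ∀ W, IsSub Y W → W = ⊥ ∨ W = ⊤

/-- `Y` is an indecomposable Yetter--Drinfeld module. -/
def IsIndecomposableYD : Prop :=
  Nontrivial Y.carrier ∧
    ∀ W W', IsSub Y W → IsSub Y W' → W ⊓ W' = ⊥ → W ⊔ W' = ⊤ → W = ⊥ ∨ W' = ⊥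

/-- The subquotient `W/K` of `Y` is isomorphic to `Z`. -/
def SubquotientIso (K W : Submodule ℂ Y.carrier) (hW : IsSub Y W) (Z : YDData p) : Prop :=
  ∃ g : W →ₗ[ℂ] Z.carrier, IsHom (Y := sub Y W hW) (Z := Z) g ∧ Function.Surjective g ∧
    (LinearMap.ker g).map W.subtype = K

/-- For `K ≤ W₀ ≤ W`, the inclusion `W₀/K ⊆ W/K` has a complement that is stable under
the action. -/
def SplitsAct (K W₀ W : Submodule ℂ Y.carrier) : Prop :=
  ∃ C, Graded Y C ∧ ActStable Y C ∧ C ⊓ W₀ = K ∧ C ⊔ W₀ = W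

/-- For `K ≤ W₀ ≤ W`, the inclusion `W₀/K ⊆ W/K` has a complement that is stable under
the coaction. -/
def SplitsCoact (K W₀ W : Submodule ℂ Y.carrier) : Prop :=
  ∃ C, Graded Y C ∧ CoactStable Y C ∧ C ⊓ W₀ = K ∧ C ⊔ W₀ = W

/-- An extension `W/K` of `W/W₀` by `W₀/K` in which the two pieces are linked by the action only:
it splits as an extension of comodules, but not as an extension of modules. -/
def ActArrow (K W₀ W : Submodule ℂ Y.carrier) : Prop :=
  SplitsCoact Y K W₀ W ∧ ¬ SplitsAct Y K W₀ W

/-- An extension `W/K` of `W/W₀` by `W₀/K` in which the two pieces are linked by the coaction only: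
it splits as an extension of modules, but not as an extension of comodules. -/
def CoactArrow (K W₀ W : Submodule ℂ Y.carrier) : Prop :=
  SplitsAct Y K W₀ W ∧ ¬ SplitsCoact Y K W₀ W

/-- `Y` has the diagram of subquotients with `T` at the top and at the bottom, `L` on the left and
`R` on the right; the arrows top → left and right → bottom are given by the coaction, the
arrows top → right and left → bottom by the action.  Here `b` is the bottom piece, `l` the piece
left--bottom and `r` the piece right--bottom; there are no other submodules
than those visible in the diagram. -/
def HasDiamond (T L R : YDData p) : Prop :=
  ∃ (b l r : Submodule ℂ Y.carrier) (hb : IsSub Y b) (hl : IsSub Y l) (hr : IsSub Y r)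
    (htop : IsSub Y ⊤),
    l ⊓ r = b ∧
    SubquotientIso Y ⊥ b hb T ∧
    SubquotientIso Y b l hl L ∧
    SubquotientIso Y b r hr R ∧
    SubquotientIso Y (l ⊔ r) ⊤ htop T ∧
    (∀ W, IsSub Y W → W = ⊥ ∨ W = b ∨ W = l ∨ W = r ∨ W = l ⊔ r ∨ W = ⊤) ∧
    ActArrow Y ⊥ b l ∧
    CoactArrow Y ⊥ b r ∧
    ActArrow Y l (l ⊔ r) ⊤ ∧
    CoactArrow Y r (l ⊔ r) ⊤

end Sub

/-! ### One-vertex and two-vertex modules -/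

/-- The action of `B_p` in which `F = F(1)` acts by `f`, so that `F(j)` acts by `f^j/⟨j⟩!`. -/
def actOf (p : ℕ) {V : Type} [AddCommGroup V] [Module ℂ V] (f : V →ₗ[ℂ] V) :
    Nich p ⊗[ℂ] V →ₗ[ℂ] V :=
  TensorProduct.lift <| (Pi.basisFun ℂ (Fin p)).constr ℂ fun j => (qfac p j.val)⁻¹ • f ^ j.val

/-- The coaction `v ↦ ∑_{j=0}^{p-1} F(j) ⊗ d^j(v)`. -/
def coactOf (p : ℕ) {V : Type} [AddCommGroup V] [Module ℂ V] (d : V →ₗ[ℂ] V) :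
    V →ₗ[ℂ] Nich p ⊗[ℂ] V :=
  ∑ j : Fin p, TensorProduct.mk ℂ (Nich p) V (Nich.F p j.val) ∘ₗ d ^ j.val

/-- The vector `V^a_s` of a one-vertex space spanned by `V^a_s`, `0 ≤ s < n`
(zero for `s ≥ n`). -/
def vtx (n s : ℕ) : Fin n → ℂ := fun i => if i.val = s then 1 else 0

/-- The one-vertex space spanned by `V^a_s`, `0 ≤ s < n`, with `V^a_s` of charge `a - 2s`,
the action `F ▸ V^a_s = ξ ⟨s-a⟩ ⟨s+1⟩ V^a_{s+1}` and
the coaction `δ V^a_s = ∑_{j=0}^s F(j) ⊗ V^a_{s-j}`. -/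
def oneVertex (p n : ℕ) (a : ℤ) : YDData p where
  carrier := Fin n → ℂ
  proj := projOf fun s : Fin n => ((a - 2 * (s.val : ℤ) : ℤ) : ZMod (4 * p))
  act := actOf p <| (Pi.basisFun ℂ (Fin n)).constr ℂ fun s =>
    (xi p * qint p (s.val - a) * qint p (s.val + 1)) • vtx n (s.val + 1)
  coact := coactOf p <| (Pi.basisFun ℂ (Fin n)).constr ℂ fun s =>
    if s.val = 0 then 0 else vtx n (s.val - 1)

/-- The vertex label `a = r - 1 - νp` (modulo `4p`) of `X(r)_ν`. -/
def label (p r : ℕ) (ν : ZMod 4) : ℤ := (r : ℤ) - 1 - (ν.val : ℤ) * p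

/-- The module `X(r)_ν`, with basis `V^a_s`, `0 ≤ s < r`, where `a = r - 1 - νp`. -/
def X (p r : ℕ) (ν : ZMod 4) : YDData p := oneVertex p r (label p r ν)

/-- The vector `V^{a,b}_{s,t}` of the two-vertex space (zero if `s ≥ p` or `t ≥ p`). -/
def vtx₂ (p s t : ℕ) : Fin p × Fin p → ℂ := fun i => if i.1.val = s ∧ i.2.val = t then 1 else 0

/-- The two-vertex module spanned by `V^{a,b}_{s,t}`, `0 ≤ s, t < p`, of charge `a + b - 2s - 2t`,
with the cumulative adjoint action
`F ▸ V^{a,b}_{s,t} = ξ⟨s+2t-a-b⟩⟨s+1⟩ V^{a,b}_{s+1,t} + ξ q^{2s-a}⟨t-b⟩⟨t+1⟩ V^{a,b}_{s,t+1}`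
and the coaction `δ V^{a,b}_{s,t} = ∑_{j=0}^s F(j) ⊗ V^{a,b}_{s-j,t}`
(deconcatenation up to the first vertex). -/
def twoVertex (p : ℕ) (a b : ℤ) : YDData p where
  carrier := Fin p × Fin p → ℂ
  proj := projOf fun i : Fin p × Fin p =>
    ((a + b - 2 * (i.1.val : ℤ) - 2 * (i.2.val : ℤ) : ℤ) : ZMod (4 * p))
  act := actOf p <| (Pi.basisFun ℂ (Fin p × Fin p)).constr ℂ fun i =>
    (xi p * qint p (i.1.val + 2 * i.2.val - a - b) * qint p (i.1.val + 1)) •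
      vtx₂ p (i.1.val + 1) i.2.val +
    (xi p * (q p) ^ (2 * (i.1.val : ℤ) - a) * qint p (i.2.val - b) * qint p (i.2.val + 1)) •
      vtx₂ p i.1.val (i.2.val + 1)
  coact := coactOf p <| (Pi.basisFun ℂ (Fin p × Fin p)).constr ℂ fun i =>
    if i.1.val = 0 then 0 else vtx₂ p (i.1.val - 1) i.2.val

/-- The fusion product map of two one-vertex spaces into the two-vertex space,
`V^a_s ⊗ V^b_t ↦ ∑_{i=0}^t q^{-ai} ⟨s+i choose s⟩ V^{a,b}_{s+i,t-i}`. -/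
def fusionMap (p n m : ℕ) (a b : ℤ) :
    (oneVertex p n a).carrier ⊗[ℂ] (oneVertex p m b).carrier →ₗ[ℂ] (twoVertex p a b).carrier :=
  TensorProduct.lift <| (Pi.basisFun ℂ (Fin n)).constr ℂ fun s =>
    (Pi.basisFun ℂ (Fin m)).constr ℂ fun t =>
      ∑ i ∈ Finset.range (t.val + 1),
        ((q p) ^ (-a * (i : ℤ)) * qbinom p s.val i) • vtx₂ p (s.val + i) (t.val - i)

/-- The vector `T = ∑_{s<ℓ} ⟨ℓ-1⟩! c(ℓ-1,s) V^{a,b}_{ℓ-s,s}` obtained from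
`F^{ℓ-1} ▸ V^{a,b}_{0,0} = ∑_{s<ℓ} ⟨ℓ-1⟩! c(ℓ-1,s) V^{a,b}_{ℓ-1-s,s}` by adding one `F` at
the far left of every term. -/
def topVector (p ℓ : ℕ) (a b : ℤ) : (twoVertex p a b).carrier :=
  ((Pi.basisFun ℂ (Fin p × Fin p)).constr ℂ fun i => vtx₂ p (i.1.val + 1) i.2.val)
    (qfac p (ℓ - 1) • (twoVertex p a b).act (Nich.F p (ℓ - 1) ⊗ₜ[ℂ] vtx₂ p 0 0))

/-- The module `P[r]_ν`: for `r < p`, it is the submodule of a two-vertex module that extends the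
module generated by the left coinvariant `V^{a,b}_{0,0}`, with `a = p - 1` and
`b = p - r - νp`; it is generated, under the action and coaction, by its top vector `T`
(with `ℓ = p - r`).  Its subscripts are those of its top and bottom subquotient `X(r)_ν`.
For `r = p` it is `X(p)_ν`. -/
def P (p r : ℕ) (ν : ZMod 4) : YDData p :=
  if r < p then
    sub (twoVertex p ((p : ℤ) - 1) ((p : ℤ) - r - (ν.val : ℤ) * p))
      (gen _ (topVector p (p - r) ((p : ℤ) - 1) ((p : ℤ) - r - (ν.val : ℤ) * p)))
      (isSub_gen _ _)
  else X p p ν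

/-! ### The index sets of the decomposition -/

/-- `s = |r₁-r₂|+1, |r₁-r₂|+3, …` up to `p - 1 - |r₁+r₂-p|`. -/
def range₁ (p r₁ r₂ : ℕ) : Finset ℕ :=
  (Finset.Icc 1 p).filter fun s =>
    |(r₁ : ℤ) - r₂| + 1 ≤ s ∧ (s : ℤ) ≤ p - 1 - |(r₁ : ℤ) + r₂ - p| ∧
      (2 : ℤ) ∣ s - (|(r₁ : ℤ) - r₂| + 1)

/-- `s = 2p-r₁-r₂+1, 2p-r₁-r₂+3, …` up to `p`. -/
def range₂ (p r₁ r₂ : ℕ) : Finset ℕ :=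
  (Finset.Icc 1 p).filter fun s =>
    2 * (p : ℤ) - r₁ - r₂ + 1 ≤ s ∧ (2 : ℤ) ∣ s - (2 * (p : ℤ) - r₁ - r₂ + 1)

end RankOneNichols

end

open scoped TensorProduct
open RankOneNichols

open scoped TensorProduct

noncomputable section

namespace RankOneNichols

variable {p : ℕ}

/-! ### Scalars -/

/-! All modules here are described by two operators: `f`, the action of F, and `d`, the coefficient
of F(1) in the coaction. Then F(j) acts by f^j/⟨j⟩!, and the coefficient of F(j) in the coaction is
d^j. The Yetter–Drinfeld axiom follows from the single relation d f = q² f d + (1 − q^{−2n}) on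
vectors of charge n, together with f^p = d^p = 0 (`HasOps.isYD`): its two sides, expanded in the
F(m), satisfy the same recursion in the degree of the acting element
(`HasOps.costraight_eq_straight`). Submodules are graded subspaces stable under f and d. By the
q-binomial theorem a tensor product has the operators f ⊗ 1 + K ⊗ f' and d ⊗ 1 + K ⊗ d', where K
multiplies charge n by q^{−n} (`HasOps.tensor`). What remains is a highest-weight calculation as for
sl₂, with the coinvariants (the kernel of d) as highest-weight vectors.

Since d is nilpotent, every nonzero submodule contains a homogeneous coinvariant. In X(r) these are
the multiples of V_0, which generates under F, so X(r) is simple (`isSimple_oneVertex`). The fusion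
map intertwines both operators and is triangular, hence injective; for p × p vertices it is
bijective, and this is how f^p = 0 is obtained on two-vertex modules (`twoF_pow`).

The module P[r] is governed by two chains F^i T and F^i u with d u = 0, d T = F^{ℓ−1} u, F^ℓ u ≠ 0
and r + ℓ = p (`TopPair`). The relation gives d on both chains explicitly: within the chain of u the
descent breaks exactly at F^ℓ u, within that of T exactly at F^r T. The 2p vectors are therefore
independent, and a submodule is determined by which of F^ℓ u, u, F^r T, T it contains
(`TopPair.le_of_tests`). The submodule lattice, the four extensions and indecomposability are read
off from this.

For the tensor product, grade X(r₁) ⊗ X(r₂) by level s + t. A nonzero coinvariant u exists at every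
level below min(r₁, r₂), and d has no kernel at levels from r₂ on. If F^s u = 0, then u generates a
copy of X(s) (`exists_isHom_X`). Otherwise F^{p−s} u ≠ 0 and F^{p−s−1} u has a preimage T under d,
so P[s] embeds (`exists_topPair`, `TopPair.exists_isHom`). The homogeneous coinvariants of different
summands have different charges, so the sum of the images is direct (`sumMap_injective`), and a
dimension count shows that it is everything (`sum_dim`). -/

lemma q_ne_zero (p : ℕ) : q p ≠ 0 := Complex.exp_ne_zero _

lemma q_zpow (p : ℕ) (n : ℤ) : q p ^ n = Complex.exp (Complex.I * Real.pi * n / p) := by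
  rw [q, ← Complex.exp_int_mul]
  congr 1
  ring

/-- `Q^n = q^{2n}`. -/
def Q (p : ℕ) (n : ℤ) : ℂ := q p ^ (2 * n)

lemma Q_ne_zero (p : ℕ) (n : ℤ) : Q p n ≠ 0 := zpow_ne_zero _ (q_ne_zero p)

lemma Q_add (p : ℕ) (m n : ℤ) : Q p (m + n) = Q p m * Q p n := by
  rw [Q, mul_add, zpow_add₀ (q_ne_zero p)]; rfl

lemma Q_sub (p : ℕ) (m n : ℤ) : Q p (m - n) = Q p m / Q p n := by
  rw [Q, mul_sub, zpow_sub₀ (q_ne_zero p)]; rfl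

lemma Q_neg (p : ℕ) (n : ℤ) : Q p (-n) = (Q p n)⁻¹ := by
  rw [Q, mul_neg, zpow_neg]; rfl

@[simp] lemma Q_zero (p : ℕ) : Q p 0 = 1 := by simp [Q]

lemma Q_one (p : ℕ) : Q p 1 = q p ^ 2 := by simp [Q]

/-- q² = exp(2πi/p) is a primitive p-th root of unity. Every vanishing or non-vanishing of a
q-integer below goes back to this. -/
lemma Q_eq_one_iff [NeZero p] (n : ℤ) : Q p n = 1 ↔ (p : ℤ) ∣ n := by
  have h := (Complex.isPrimitiveRoot_exp p (NeZero.ne p)).zpow_eq_one_iff_dvd n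
  rw [← h, Q, q_zpow, ← Complex.exp_int_mul]
  apply Eq.congr_left
  congr 1
  push_cast
  ring

lemma Q_eq_Q_iff [NeZero p] (m n : ℤ) : Q p m = Q p n ↔ (p : ℤ) ∣ m - n := by
  rw [← Q_eq_one_iff, Q_sub, div_eq_one_iff_eq (Q_ne_zero p n)]

lemma Q_one_ne_one (hp : 2 ≤ p) : Q p 1 ≠ 1 := by
  have : NeZero p := ⟨by omega⟩
  rw [Ne, Q_eq_one_iff]
  intro h
  have := Int.le_of_dvd one_pos h
  omega

lemma qint_eq (p : ℕ) (n : ℤ) : qint p n = (Q p n - 1) / (Q p 1 - 1) := by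
  rw [qint, Q_one]; rfl

lemma xi_eq (p : ℕ) : xi p = 1 - Q p 1 := by rw [xi, Q_one]

lemma xi_ne_zero (hp : 2 ≤ p) : xi p ≠ 0 := by
  rw [xi_eq, sub_ne_zero]; exact (Q_one_ne_one hp).symm

lemma xi_mul_qint (hp : 2 ≤ p) (n : ℤ) : xi p * qint p n = 1 - Q p n := by
  have h := sub_ne_zero.2 (Q_one_ne_one hp)
  rw [xi_eq, qint_eq]
  field_simp
  ring

@[simp] lemma qint_zero (p : ℕ) : qint p 0 = 0 := by simp [qint]

lemma qint_eq_zero_iff [NeZero p] (hp : 2 ≤ p) (n : ℤ) : qint p n = 0 ↔ (p : ℤ) ∣ n := by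
  rw [qint_eq, div_eq_zero_iff, or_iff_left (sub_ne_zero.2 (Q_one_ne_one hp)), sub_eq_zero,
    Q_eq_one_iff]

lemma qint_add (p : ℕ) (m n : ℤ) : qint p (m + n) = qint p m + Q p m * qint p n := by
  simp only [qint_eq, Q_add]; ring

lemma qint_ne_zero (hp : 2 ≤ p) {n : ℤ} (h0 : 0 < n) (hn : n < p) : qint p n ≠ 0 := by
  have : NeZero p := ⟨by omega⟩
  rw [Ne, qint_eq_zero_iff hp]
  intro h
  have := Int.le_of_dvd h0 h
  omega

@[simp] lemma qfac_zero (p : ℕ) : qfac p 0 = 1 := by simp [qfac]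

lemma qfac_succ (p n : ℕ) : qfac p (n + 1) = qfac p n * qint p (n + 1) := by
  simp [qfac, Finset.prod_range_succ]

lemma qfac_ne_zero (hp : 2 ≤ p) {n : ℕ} (hn : n < p) : qfac p n ≠ 0 := by
  rw [qfac, Finset.prod_ne_zero_iff]
  intro i hi
  rw [Finset.mem_range] at hi
  exact qint_ne_zero hp (by omega) (by omega)

/-- The factor ⟨p⟩ vanishes. With the convention 0⁻¹ = 0 this makes f^j/⟨j⟩! vanish for j ≥ p, in
agreement with F(j) = 0. -/
lemma qfac_eq_zero (hp : 2 ≤ p) {n : ℕ} (hn : p ≤ n) : qfac p n = 0 := by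
  have : NeZero p := ⟨by omega⟩
  rw [qfac, Finset.prod_eq_zero_iff]
  refine ⟨p - 1, by simp; omega, ?_⟩
  rw [qint_eq_zero_iff hp]
  exact ⟨1, by push_cast [show 1 ≤ p by omega]; ring⟩

lemma bichar_intCast [NeZero p] (m n : ℤ) :
    bichar p (m : ZMod (4 * p)) (n : ZMod (4 * p)) =
      Complex.exp (Complex.I * Real.pi * (m * n) / (2 * p)) := by
  have hp : (p : ℂ) ≠ 0 := Nat.cast_ne_zero.2 (NeZero.ne p)
  have key : ∀ k : ℤ, ∃ c : ℤ, ((((k : ZMod (4 * p)).val : ℤ)) : ℂ) = k + 4 * p * c := by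
    intro k
    refine ⟨-(k / (4 * p : ℕ)), ?_⟩
    rw [ZMod.val_intCast, Int.emod_def]
    push_cast
    ring
  obtain ⟨c, hc⟩ := key m
  obtain ⟨e, he⟩ := key n
  rw [bichar, Complex.exp_eq_exp_iff_exists_int]
  push_cast at hc he
  rw [hc, he]
  -- Replacing m, n by m + 4pc, n + 4pe changes mn/2 by 2p times this integer, and q^{2p} = 1: the
  -- charge group ℤ/4p is just large enough for q^{αβ/2} to be well defined.
  refine ⟨m * e + n * c + 4 * p * c * e, ?_⟩
  push_cast
  field_simp
  ring

/-- Every braiding in the axioms and in tensor products has an F(k) as one of its factors, so only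
integral powers of q ever appear. -/
lemma bichar_neg_two_mul [NeZero p] (k n : ℤ) :
    bichar p ((-2 * k : ℤ) : ZMod (4 * p)) (n : ZMod (4 * p)) = q p ^ (-(k * n)) := by
  have hp : (p : ℂ) ≠ 0 := Nat.cast_ne_zero.2 (NeZero.ne p)
  rw [bichar_intCast, q_zpow]
  congr 1
  push_cast
  field_simp

lemma bichar_comm (α β : ZMod (4 * p)) : bichar p α β = bichar p β α := by
  simp only [bichar, mul_comm]

/-! ### The braiding on homogeneous vectors -/

section Homog

variable {V W : Type} [AddCommGroup V] [Module ℂ V] [AddCommGroup W] [Module ℂ W]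

/-- `v` has charge `α` with respect to the projections `π`. -/
def Homog (π : ZMod (4 * p) → V →ₗ[ℂ] V) (α : ZMod (4 * p)) (v : V) : Prop :=
  ∀ β, π β v = if β = α then v else 0

lemma Homog.self {π : ZMod (4 * p) → V →ₗ[ℂ] V} {α : ZMod (4 * p)} {v : V}
    (h : Homog π α v) : π α v = v := by simpa using h α

lemma braid_tmul [NeZero p] {πV : ZMod (4 * p) → V →ₗ[ℂ] V} {πW : ZMod (4 * p) → W →ₗ[ℂ] W}
    {α β : ZMod (4 * p)} {v : V} {w : W} (hv : Homog πV α v) (hw : Homog πW β w) :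
    braid πV πW (v ⊗ₜ[ℂ] w) = bichar p α β • w ⊗ₜ[ℂ] v := by
  simp only [braid, LinearMap.sum_apply, LinearMap.smul_apply, LinearMap.comp_apply,
    TensorProduct.map_tmul, hv _, hw _]
  rw [Finset.sum_eq_single α, Finset.sum_eq_single β]
  · simp
  · intro b _ hb; simp [hb]
  · simp
  · intro a _ ha; simp [ha]
  · simp

lemma midBraid_tmul [NeZero p] {A D : Type} [AddCommGroup A] [Module ℂ A] [AddCommGroup D]
    [Module ℂ D] {πV : ZMod (4 * p) → V →ₗ[ℂ] V} {πW : ZMod (4 * p) → W →ₗ[ℂ] W}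
    {α β : ZMod (4 * p)} {v : V} {w : W} (hv : Homog πV α v) (hw : Homog πW β w) (a : A) (e : D) :
    midBraid A D πV πW ((a ⊗ₜ[ℂ] v) ⊗ₜ[ℂ] (w ⊗ₜ[ℂ] e)) =
      bichar p α β • (a ⊗ₜ[ℂ] w) ⊗ₜ[ℂ] (v ⊗ₜ[ℂ] e) := by
  simp only [midBraid, LinearMap.comp_apply, LinearEquiv.coe_coe, TensorProduct.assoc_tmul,
    LinearMap.lTensor_tmul, TensorProduct.assoc_symm_tmul, LinearMap.rTensor_tmul,
    braid_tmul hv hw, ← TensorProduct.smul_tmul', TensorProduct.tmul_smul, map_smul]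

end Homog

/-! ### The basis of the Nichols algebra -/

lemma F_eq_single (j : Fin p) : Nich.F p j = Pi.single j 1 := by
  ext i
  simp [Nich.F, Pi.single_apply, Fin.ext_iff]

lemma F_eq_zero {r : ℕ} (hr : p ≤ r) : Nich.F p r = 0 := by
  ext i
  have := i.2
  simp [Nich.F]
  omega

lemma basisFun_constr_single {ι : Type} [Fintype ι] [DecidableEq ι] {V : Type} [AddCommGroup V]
    [Module ℂ V] (g : ι → V) (i : ι) :
    (Pi.basisFun ℂ ι).constr ℂ g (Pi.single i 1) = g i := by
  rw [← Pi.basisFun_apply, Module.Basis.constr_basis]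

lemma nich_tensor_ext {V W : Type} [AddCommGroup V] [Module ℂ V] [AddCommGroup W] [Module ℂ W]
    {g h : Nich p ⊗[ℂ] V →ₗ[ℂ] W}
    (H : ∀ j < p, ∀ v, g (Nich.F p j ⊗ₜ[ℂ] v) = h (Nich.F p j ⊗ₜ[ℂ] v)) : g = h := by
  refine TensorProduct.ext ((Pi.basisFun ℂ (Fin p)).ext fun j => LinearMap.ext fun v => ?_)
  simpa [F_eq_single] using H j j.2 v

lemma projOf_single {ι : Type} [Fintype ι] [DecidableEq ι] (deg : ι → ZMod (4 * p))
    (α : ZMod (4 * p)) (i : ι) :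
    projOf deg α (Pi.single i 1) = if deg i = α then Pi.single i 1 else 0 :=
  basisFun_constr_single _ i

lemma homog_F (r : ℕ) : Homog (Nich.proj p) ((-2 * (r : ℤ) : ℤ) : ZMod (4 * p)) (Nich.F p r) := by
  intro β
  rcases lt_or_ge r p with h | h
  · have := projOf_single (p := p) (fun r : Fin p => ((-2 * (r.val : ℤ) : ℤ) : ZMod (4 * p)))
      β ⟨r, h⟩
    rw [← F_eq_single] at this
    simp only [Nich.proj, this, eq_comm]
  · simp [F_eq_zero h]

lemma mul_F (r s : ℕ) :
    Nich.mul p (Nich.F p r ⊗ₜ[ℂ] Nich.F p s) = qbinom p r s • Nich.F p (r + s) := by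
  rcases lt_or_ge r p with hr | hr
  · rcases lt_or_ge s p with hs | hs
    · have h1 := F_eq_single (⟨r, hr⟩ : Fin p)
      have h2 := F_eq_single (⟨s, hs⟩ : Fin p)
      simp only at h1 h2
      rw [Nich.mul, TensorProduct.lift.tmul, h1, h2, basisFun_constr_single,
        basisFun_constr_single]
    · rw [F_eq_zero hs, F_eq_zero (show p ≤ r + s by omega)]; simp
  · rw [F_eq_zero hr, F_eq_zero (show p ≤ r + s by omega)]; simp

lemma comul_F {n : ℕ} (hn : n < p) : Nich.comul p (Nich.F p n) =
    ∑ x ∈ Finset.HasAntidiagonal.antidiagonal n, Nich.F p x.1 ⊗ₜ[ℂ] Nich.F p x.2 := by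
  have h1 := F_eq_single (⟨n, hn⟩ : Fin p)
  simp only at h1
  rw [h1, Nich.comul, basisFun_constr_single]
  exact (Finset.Nat.sum_antidiagonal_eq_sum_range_succ
    (fun i j => Nich.F p i ⊗ₜ[ℂ] Nich.F p j) n).symm

lemma counit_F [NeZero p] (n : ℕ) : Nich.counit p (Nich.F p n) = if n = 0 then 1 else 0 := by
  rcases lt_or_ge n p with hn | hn
  · have h1 := F_eq_single (⟨n, hn⟩ : Fin p)
    simp only at h1
    rw [h1, Nich.counit, basisFun_constr_single]
  · rw [F_eq_zero hn, if_neg (by have := NeZero.pos p; omega), map_zero]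

section Coeff

variable {V : Type} [AddCommGroup V] [Module ℂ V]

lemma coeff_F_tmul (j : Fin p) (r : ℕ) (v : V) :
    coeff V j (Nich.F p r ⊗ₜ[ℂ] v) = if j.val = r then v else 0 := by
  simp [coeff, Nich.F]

lemma sum_F_tmul_coeff (z : Nich p ⊗[ℂ] V) :
    ∑ j : Fin p, Nich.F p j ⊗ₜ[ℂ] coeff V j z = z := by
  have : ∑ j : Fin p, TensorProduct.mk ℂ (Nich p) V (Nich.F p j) ∘ₗ coeff V j =
      LinearMap.id := by
    apply nich_tensor_ext
    intro j hj v
    simp only [LinearMap.sum_apply, LinearMap.comp_apply, coeff_F_tmul, TensorProduct.mk_apply]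
    rw [Finset.sum_eq_single ⟨j, hj⟩]
    · simp
    · intro b _ hb
      rw [if_neg (fun h => hb (Fin.ext h)), TensorProduct.tmul_zero]
    · simp
  simpa using LinearMap.congr_fun this z

lemma coeff_ext {z z' : Nich p ⊗[ℂ] V} (h : ∀ j, coeff V j z = coeff V j z') : z = z' := by
  rw [← sum_F_tmul_coeff z, ← sum_F_tmul_coeff z']
  simp [h]

end Coeff

/-! ### Divided powers -/

section DividedPowers

variable {V : Type} [AddCommGroup V] [Module ℂ V]

/-- The divided power `f^j/⟨j⟩!`, which is `0` for `j ≥ p`. -/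
def dpow (p : ℕ) (f : Module.End ℂ V) (j : ℕ) : Module.End ℂ V := (qfac p j)⁻¹ • f ^ j

@[simp] lemma dpow_zero (f : Module.End ℂ V) : dpow p f 0 = 1 := by simp [dpow]

lemma dpow_eq_zero (hp : 2 ≤ p) (f : Module.End ℂ V) {j : ℕ} (hj : p ≤ j) : dpow p f j = 0 := by
  simp [dpow, qfac_eq_zero hp hj]

lemma dpow_mul_self (f : Module.End ℂ V) (j : ℕ) : dpow p f j * f = f * dpow p f j := by
  simp [dpow, ← pow_succ, ← pow_succ']

/-- The nilpotency is needed for j + 1 = p, where the left side is f^p/⟨p−1⟩! and the right side is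
zero by convention. -/
lemma mul_dpow (hp : 2 ≤ p) {f : Module.End ℂ V} (hf : f ^ p = 0) (j : ℕ) :
    f * dpow p f j = qint p (j + 1) • dpow p f (j + 1) := by
  rw [dpow, dpow, mul_smul_comm, ← pow_succ', smul_smul]
  rcases lt_or_ge (j + 1) p with h | h
  · rw [qfac_succ]
    have h1 : qint p (j + 1) ≠ 0 := qint_ne_zero hp (by omega) (by omega)
    rw [mul_inv, mul_comm, mul_assoc, inv_mul_cancel₀ h1, mul_one]
  · rw [pow_eq_zero_of_le h hf, smul_zero, smul_zero]

lemma actOf_F (hp : 2 ≤ p) (f : Module.End ℂ V) (j : ℕ) (v : V) :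
    actOf p f (Nich.F p j ⊗ₜ[ℂ] v) = dpow p f j v := by
  rcases lt_or_ge j p with h | h
  · have h1 := F_eq_single (⟨j, h⟩ : Fin p)
    simp only at h1
    rw [actOf, TensorProduct.lift.tmul, h1, basisFun_constr_single, dpow]
  · rw [F_eq_zero h, dpow_eq_zero hp f h]; simp

lemma coactOf_apply (d : Module.End ℂ V) (v : V) :
    coactOf p d v = ∑ j ∈ Finset.range p, Nich.F p j ⊗ₜ[ℂ] (d ^ j) v := by
  rw [Finset.sum_range fun j => Nich.F p j ⊗ₜ[ℂ] (d ^ j) v]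
  simp [coactOf]

lemma coeff_coactOf (d : Module.End ℂ V) (j : Fin p) (v : V) :
    coeff V j (coactOf p d v) = (d ^ j.val) v := by
  simp only [coactOf_apply, map_sum, coeff_F_tmul]
  rw [Finset.sum_ite_eq]
  simp

/-- The `q`-binomial theorem in terms of divided powers. -/
lemma add_mul_sum_dpow (hp : 2 ≤ p) {A B : Module.End ℂ V} (hA : A ^ p = 0) (hB : B ^ p = 0)
    (h : B * A = Q p 1 • (A * B)) (N : ℕ) :
    (A + B) * ∑ x ∈ Finset.HasAntidiagonal.antidiagonal N, dpow p A x.1 * dpow p B x.2 =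
      qint p (N + 1) • ∑ x ∈ Finset.HasAntidiagonal.antidiagonal (N + 1), dpow p A x.1 * dpow p B x.2 := by
  have hBA : ∀ i : ℕ, B * A ^ i = Q p i • (A ^ i * B) := by
    intro i
    induction i with
    | zero => simp
    | succ i ih =>
      rw [pow_succ, ← mul_assoc, ih, smul_mul_assoc, mul_assoc, h, mul_smul_comm, smul_smul,
        mul_assoc]
      push_cast
      rw [Q_add]
  have hBd : ∀ i : ℕ, B * dpow p A i = Q p i • (dpow p A i * B) := by
    intro i
    rw [dpow, mul_smul_comm, hBA, smul_mul_assoc, smul_comm]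
  -- The sum over the longer antidiagonal has one additional point, whose coefficient is ⟨0⟩ = 0.
  have e1 : A * ∑ x ∈ Finset.HasAntidiagonal.antidiagonal N, dpow p A x.1 * dpow p B x.2 =
      ∑ x ∈ Finset.HasAntidiagonal.antidiagonal (N + 1), qint p x.1 • (dpow p A x.1 * dpow p B x.2) := by
    rw [Finset.Nat.sum_antidiagonal_succ, Finset.mul_sum]
    simp only [CharP.cast_eq_zero, qint_zero, zero_smul, zero_add]
    refine Finset.sum_congr rfl fun x _ => ?_
    rw [← mul_assoc, mul_dpow hp hA, smul_mul_assoc]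
    push_cast
    rfl
  have e2 : B * ∑ x ∈ Finset.HasAntidiagonal.antidiagonal N, dpow p A x.1 * dpow p B x.2 =
      ∑ x ∈ Finset.HasAntidiagonal.antidiagonal (N + 1),
        (Q p x.1 * qint p x.2) • (dpow p A x.1 * dpow p B x.2) := by
    rw [Finset.Nat.sum_antidiagonal_succ', Finset.mul_sum]
    simp only [CharP.cast_eq_zero, qint_zero, mul_zero, zero_smul, zero_add]
    refine Finset.sum_congr rfl fun x _ => ?_
    rw [← mul_assoc, hBd, smul_mul_assoc, mul_assoc, mul_dpow hp hB, mul_smul_comm, smul_smul]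
    push_cast
    rfl
  rw [add_mul, e1, e2, ← Finset.sum_add_distrib, Finset.smul_sum]
  refine Finset.sum_congr rfl fun x hx => ?_
  -- ⟨i⟩ + q^{2i}⟨j⟩ = ⟨i+j⟩ is constant along the antidiagonal.
  rw [← add_smul, ← qint_add]
  rw [Finset.HasAntidiagonal.mem_antidiagonal] at hx
  congr 2
  exact_mod_cast hx

lemma sum_dpow_eq (hp : 2 ≤ p) {A B : Module.End ℂ V} (hA : A ^ p = 0) (hB : B ^ p = 0)
    (h : B * A = Q p 1 • (A * B)) {N : ℕ} (hN : N ≤ p) :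
    (A + B) ^ N =
      qfac p N • ∑ x ∈ Finset.HasAntidiagonal.antidiagonal N, dpow p A x.1 * dpow p B x.2 := by
  induction N with
  | zero => simp
  | succ N ih =>
    rw [pow_succ', ih (by omega), mul_smul_comm, add_mul_sum_dpow hp hA hB h, smul_smul,
      qfac_succ]

/-- The case N = p of the binomial formula, whose prefactor ⟨p⟩! vanishes. -/
lemma add_pow_eq_zero (hp : 2 ≤ p) {A B : Module.End ℂ V} (hA : A ^ p = 0) (hB : B ^ p = 0)
    (h : B * A = Q p 1 • (A * B)) : (A + B) ^ p = 0 := by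
  rw [sum_dpow_eq hp hA hB h le_rfl, qfac_eq_zero hp le_rfl, zero_smul]

lemma dpow_add (hp : 2 ≤ p) {A B : Module.End ℂ V} (hA : A ^ p = 0) (hB : B ^ p = 0)
    (h : B * A = Q p 1 • (A * B)) {N : ℕ} (hN : N < p) :
    dpow p (A + B) N = ∑ x ∈ Finset.HasAntidiagonal.antidiagonal N, dpow p A x.1 * dpow p B x.2 := by
  rw [dpow, sum_dpow_eq hp hA hB h hN.le, smul_smul, inv_mul_cancel₀ (qfac_ne_zero hp hN),
    one_smul]

end DividedPowers

/-! ### Divided powers indexed by the integers -/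

section IntegerDividedPowers

variable {V : Type} [AddCommGroup V] [Module ℂ V]

/-- The divided power `f^j/⟨j⟩!`, which is `0` for `j < 0` and for `j ≥ p`. -/
def dpowz (p : ℕ) (f : Module.End ℂ V) (j : ℤ) : Module.End ℂ V :=
  if j < 0 then 0 else dpow p f j.toNat

@[simp] lemma dpowz_natCast (f : Module.End ℂ V) (j : ℕ) : dpowz p f j = dpow p f j := by
  simp [dpowz]

lemma dpowz_of_neg (f : Module.End ℂ V) {j : ℤ} (hj : j < 0) : dpowz p f j = 0 := if_pos hj

/-- Integer indices spare the sums below their boundary cases: terms outside the range are zero, and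
at j = −1 the coefficient ⟨0⟩ removes the term of index 0. -/
lemma mul_dpowz (hp : 2 ≤ p) {f : Module.End ℂ V} (hf : f ^ p = 0) (j : ℤ) :
    f * dpowz p f j = qint p (j + 1) • dpowz p f (j + 1) := by
  rcases lt_or_ge j 0 with h | h
  · rw [dpowz_of_neg f h, mul_zero]
    rcases eq_or_ne j (-1) with rfl | h1
    · simp
    · rw [dpowz_of_neg f (show j + 1 < 0 by omega), smul_zero]
  · lift j to ℕ using h
    have := mul_dpow hp hf j
    rw [dpowz_natCast, this]
    norm_cast

end IntegerDividedPowers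

/-! ### Yetter--Drinfeld modules given by a pair of operators -/

/-- The action and coaction on a graded space are given by the operators `f` and `d`, whose
commutation relation is that of a Yetter--Drinfeld module. -/
structure IsOps [NeZero p] {V : Type} [AddCommGroup V] [Module ℂ V]
    (π : ZMod (4 * p) → V →ₗ[ℂ] V) (act : Nich p ⊗[ℂ] V →ₗ[ℂ] V)
    (coact : V →ₗ[ℂ] Nich p ⊗[ℂ] V) (f d : Module.End ℂ V) : Prop where
  proj_comp : ∀ α β, π α ∘ₗ π β = if α = β then π α else 0
  proj_sum : ∑ α, π α = LinearMap.id
  act_eq : act = actOf p f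
  coact_eq : coact = coactOf p d
  f_proj : ∀ α, f ∘ₗ π α = π (α - 2) ∘ₗ f
  d_proj : ∀ α, d ∘ₗ π α = π (α + 2) ∘ₗ d
  f_pow : f ^ p = 0
  d_pow : d ^ p = 0
  rel : ∀ (n : ℤ) (y : V), π n y = y → d (f y) = Q p 1 • f (d y) + (1 - Q p (-n)) • y

/-- The structure of `Y` is given by the operators `f` and `d`. -/
abbrev HasOps [NeZero p] (Y : YDData p) (f d : Module.End ℂ Y.carrier) : Prop :=
  IsOps Y.proj Y.act Y.coact f d

namespace HasOps

variable [NeZero p] {Y : YDData p} {f d : Module.End ℂ Y.carrier} (h : HasOps Y f d)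
include h

lemma homog_proj (α : ZMod (4 * p)) (y : Y.carrier) : Homog Y.proj α (Y.proj α y) := by
  intro β
  have := LinearMap.congr_fun (h.proj_comp β α) y
  simp only [LinearMap.comp_apply] at this
  rw [this]
  split_ifs with hβ
  · rw [hβ]
  · rfl

lemma homog_of_proj {α : ZMod (4 * p)} {y : Y.carrier} (hy : Y.proj α y = y) :
    Homog Y.proj α y := by
  rw [← hy]; exact h.homog_proj α y

lemma sum_proj (y : Y.carrier) : ∑ α, Y.proj α y = y := by
  simpa using LinearMap.congr_fun h.proj_sum y

/-- Two linear maps agree if they agree on the homogeneous vectors. -/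
lemma ext_homog {W : Type} [AddCommGroup W] [Module ℂ W] {g g' : Y.carrier →ₗ[ℂ] W}
    (H : ∀ (n : ℤ) (y : Y.carrier), Y.proj n y = y → g y = g' y) : g = g' := by
  ext y
  rw [← h.sum_proj y, map_sum, map_sum]
  refine Finset.sum_congr rfl fun α _ => ?_
  obtain ⟨n, rfl⟩ := ZMod.intCast_surjective α
  exact H n _ (h.homog_proj _ y).self

lemma f_homog {n : ℤ} {y : Y.carrier} (hy : Y.proj n y = y) :
    Y.proj ((n - 2 : ℤ)) (f y) = f y := by
  have := LinearMap.congr_fun (h.f_proj n) y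
  simp only [LinearMap.comp_apply, hy] at this
  push_cast
  exact this.symm

lemma d_homog {n : ℤ} {y : Y.carrier} (hy : Y.proj n y = y) :
    Y.proj ((n + 2 : ℤ)) (d y) = d y := by
  have := LinearMap.congr_fun (h.d_proj n) y
  simp only [LinearMap.comp_apply, hy] at this
  push_cast
  exact this.symm

lemma f_pow_homog {n : ℤ} {y : Y.carrier} (hy : Y.proj n y = y) (j : ℕ) :
    Y.proj ((n - 2 * j : ℤ)) ((f ^ j) y) = (f ^ j) y := by
  induction j with
  | zero => simpa using hy
  | succ j ih =>
    rw [pow_succ', Module.End.mul_apply]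
    have := h.f_homog ih
    convert this using 3
    push_cast; ring

lemma d_pow_homog {n : ℤ} {y : Y.carrier} (hy : Y.proj n y = y) (j : ℕ) :
    Y.proj ((n + 2 * j : ℤ)) ((d ^ j) y) = (d ^ j) y := by
  induction j with
  | zero => simpa using hy
  | succ j ih =>
    rw [pow_succ', Module.End.mul_apply]
    have := h.d_homog ih
    convert this using 3
    push_cast; ring

/-- The commutation of `f` with a power of `d`. -/
lemma d_pow_f (hp : 2 ≤ p) {n : ℤ} {y : Y.carrier} (hy : Y.proj n y = y) (j : ℕ) :
    (d ^ (j + 1)) (f y) = Q p (j + 1) • f ((d ^ (j + 1)) y) +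
      (qint p (j + 1) * (1 - Q p (-n - j))) • (d ^ j) y := by
  induction j with
  | zero =>
    have h1 : qint p 1 = 1 := by
      rw [qint_eq]; exact div_self (sub_ne_zero.2 (Q_one_ne_one hp))
    simp [h.rel n y hy, h1]
  | succ j ih =>
    have hr := h.rel _ _ (h.d_pow_homog hy (j + 1))
    have hd : d ((d ^ j) y) = (d ^ (j + 1)) y := by rw [pow_succ']; rfl
    have hd' : d ((d ^ (j + 1)) y) = (d ^ (j + 1 + 1)) y := by rw [pow_succ' d (j + 1)]; rfl
    have hd2 : (d ^ (j + 1 + 1)) (f y) = d ((d ^ (j + 1)) (f y)) := by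
      rw [pow_succ' d (j + 1)]; rfl
    rw [hd2, ih, map_add, map_smul, map_smul, hr, hd, hd', smul_add,
      smul_smul, smul_smul, add_assoc, ← add_smul]
    congr 2
    · rw [← Q_add]; push_cast; ring_nf
    · have h0' := sub_ne_zero.2 (Q_one_ne_one hp)
      simp only [qint_eq]
      push_cast
      simp only [Q_add, Q_sub, Q_neg, two_mul, neg_add]
      have := Q_ne_zero p n
      have := Q_ne_zero p j
      have := Q_ne_zero p 1
      field_simp
      ring

/-- The commutation of `d` with a power of `f`. -/
lemma d_f_pow (hp : 2 ≤ p) {n : ℤ} {y : Y.carrier} (hy : Y.proj n y = y) (j : ℕ) :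
    d ((f ^ (j + 1)) y) = Q p (j + 1) • (f ^ (j + 1)) (d y) +
      (qint p (j + 1) * (1 - Q p (j - n))) • (f ^ j) y := by
  induction j with
  | zero =>
    have h1 : qint p 1 = 1 := by
      rw [qint_eq]; exact div_self (sub_ne_zero.2 (Q_one_ne_one hp))
    simp [h.rel n y hy, h1]
  | succ j ih =>
    have hr := h.rel _ _ (h.f_pow_homog hy (j + 1))
    have hf : f ((f ^ j) y) = (f ^ (j + 1)) y := by rw [pow_succ']; rfl
    have hf' : f ((f ^ (j + 1)) (d y)) = (f ^ (j + 1 + 1)) (d y) := by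
      rw [pow_succ' f (j + 1)]; rfl
    have hf2 : (f ^ (j + 1 + 1)) y = f ((f ^ (j + 1)) y) := by
      rw [pow_succ' f (j + 1)]; rfl
    rw [hf2, hr, ih, map_add, map_smul, map_smul, hf, hf', smul_add,
      smul_smul, smul_smul, add_assoc, ← add_smul]
    congr 2
    · rw [← Q_add]; push_cast; ring_nf
    · have h0' := sub_ne_zero.2 (Q_one_ne_one hp)
      simp only [qint_eq]
      push_cast
      simp only [Q_add, Q_sub, two_mul, neg_sub]
      have := Q_ne_zero p n
      have := Q_ne_zero p j
      have := Q_ne_zero p 1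
      field_simp
      ring

end HasOps

/-- A shift of the summation index, with ⟨k⟩/⟨k⟩! = 1/⟨k−1⟩!. The term k = p − 1 on the right has no
partner on the left, hence the assumption on `G`. -/
lemma sum_qint_mul_inv_qfac_smul (hp : 2 ≤ p) {V : Type} [AddCommGroup V] [Module ℂ V]
    (G : ℤ → V) (hG : G (p - 1) = 0) :
    ∑ k ∈ Finset.range p, (qint p k * (qfac p k)⁻¹) • G (k - 1) =
      ∑ k ∈ Finset.range p, (qfac p k)⁻¹ • G k := by
  obtain ⟨m, rfl⟩ : ∃ m, p = m + 1 := ⟨p - 1, by omega⟩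
  rw [Finset.sum_range_succ', Finset.sum_range_succ]
  simp only [Nat.cast_add, Nat.cast_one, add_sub_cancel_right] at hG
  rw [hG]
  simp only [CharP.cast_eq_zero, qint_zero, zero_mul, zero_smul, smul_zero, add_zero]
  refine Finset.sum_congr rfl fun k hk => ?_
  rw [Finset.mem_range] at hk
  have h1 : qint (m + 1) (k + 1) ≠ 0 := qint_ne_zero hp (by omega) (by push_cast; omega)
  rw [qfac_succ, mul_inv, mul_comm ((qfac (m + 1) k)⁻¹), ← mul_assoc]
  push_cast
  rw [mul_inv_cancel₀ h1, one_mul, add_sub_cancel_right]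

/-! ### Straightening: comparison of the two sides of the Yetter–Drinfeld axiom -/

namespace HasOps

variable [NeZero p] {Y : YDData p} {f d : Module.End ℂ Y.carrier}

/-- The coefficient of `F(m)` in the action of `F(n)` on the coaction of `y`. -/
def straight (Y : YDData p) (f d : Module.End ℂ Y.carrier) (n m : ℤ) (y : Y.carrier) :
    Y.carrier :=
  ∑ k ∈ Finset.range p, (Q p ((n - k) * (m - k)) * (qfac p k)⁻¹) •
    dpowz p f (n - k) (dpowz p d (m - k) y)

/-- The coefficient of `F(m)` in the braided coaction of the action of `F(n)` on a vector `y` of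
charge `c`. -/
def costraight (Y : YDData p) (f d : Module.End ℂ Y.carrier) (c n m : ℤ) (y : Y.carrier) :
    Y.carrier :=
  ∑ k ∈ Finset.range p, (Q p (-(k * (c + m - n))) * (qfac p k)⁻¹) •
    dpowz p d (m - k) (dpowz p f (n - k) y)

omit [NeZero p] in
-- Split ⟨n+1⟩ = ⟨k⟩ + q^{2k}⟨n−k+1⟩ in the k-th term. The second part is f applied to the k-th term
-- for n; the first part, after a shift of k, belongs to the sum for m − 1. The bound m < p makes
-- the boundary term of the shift vanish.
lemma straight_succ (hp : 2 ≤ p) (hf : f ^ p = 0) (n : ℤ) {m : ℤ} (hm : m < p)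
    (y : Y.carrier) : qint p (n + 1) • straight Y f d (n + 1) m y =
      Q p m • f (straight Y f d n m y) + straight Y f d n (m - 1) y := by
  have e := sum_qint_mul_inv_qfac_smul hp (fun k : ℤ => Q p ((n - k) * (m - 1 - k)) •
    dpowz p f (n - k) (dpowz p d (m - 1 - k) y))
    (by rw [dpowz_of_neg d (show m - 1 - ((p : ℤ) - 1) < 0 by omega)]; simp)
  simp only [smul_smul] at e
  have e2 : straight Y f d n (m - 1) y = ∑ k ∈ Finset.range p,
      (qint p k * (qfac p k)⁻¹ * Q p ((n - (k - 1)) * (m - 1 - (k - 1)))) •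
        dpowz p f (n - (k - 1)) (dpowz p d (m - 1 - (k - 1)) y) := by
    rw [e, straight]
    exact Finset.sum_congr rfl fun k _ => by rw [mul_comm]
  rw [e2, straight, straight, map_sum, Finset.smul_sum, Finset.smul_sum,
    ← Finset.sum_add_distrib]
  refine Finset.sum_congr rfl fun k _ => ?_
  have hk := LinearMap.congr_fun (mul_dpowz hp hf (n - k)) (dpowz p d (m - k) y)
  rw [Module.End.mul_apply, LinearMap.smul_apply] at hk
  rw [map_smul, hk, show n + 1 - (k : ℤ) = n - k + 1 by ring,
    show n - ((k : ℤ) - 1) = n - k + 1 by ring,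
    show m - 1 - ((k : ℤ) - 1) = m - k by ring, smul_smul, smul_smul, smul_smul, ← add_smul]
  congr 1
  rw [show n + 1 = k + (n - k + 1) by ring, qint_add,
    show (n - (k : ℤ) + 1) * (m - k) = (n - k) * (m - k) + m - k by ring, Q_sub, Q_add]
  have := Q_ne_zero p k
  field_simp
  ring

omit [NeZero p] in
-- The same splitting of ⟨n+1⟩. Here f acts before d, so the factor f is absorbed into the argument,
-- whose charge drops to c − 2.
lemma costraight_succ (hp : 2 ≤ p) (hf : f ^ p = 0) (c n : ℤ) {m : ℤ} (hm : m < p)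
    (y : Y.carrier) : qint p (n + 1) • costraight Y f d c (n + 1) m y =
      costraight Y f d (c - 2) n m (f y) +
        Q p (-(c + m - n - 1)) • costraight Y f d c n (m - 1) y := by
  have e := sum_qint_mul_inv_qfac_smul hp (fun k : ℤ => Q p (-(k * (c + (m - 1) - n))) •
    dpowz p d (m - 1 - k) (dpowz p f (n - k) y))
    (by rw [dpowz_of_neg d (show m - 1 - ((p : ℤ) - 1) < 0 by omega)]; simp)
  simp only [smul_smul] at e
  have e2 : costraight Y f d c n (m - 1) y = ∑ k ∈ Finset.range p,
      (qint p k * (qfac p k)⁻¹ * Q p (-((k - 1) * (c + (m - 1) - n)))) •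
        dpowz p d (m - 1 - (k - 1)) (dpowz p f (n - (k - 1)) y) := by
    rw [e, costraight]
    exact Finset.sum_congr rfl fun k _ => by rw [mul_comm]
  rw [e2, costraight, costraight, Finset.smul_sum, Finset.smul_sum, ← Finset.sum_add_distrib]
  refine Finset.sum_congr rfl fun k _ => ?_
  have hcomm : dpowz p f (n - k) * f = f * dpowz p f (n - k) := by
    rw [dpowz]; split_ifs
    · simp
    · exact dpow_mul_self f _
  have hk := LinearMap.congr_fun (hcomm.trans (mul_dpowz hp hf (n - k))) y
  rw [Module.End.mul_apply, LinearMap.smul_apply] at hk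
  rw [hk, show n + 1 - (k : ℤ) = n - k + 1 by ring,
    show n - ((k : ℤ) - 1) = n - k + 1 by ring,
    show m - 1 - ((k : ℤ) - 1) = m - k by ring, map_smul, smul_smul, smul_smul, smul_smul,
    ← add_smul]
  congr 1
  rw [show n + 1 = k + (n - k + 1) by ring, qint_add,
    show -((k : ℤ) * (c + m - (k + (n - k + 1)))) = -(k * (c - 2 + m - n)) - k by ring,
    show -(((k : ℤ) - 1) * (c + (m - 1) - n)) =
      -(k * (c - 2 + m - n)) - k + (c + m - n - 1) by ring, Q_add _ _ (c + m - n - 1), Q_sub, Q_neg _ (c + m - n - 1)]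
  have := Q_ne_zero p k
  have := Q_ne_zero p (c + m - n - 1)
  field_simp
  ring

variable (h : HasOps Y f d)
include h

lemma dpowz_d_f (hp : 2 ≤ p) {n : ℤ} {y : Y.carrier} (hy : Y.proj n y = y) {j : ℤ} (hj : j < p) :
    dpowz p d j (f y) = Q p j • f (dpowz p d j y) +
      (1 - Q p (-n - (j - 1))) • dpowz p d (j - 1) y := by
  rcases lt_trichotomy j 0 with h0 | rfl | h0
  · rw [dpowz_of_neg d h0, dpowz_of_neg d (show j - 1 < 0 by omega)]; simp
  · rw [dpowz_of_neg d (show (0 : ℤ) - 1 < 0 by omega), ← Nat.cast_zero, dpowz_natCast]; simp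
  · obtain ⟨i, rfl⟩ : ∃ i : ℕ, j = (i : ℤ) + 1 := ⟨(j - 1).toNat, by omega⟩
    have hq : qint p (i + 1) ≠ 0 := qint_ne_zero hp (by omega) hj
    have h1 : dpowz p d ((i : ℤ) + 1) = dpow p d (i + 1) := by
      rw [← dpowz_natCast]; norm_cast
    rw [add_sub_cancel_right, h1, dpowz_natCast, dpow, dpow, LinearMap.smul_apply,
      LinearMap.smul_apply, LinearMap.smul_apply, h.d_pow_f hp hy i, smul_add, map_smul, smul_smul,
      smul_smul, smul_smul, smul_smul, qfac_succ]
    congr 2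
    · ring
    · field_simp

/-- The commutation relation pushed through all divided powers of d. It brings the recursion of
`costraight`, which involves the value at f y, into the form of that of `straight`. -/
lemma straight_comm (hp : 2 ≤ p) {c : ℤ} {y : Y.carrier} (hy : Y.proj c y = y) (n : ℤ) {m : ℤ}
    (hm : m < p) : straight Y f d n m (f y) = Q p m • f (straight Y f d n m y) +
      (1 - Q p (-(c + m - n - 1))) • straight Y f d n (m - 1) y := by
  have e := sum_qint_mul_inv_qfac_smul hp (fun k : ℤ =>
    (Q p ((n - k) * (m - 1 - k)) * (1 - Q p (n - k))) •
    dpowz p f (n - k) (dpowz p d (m - 1 - k) y))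
    (by rw [dpowz_of_neg d (show m - 1 - ((p : ℤ) - 1) < 0 by omega)]; simp)
  simp only [smul_smul] at e
  have e3 : (1 - Q p (-(c + m - n - 1))) • straight Y f d n (m - 1) y =
      (∑ k ∈ Finset.range p, (Q p ((n - k) * (m - k)) * (qfac p k)⁻¹ *
        (1 - Q p (-c - (m - k - 1)))) • dpowz p f (n - k) (dpowz p d (m - k - 1) y)) +
      ∑ k ∈ Finset.range p, ((qfac p k)⁻¹ *
        (Q p ((n - k) * (m - 1 - k)) * (1 - Q p (n - k)))) •
          dpowz p f (n - k) (dpowz p d (m - 1 - k) y) := by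
    rw [straight, Finset.smul_sum, ← Finset.sum_add_distrib]
    refine Finset.sum_congr rfl fun k _ => ?_
    rw [show m - (k : ℤ) - 1 = m - 1 - k by ring, smul_smul, ← add_smul]
    congr 1
    rw [show (n - (k : ℤ)) * (m - k) = (n - k) * (m - 1 - k) + (n - k) by ring, Q_add,
      show -(c + m - n - 1) = (-c - (m - 1 - k)) + (n - k) by ring, Q_add _ (-c - (m - 1 - k))]
    ring
  -- The coefficient 1 − q^{−2(c+m−n−1)} is the commutator contribution plus a multiple of 1 −
  -- q^{2(n−k)}; `e` shifts the latter to the index of the main terms.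
  rw [e3, ← e, straight, straight, map_sum, Finset.smul_sum, ← Finset.sum_add_distrib,
    ← Finset.sum_add_distrib]
  refine Finset.sum_congr rfl fun k _ => ?_
  have hcomm : dpowz p f (n - k) * f = f * dpowz p f (n - k) := by
    rw [dpowz]; split_ifs
    · simp
    · exact dpow_mul_self f _
  have hk1 := LinearMap.congr_fun hcomm (dpowz p d (m - k) y)
  have hk2 := LinearMap.congr_fun (mul_dpowz hp h.f_pow (n - k)) (dpowz p d (m - k) y)
  rw [Module.End.mul_apply, Module.End.mul_apply] at hk1
  rw [Module.End.mul_apply, LinearMap.smul_apply] at hk2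
  rw [h.dpowz_d_f hp hy (show m - (k : ℤ) < p by omega), map_add, map_smul, map_smul, hk1,
    map_smul, hk2, show m - 1 - ((k : ℤ) - 1) = m - k by ring,
    show n - ((k : ℤ) - 1) = n - k + 1 by ring, smul_add, smul_smul, smul_smul, smul_smul,
    smul_smul, smul_smul, ← add_assoc, add_right_comm, ← add_smul]
  congr 2
  rw [← xi_mul_qint hp (n - k + 1),
    show (n - (k : ℤ) + 1) * (m - k) = (n - k) * (m - k) + (m - k) by ring, Q_add, Q_sub _ m k]
  have hx : xi p * qint p k = 1 - Q p k := xi_mul_qint hp k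
  have := Q_ne_zero p k
  field_simp
  linear_combination
    (-(Q p ((n - k) * (m - k)) * (qfac p k)⁻¹ * Q p m * qint p (n - k + 1))) * hx

/-- Induction on n. After `straight_comm` the two contributions at m − 1 have coefficients summing
to 1, which leaves exactly the recursion of `straight`. Dividing by ⟨n+1⟩ requires n + 1 < p. -/
lemma costraight_eq_straight (hp : 2 ≤ p) (n : ℕ) (hn : n < p) {c : ℤ} {y : Y.carrier}
    (hy : Y.proj c y = y) {m : ℤ} (hm : m < p) :
    costraight Y f d c n m y = straight Y f d n m y := by
  induction n generalizing c y m with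
  | zero =>
    refine Finset.sum_congr rfl fun k _ => ?_
    rcases Nat.eq_zero_or_pos k with rfl | hk
    · have : dpowz p f (((0 : ℕ) : ℤ) - ((0 : ℕ) : ℤ)) = 1 := by simp [dpowz]
      rw [this]
      simp
    · rw [dpowz_of_neg f (show ((0 : ℕ) : ℤ) - (k : ℤ) < 0 by omega)]
      simp
  | succ n ih =>
    have hq : qint p (n + 1) ≠ 0 := qint_ne_zero hp (by omega) (by omega)
    have e1 := costraight_succ hp h.f_pow (d := d) c n hm y
    have e2 := straight_succ hp h.f_pow (d := d) n hm y
    rw [ih (by omega) (h.f_homog hy) hm, ih (by omega) hy (by omega), h.straight_comm hp hy n hm,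
      add_assoc, ← add_smul, sub_add_cancel, one_smul, ← e2] at e1
    push_cast
    exact smul_right_injective _ hq e1

end HasOps

lemma sum_range_ite_eq_add {V : Type} [AddCommGroup V]
    (g : ℕ → V) {m : ℕ} (hm : m < p) (k : ℕ) :
    (∑ j ∈ Finset.range p, if m = j + k then g j else 0) = if k ≤ m then g (m - k) else 0 := by
  split_ifs with h
  · rw [Finset.sum_eq_single (m - k)]
    · rw [if_pos (by omega)]
    · intro b _ hb
      rw [if_neg (by omega)]
    · intro hb
      rw [Finset.mem_range] at hb
      omega
  · refine Finset.sum_eq_zero fun j _ => ?_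
    rw [if_neg (by omega)]

lemma pow_eq_qfac_smul_dpow (hp : 2 ≤ p) {V : Type} [AddCommGroup V] [Module ℂ V]
    (d : Module.End ℂ V) {j : ℕ} (hj : j < p) : d ^ j = qfac p j • dpow p d j := by
  rw [dpow, smul_smul, mul_inv_cancel₀ (qfac_ne_zero hp hj), one_smul]

lemma sum_antidiagonal_eq_sum_range {V : Type} [AddCommGroup V]
    {n : ℕ} (hn : n < p) (g : ℕ → ℕ → V) :
    ∑ x ∈ Finset.HasAntidiagonal.antidiagonal n, g x.1 x.2 =
      ∑ k ∈ Finset.range p, if k ≤ n then g k (n - k) else 0 := by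
  rw [Finset.Nat.sum_antidiagonal_eq_sum_range_succ g n, ← Finset.sum_filter]
  congr 1
  ext k
  simp only [Finset.mem_range, Finset.mem_filter]
  omega

/-- The map `(b ⊗ c) ⊗ y ↦ b ▸ y`, followed by the coaction and by multiplication with `c` from the
right, with the braidings that this requires. -/
def braidedCoact [NeZero p] (Y : YDData p) :
    (Nich p ⊗[ℂ] Nich p) ⊗[ℂ] Y.carrier →ₗ[ℂ] Nich p ⊗[ℂ] Y.carrier :=
  (Nich.mul p).rTensor Y.carrier ∘ₗ
  (TensorProduct.assoc ℂ (Nich p) (Nich p) Y.carrier).symm.toLinearMap ∘ₗ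
  (braid Y.proj (Nich.proj p)).lTensor (Nich p) ∘ₗ
  (TensorProduct.assoc ℂ (Nich p) Y.carrier (Nich p)).toLinearMap ∘ₗ
  (Y.coact ∘ₗ Y.act).rTensor (Nich p) ∘ₗ
  (TensorProduct.assoc ℂ (Nich p) Y.carrier (Nich p)).symm.toLinearMap ∘ₗ
  (braid (Nich.proj p) Y.proj).lTensor (Nich p) ∘ₗ
  (TensorProduct.assoc ℂ (Nich p) (Nich p) Y.carrier).toLinearMap

lemma nich_induction {P : Nich p → Prop} (hF : ∀ j < p, P (Nich.F p j)) (h0 : P 0)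
    (hadd : ∀ b c, P b → P c → P (b + c)) (hsmul : ∀ (r : ℂ) b, P b → P (r • b)) (b : Nich p) :
    P b := by
  rw [← (Pi.basisFun ℂ (Fin p)).sum_repr b]
  refine Finset.sum_induction _ P hadd h0 fun j _ => hsmul _ _ ?_
  rw [Pi.basisFun_apply, ← F_eq_single]
  exact hF j j.2

/-! ### The Yetter–Drinfeld axioms -/

namespace HasOps

variable [NeZero p] {Y : YDData p} {f d : Module.End ℂ Y.carrier} (h : HasOps Y f d)
include h

lemma act_F (hp : 2 ≤ p) (j : ℕ) (y : Y.carrier) :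
    Y.act (Nich.F p j ⊗ₜ[ℂ] y) = dpow p f j y := by rw [h.act_eq, actOf_F hp]

lemma coact_apply (y : Y.carrier) :
    Y.coact y = ∑ j ∈ Finset.range p, Nich.F p j ⊗ₜ[ℂ] (d ^ j) y := by
  rw [h.coact_eq, coactOf_apply]

lemma dpow_f_homog {n : ℤ} {y : Y.carrier} (hy : Y.proj n y = y) (j : ℕ) :
    Y.proj ((n - 2 * j : ℤ)) (dpow p f j y) = dpow p f j y := by
  rw [dpow, LinearMap.smul_apply, map_smul, h.f_pow_homog hy]

lemma yd_left (hp : 2 ≤ p) {n : ℕ} (hn : n < p) {c : ℤ} {y : Y.carrier} (hy : Y.proj c y = y)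
    (m : Fin p) :
    coeff Y.carrier m ((braidedCoact Y ∘ₗ (Nich.comul p).rTensor Y.carrier) (Nich.F p n ⊗ₜ[ℂ] y)) =
      qfac p m • costraight Y f d c n m y := by
  have hy' := h.homog_of_proj hy
  have key : ∀ i k : ℕ, i + k = n →
      coeff Y.carrier m (braidedCoact Y
      ((Nich.F p i ⊗ₜ[ℂ] Nich.F p k) ⊗ₜ[ℂ] y)) =
      qfac p m • ((Q p (-(k * (c + m - n))) * (qfac p k)⁻¹) •
    dpowz p d (m - k) (dpowz p f (n - k) y)) := by
    intro i k hik
    have hb : ∀ j : ℕ, braid Y.proj (Nich.proj p)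
        ((d ^ j) (dpow p f i y) ⊗ₜ[ℂ] Nich.F p k) =
        q p ^ (-(k * (c - 2 * i + 2 * j) : ℤ)) • Nich.F p k ⊗ₜ[ℂ] (d ^ j) (dpow p f i y) := by
      intro j
      rw [braid_tmul (h.homog_of_proj (h.d_pow_homog (h.dpow_f_homog hy i) j)) (homog_F k),
        bichar_comm, bichar_neg_two_mul]
    simp only [braidedCoact, LinearMap.comp_apply, LinearEquiv.coe_coe, TensorProduct.assoc_tmul,
      LinearMap.lTensor_tmul, braid_tmul (homog_F k) hy', bichar_neg_two_mul,
      TensorProduct.tmul_smul, map_smul, TensorProduct.assoc_symm_tmul, LinearMap.rTensor_tmul,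
      h.act_F hp, h.coact_apply, TensorProduct.sum_tmul, map_sum, hb, mul_F,
      ← TensorProduct.smul_tmul', coeff_F_tmul]
    have e : ∀ j ∈ Finset.range p, q p ^ (-(k * (c - 2 * i + 2 * j) : ℤ)) • qbinom p j k •
        (if (m : ℕ) = j + k then (d ^ j) (dpow p f i y) else 0) =
        if (m : ℕ) = j + k then (q p ^ (-(k * (c - 2 * i + 2 * j) : ℤ)) *
          (qfac p m * (qfac p k)⁻¹)) • dpow p d j (dpow p f i y) else 0 := by
      intro j hj
      rw [Finset.mem_range] at hj
      split_ifs with hm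
      · rw [pow_eq_qfac_smul_dpow hp d hj, LinearMap.smul_apply, smul_smul, smul_smul, qbinom,
          ← hm]
        congr 1
        have := qfac_ne_zero hp hj
        rw [mul_assoc, div_mul_eq_mul_div, mul_comm (qfac p j), mul_div_mul_right _ _ this, div_eq_mul_inv]
      · simp
    rw [Finset.sum_congr rfl e, sum_range_ite_eq_add _ m.2]
    have hi : dpowz p f ((n : ℤ) - k) = dpow p f i := by
      rw [← dpowz_natCast, ← hik]; push_cast; ring_nf
    rw [hi]
    split_ifs with hkm
    · have hj : dpowz p d ((m : ℤ) - k) = dpow p d (m - k) := by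
        rw [← dpowz_natCast]; push_cast [hkm]; rfl
      rw [hj, smul_smul, smul_smul]
      congr 1
      -- F(k) is braided twice: past y, of charge c, and back past d^j f^{(i)} y, of charge c − 2i +
      -- 2j. With i = n − k and j = m − k the two charges add up to 2(c + m − n).
      have hz : q p ^ (-((k : ℤ) * c)) * q p ^ (-(k * (c - 2 * i + 2 * ((m - k : ℕ) : ℤ)))) =
          Q p (-(k * (c + m - n))) := by
        rw [← zpow_add₀ (q_ne_zero p), Q]
        congr 1
        push_cast [hkm, ← hik]
        ring
      linear_combination (qfac p m * (qfac p k)⁻¹) * hz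
    · rw [dpowz_of_neg d (show (m : ℤ) - k < 0 by omega)]
      simp
  rw [LinearMap.comp_apply, LinearMap.rTensor_tmul, comul_F hn, TensorProduct.sum_tmul, map_sum, map_sum,
    ← Finset.Nat.sum_antidiagonal_swap, costraight, Finset.smul_sum]
  have := sum_antidiagonal_eq_sum_range hn (fun k _ =>
    qfac p m • ((Q p (-(k * (c + m - n))) * (qfac p k)⁻¹) •
    dpowz p d (m - k) (dpowz p f (n - k) y)))
  refine (Finset.sum_congr rfl fun x hx => ?_).trans (this.trans ?_)
  · rw [Finset.HasAntidiagonal.mem_antidiagonal] at hx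
    exact key x.2 x.1 (by omega)
  · refine Finset.sum_congr rfl fun k _ => ?_
    split_ifs with hk
    · rfl
    · rw [dpowz_of_neg f (show (n : ℤ) - k < 0 by omega)]
      simp

/-- The only braiding exchanges F(n−k) with F(m−k) and yields the factor q^{2(n−k)(m−k)}. -/
lemma yd_right (hp : 2 ≤ p) {n : ℕ} (hn : n < p) (y : Y.carrier) (m : Fin p) :
    coeff Y.carrier m ((TensorProduct.map (Nich.mul p) Y.act ∘ₗ
    midBraid (Nich p) Y.carrier (Nich.proj p) (Nich.proj p) ∘ₗ
    TensorProduct.map (Nich.comul p) Y.coact) (Nich.F p n ⊗ₜ[ℂ] y)) =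
      qfac p m • straight Y f d n m y := by
  have key : ∀ k i : ℕ, k + i = n →
      ∑ j ∈ Finset.range p, coeff Y.carrier m (TensorProduct.map (Nich.mul p) Y.act (
    midBraid (Nich p) Y.carrier (Nich.proj p) (Nich.proj p)
      ((Nich.F p k ⊗ₜ[ℂ] Nich.F p i) ⊗ₜ[ℂ] (Nich.F p j ⊗ₜ[ℂ] (d ^ j) y)))) =
      qfac p m • ((Q p ((n - k) * (m - k)) * (qfac p k)⁻¹) •
    dpowz p f (n - k) (dpowz p d (m - k) y)) := by
    intro k i hik
    have e : ∀ j ∈ Finset.range p, coeff Y.carrier m (TensorProduct.map (Nich.mul p) Y.act (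
    midBraid (Nich p) Y.carrier (Nich.proj p) (Nich.proj p)
      ((Nich.F p k ⊗ₜ[ℂ] Nich.F p i) ⊗ₜ[ℂ] (Nich.F p j ⊗ₜ[ℂ] (d ^ j) y)))) =
        if (m : ℕ) = j + k then (Q p (i * j) *
          (qfac p m * (qfac p k)⁻¹)) • dpow p f i (dpow p d j y) else 0 := by
      intro j hj
      rw [Finset.mem_range] at hj
      rw [midBraid_tmul (homog_F i) (homog_F j), bichar_neg_two_mul, map_smul,
        TensorProduct.map_tmul, mul_F, ← TensorProduct.smul_tmul', map_smul, map_smul,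
        coeff_F_tmul, add_comm k j, h.act_F hp]
      split_ifs with hm
      · rw [pow_eq_qfac_smul_dpow hp d hj, LinearMap.smul_apply, map_smul, smul_smul, smul_smul,
          qbinom, add_comm k j, ← hm, Q]
        congr 1
        have := qfac_ne_zero hp hj
        rw [show -((i : ℤ) * (-2 * j)) = 2 * (i * j) by ring]
        rw [mul_assoc, div_mul_eq_mul_div, mul_div_mul_right _ _ this, div_eq_mul_inv]
      · simp
    rw [Finset.sum_congr rfl e, sum_range_ite_eq_add _ m.2]
    have hi : dpowz p f ((n : ℤ) - k) = dpow p f i := by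
      rw [← dpowz_natCast, ← hik]; push_cast; ring_nf
    rw [hi]
    split_ifs with hkm
    · have hj : dpowz p d ((m : ℤ) - k) = dpow p d (m - k) := by
        rw [← dpowz_natCast]; push_cast [hkm]; rfl
      rw [hj, smul_smul]
      congr 1
      rw [← hik]
      push_cast [hkm]
      rw [add_sub_cancel_left]
      ring
    · rw [dpowz_of_neg d (show (m : ℤ) - k < 0 by omega)]
      simp
  rw [LinearMap.comp_apply, LinearMap.comp_apply, TensorProduct.map_tmul, comul_F hn,
    h.coact_apply, TensorProduct.sum_tmul, map_sum, map_sum, map_sum, straight, Finset.smul_sum]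
  simp only [TensorProduct.tmul_sum, map_sum]
  have := sum_antidiagonal_eq_sum_range hn (fun k _ =>
    qfac p m • ((Q p ((n - k) * (m - k)) * (qfac p k)⁻¹) •
    dpowz p f (n - k) (dpowz p d (m - k) y)))
  refine (Finset.sum_congr rfl fun x hx => ?_).trans (this.trans ?_)
  · rw [Finset.HasAntidiagonal.mem_antidiagonal] at hx
    exact key x.1 x.2 hx
  · refine Finset.sum_congr rfl fun k _ => ?_
    split_ifs with hk
    · rfl
    · rw [dpowz_of_neg f (show (n : ℤ) - k < 0 by omega)]
      simp

/-- The compatibility axiom is tested on F(n) ⊗ y with y homogeneous and compared coefficient by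
coefficient, where it becomes `costraight_eq_straight`. Associativity of the action and
coassociativity use f^p = 0 and d^p = 0 in the degrees from p on, where products of the F(i) vanish.
-/
theorem isYD (hp : 2 ≤ p) : IsYD Y where
  proj_comp := h.proj_comp
  proj_sum := h.proj_sum
  act_charge α β := by
    apply nich_tensor_ext
    intro j hj y
    obtain ⟨n, rfl⟩ := ZMod.intCast_surjective β
    simp only [LinearMap.comp_apply, TensorProduct.map_tmul]
    rw [homog_F j α]
    split_ifs with hα
    · rw [h.act_F hp, hα]
      have := h.dpow_f_homog (h.homog_proj n y).self j
      convert this using 2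
      push_cast; ring_nf
    · simp
  coact_charge γ := by
    obtain ⟨n, rfl⟩ := ZMod.intCast_surjective γ
    ext y
    simp only [LinearMap.comp_apply, h.coact_apply, LinearMap.sum_apply, map_sum,
      TensorProduct.map_tmul]
    refine Finset.sum_congr rfl fun j _ => ?_
    rw [Finset.sum_eq_single ((-2 * (j : ℤ) : ℤ) : ZMod (4 * p))]
    · rw [(homog_F j).self]
      congr 1
      have : ∀ j : ℕ, ∀ α y, (d ^ j) (Y.proj α y) = Y.proj (α + 2 * j) ((d ^ j) y) := by
        intro j
        induction j with
        | zero => intro α y; simp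
        | succ j ih =>
          intro α y
          have := LinearMap.congr_fun (h.d_proj α) y
          simp only [LinearMap.comp_apply] at this
          rw [pow_succ, Module.End.mul_apply, this, ih, Module.End.mul_apply]
          congr 2
          push_cast; ring
      rw [this]
      congr 2
      push_cast; ring
    · intro α _ hα
      rw [homog_F j α, if_neg hα, TensorProduct.zero_tmul]
    · simp
  one_act y := by rw [h.act_F hp]; simp
  mul_act b c y := by
    induction b using nich_induction with
    | h0 => simp
    | hadd b b' hb hb' => simp only [TensorProduct.add_tmul, map_add, hb, hb']
    | hsmul r b hb => simp only [← TensorProduct.smul_tmul', map_smul, hb]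
    | hF i hi =>
      induction c using nich_induction with
      | h0 => simp
      | hadd c c' hc hc' =>
        simp only [TensorProduct.add_tmul, TensorProduct.tmul_add, map_add, hc, hc']
      | hsmul r c hc =>
        simp only [← TensorProduct.smul_tmul', TensorProduct.tmul_smul, map_smul, hc]
      | hF j hj =>
        rw [mul_F, ← TensorProduct.smul_tmul', map_smul, h.act_F hp, h.act_F hp, h.act_F hp]
        rcases lt_or_ge (i + j) p with hij | hij
        · rw [dpow, dpow, dpow, LinearMap.smul_apply, LinearMap.smul_apply, LinearMap.smul_apply,
            map_smul, smul_smul, smul_smul, pow_add, Module.End.mul_apply, qbinom]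
          congr 1
          have := qfac_ne_zero hp hij
          field_simp
        · rw [dpow_eq_zero hp f hij, dpow, dpow, LinearMap.smul_apply, LinearMap.smul_apply,
            map_smul, ← Module.End.mul_apply, ← pow_add, pow_eq_zero_of_le hij h.f_pow]
          simp
  counit_coact := by
    ext y
    simp only [LinearMap.comp_apply, h.coact_apply, map_sum, LinearMap.rTensor_tmul,
      counit_F, LinearEquiv.coe_coe, TensorProduct.lid_tmul]
    rw [Finset.sum_eq_single 0]
    · simp
    · intro b _ hb; simp [hb]
    · intro h0; simp at h0; omega
  coassoc := by
    ext y
    refine coeff_ext fun s => coeff_ext fun t => ?_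
    have e : ∀ j ∈ Finset.range p, coeff Y.carrier t (coeff (Nich p ⊗[ℂ] Y.carrier) s
        ((TensorProduct.assoc ℂ (Nich p) (Nich p) Y.carrier)
          (Nich.comul p (Nich.F p j) ⊗ₜ[ℂ] (d ^ j) y))) =
        if j = s + t then (d ^ j) y else 0 := by
      intro j hj
      rw [Finset.mem_range] at hj
      simp only [comul_F hj, TensorProduct.sum_tmul, map_sum, TensorProduct.assoc_tmul,
        coeff_F_tmul, apply_ite, map_zero]
      split_ifs with hst
      · rw [Finset.sum_eq_single (s.val, t.val)]
        · simp
        · rintro ⟨a, b⟩ _ hab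
          by_cases ha : s.val = a
          · rw [if_pos ha, if_neg (fun hb => hab (by rw [ha, hb]))]
          · rw [if_neg ha]
        · intro hn
          exact absurd (Finset.HasAntidiagonal.mem_antidiagonal.2 hst.symm) hn
      · refine Finset.sum_eq_zero fun x hx => ?_
        rw [Finset.HasAntidiagonal.mem_antidiagonal] at hx
        split_ifs with h1 h2
        · omega
        · rfl
        · rfl
    simp only [LinearMap.comp_apply, h.coact_apply, map_sum, LinearMap.rTensor_tmul,
      LinearEquiv.coe_coe, LinearMap.lTensor_tmul, TensorProduct.tmul_sum, coeff_F_tmul,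
      apply_ite, map_zero]
    rw [Finset.sum_congr rfl e, Finset.sum_ite_eq']
    rw [Finset.sum_eq_single s.val (fun b _ hb => by simp [Ne.symm hb]) (by simp)]
    simp only [Finset.sum_ite_eq, Finset.mem_range, t.2, if_true]
    split_ifs with hst
    · rw [add_comm, pow_add]; rfl
    · rw [← Module.End.mul_apply, ← pow_add, pow_eq_zero_of_le (by omega) h.d_pow]; rfl
  yetterDrinfeld := by
    refine nich_tensor_ext fun n hn y => ?_
    have := LinearMap.congr_fun (h.ext_homog
      (g := (braidedCoact Y ∘ₗ (Nich.comul p).rTensor Y.carrier) ∘ₗ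
        TensorProduct.mk ℂ (Nich p) Y.carrier (Nich.F p n))
      (g' := (TensorProduct.map (Nich.mul p) Y.act ∘ₗ
        midBraid (Nich p) Y.carrier (Nich.proj p) (Nich.proj p) ∘ₗ
        TensorProduct.map (Nich.comul p) Y.coact) ∘ₗ
        TensorProduct.mk ℂ (Nich p) Y.carrier (Nich.F p n)) ?_) y
    · exact this
    · intro c y hy
      refine coeff_ext fun m => ?_
      have e1 := h.yd_left hp hn hy m
      have e2 := h.yd_right hp hn y m
      rw [← h.costraight_eq_straight hp n hn hy (by omega), ← e1] at e2
      exact e2.symm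

end HasOps

/-! ### Operators on tensor products and submodules, and morphisms in terms of them -/

lemma Q_eq_of_cast_eq [NeZero p] {m n : ℤ} (h : (m : ZMod (4 * p)) = n) : Q p m = Q p n := by
  rw [Q_eq_Q_iff]
  rw [ZMod.intCast_eq_intCast_iff_dvd_sub] at h
  obtain ⟨c, hc⟩ := h
  exact ⟨-4 * c, by push_cast at hc; linarith⟩

/-- The operator that multiplies the vectors of charge `n` by `q^{-n}`. -/
def phase [NeZero p] (Y : YDData p) : Module.End ℂ Y.carrier :=
  ∑ α, bichar p ((-2 * (1 : ℤ) : ℤ) : ZMod (4 * p)) α • Y.proj α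

/-- The operator of a tensor product. -/
def tensorOp [NeZero p] {Y Z : YDData p} (f : Module.End ℂ Y.carrier)
    (f' : Module.End ℂ Z.carrier) : Module.End ℂ (Y.carrier ⊗[ℂ] Z.carrier) :=
  TensorProduct.map f LinearMap.id + TensorProduct.map (phase Y) f'

/-- The projections of a tensor product. -/
def tensorProj [NeZero p] (Y Z : YDData p) (γ : ZMod (4 * p)) :
    Y.carrier ⊗[ℂ] Z.carrier →ₗ[ℂ] Y.carrier ⊗[ℂ] Z.carrier :=
  ∑ α, TensorProduct.map (Y.proj α) (Z.proj (γ - α))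

/-- Morphisms in terms of the operators. -/
lemma isHom_of_ops [NeZero p] {Y Z : YDData p} {f d : Module.End ℂ Y.carrier}
    {f' d' : Module.End ℂ Z.carrier} (hY : HasOps Y f d) (hZ : HasOps Z f' d')
    {φ : Y.carrier →ₗ[ℂ] Z.carrier} (hp : 2 ≤ p) (h1 : ∀ α y, φ (Y.proj α y) = Z.proj α (φ y))
    (h2 : ∀ y, φ (f y) = f' (φ y)) (h3 : ∀ y, φ (d y) = d' (φ y)) : IsHom (Y := Y) (Z := Z) φ where
  proj α := LinearMap.ext fun y => h1 α y
  act := by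
    refine nich_tensor_ext fun j _ y => ?_
    have : ∀ j : ℕ, ∀ y, φ ((f ^ j) y) = (f' ^ j) (φ y) := by
      intro j
      induction j with
      | zero => simp
      | succ j ih => intro y; rw [pow_succ, pow_succ, Module.End.mul_apply, ih, h2]; rfl
    simp only [LinearMap.comp_apply, LinearMap.lTensor_tmul, hY.act_F hp, hZ.act_F hp, dpow,
      LinearMap.smul_apply, map_smul, this]
  coact := by
    ext y
    have : ∀ j : ℕ, ∀ y, φ ((d ^ j) y) = (d' ^ j) (φ y) := by
      intro j
      induction j with
      | zero => simp
      | succ j ih => intro y; rw [pow_succ, pow_succ, Module.End.mul_apply, ih, h3]; rfl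
    simp only [LinearMap.comp_apply, hY.coact_apply, hZ.coact_apply, map_sum,
      LinearMap.lTensor_tmul, this]

namespace HasOps

section Criteria

variable [NeZero p] {Y : YDData p} {f d : Module.End ℂ Y.carrier} (h : HasOps Y f d)
include h

lemma act_one (hp : 2 ≤ p) (y : Y.carrier) : Y.act (Nich.F p 1 ⊗ₜ[ℂ] y) = f y := by
  have h1 : qint p 1 = 1 := by
    rw [qint_eq]; exact div_self (sub_ne_zero.2 (Q_one_ne_one hp))
  rw [h.act_F hp, dpow]
  simp [qfac, h1]

lemma coeff_coact (j : Fin p) (y : Y.carrier) :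
    coeff Y.carrier j (Y.coact y) = (d ^ j.val) y := by
  rw [h.coact_eq, coeff_coactOf]

/-- F(j) acts by a multiple of f^j and the coefficient of F(j) in the coaction is d^j, so it
suffices to test j = 1. -/
lemma isSub_iff (hp : 2 ≤ p) (W : Submodule ℂ Y.carrier) : IsSub Y W ↔
    Graded Y W ∧ (∀ w ∈ W, f w ∈ W) ∧ ∀ w ∈ W, d w ∈ W := by
  constructor
  · rintro ⟨h1, h2, h3⟩
    refine ⟨h1, fun w hw => ?_, fun w hw => ?_⟩
    · rw [← h.act_one hp]; exact h2 _ w hw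
    · have := h3 ⟨1, by omega⟩ w hw
      rwa [h.coeff_coact, pow_one] at this
  · rintro ⟨h1, h2, h3⟩
    refine ⟨h1, fun b w hw => ?_, fun j w hw => ?_⟩
    · induction b using nich_induction with
      | hF j hj =>
        rw [h.act_F hp, dpow, LinearMap.smul_apply]
        refine W.smul_mem _ ?_
        clear hj
        induction j with
        | zero => simpa
        | succ j ih => rw [pow_succ', Module.End.mul_apply]; exact h2 _ ih
      | h0 => simp
      | hadd b c hb hc => rw [TensorProduct.add_tmul, map_add]; exact W.add_mem hb hc
      | hsmul r b hb => rw [← TensorProduct.smul_tmul', map_smul]; exact W.smul_mem _ hb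
    · rw [h.coeff_coact]
      generalize j.val = j
      induction j with
      | zero => simpa
      | succ j ih => rw [pow_succ', Module.End.mul_apply]; exact h3 _ ih

lemma actStable_iff (hp : 2 ≤ p) (W : Submodule ℂ Y.carrier) :
    ActStable Y W ↔ ∀ w ∈ W, f w ∈ W := by
  constructor
  · intro h2 w hw
    rw [← h.act_one hp]; exact h2 _ w hw
  · intro h2 b w hw
    induction b using nich_induction with
    | hF j hj =>
      rw [h.act_F hp, dpow, LinearMap.smul_apply]
      refine W.smul_mem _ ?_
      clear hj
      induction j with
      | zero => simpa
      | succ j ih => rw [pow_succ', Module.End.mul_apply]; exact h2 _ ih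
    | h0 => simp
    | hadd b c hb hc => rw [TensorProduct.add_tmul, map_add]; exact W.add_mem hb hc
    | hsmul r b hb => rw [← TensorProduct.smul_tmul', map_smul]; exact W.smul_mem _ hb

lemma coactStable_iff (hp : 2 ≤ p) (W : Submodule ℂ Y.carrier) :
    CoactStable Y W ↔ ∀ w ∈ W, d w ∈ W := by
  constructor
  · intro h3 w hw
    have := h3 ⟨1, by omega⟩ w hw
    rwa [h.coeff_coact, pow_one] at this
  · intro h3 j w hw
    rw [h.coeff_coact]
    generalize j.val = j
    induction j with
    | zero => simpa
    | succ j ih => rw [pow_succ', Module.End.mul_apply]; exact h3 _ ih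

lemma phase_apply {n : ℤ} {y : Y.carrier} (hy : Y.proj n y = y) :
    phase Y y = q p ^ (-n) • y := by
  have hy' := h.homog_of_proj hy
  simp only [phase, LinearMap.sum_apply, LinearMap.smul_apply, hy' _]
  rw [Finset.sum_eq_single (n : ZMod (4 * p))]
  · rw [bichar_neg_two_mul, if_pos rfl, one_mul]
  · intro b _ hb; simp [hb]
  · simp

/-- The action enters only through its values on pure tensors, where it is the restriction of the
ambient one. -/
lemma isOps_sub {W : Submodule ℂ Y.carrier} (hW : IsSub Y W)
    (hf : ∀ w ∈ W, f w ∈ W) (hd : ∀ w ∈ W, d w ∈ W) (act : Nich p ⊗[ℂ] W →ₗ[ℂ] W)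
    (hact : ∀ b w, (act (b ⊗ₜ[ℂ] w) : Y.carrier) = Y.act (b ⊗ₜ[ℂ] (w : Y.carrier)))
    (hp : 2 ≤ p) :
    IsOps (fun α => (Y.proj α).restrict (hW.graded α)) act
      (∑ j : Fin p, TensorProduct.mk ℂ (Nich p) W (Nich.F p j.val) ∘ₗ
        (coeff Y.carrier j ∘ₗ Y.coact).restrict (hW.coact j))
      (f.restrict hf) (d.restrict hd) where
  proj_comp α β := by
    ext w
    have := LinearMap.congr_fun (h.proj_comp α β) w
    simp only [LinearMap.comp_apply] at this
    simp only [LinearMap.comp_apply, LinearMap.coe_restrict_apply]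
    rw [this]
    split_ifs <;> rfl
  proj_sum := by
    ext w
    simpa using h.sum_proj w
  act_eq := by
    refine nich_tensor_ext fun j hj w => ?_
    apply Subtype.ext
    rw [actOf_F hp, dpow, hact, LinearMap.smul_apply, Module.End.pow_restrict]
    simp only [h.act_F hp, dpow]
    rfl
  coact_eq := by
    rw [coactOf]
    refine Finset.sum_congr rfl fun j _ => ?_
    congr 1
    rw [Module.End.pow_restrict]
    ext w
    simp [h.coeff_coact]
  f_proj α := by
    ext w
    exact LinearMap.congr_fun (h.f_proj α) w
  d_proj α := by
    ext w
    exact LinearMap.congr_fun (h.d_proj α) w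
  f_pow := by
    rw [Module.End.pow_restrict]
    ext w
    simp [h.f_pow]
  d_pow := by
    rw [Module.End.pow_restrict]
    ext w
    simp [h.d_pow]
  rel n y hy := by
    apply Subtype.ext
    exact h.rel n y (congrArg Subtype.val hy)

/-- The operators of a Yetter--Drinfeld submodule. -/
lemma sub (hp : 2 ≤ p) {W : Submodule ℂ Y.carrier} (hW : IsSub Y W)
    (hf : ∀ w ∈ W, f w ∈ W) (hd : ∀ w ∈ W, d w ∈ W) :
    HasOps (RankOneNichols.sub Y W hW) (f.restrict hf) (d.restrict hd) :=
  h.isOps_sub hW hf hd _ (fun _ _ => rfl) hp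

end Criteria

/-! ### The operators of a tensor product -/

section Tensor

variable [NeZero p] {Y Z : YDData p} {f d : Module.End ℂ Y.carrier}
  {f' d' : Module.End ℂ Z.carrier} (hY : HasOps Y f d) (hZ : HasOps Z f' d')
include hY hZ

lemma tensor_ext {V : Type} [AddCommGroup V] [Module ℂ V]
    {g g' : Y.carrier ⊗[ℂ] Z.carrier →ₗ[ℂ] V}
    (H : ∀ (m n : ℤ) (y : Y.carrier) (z : Z.carrier), Y.proj m y = y → Z.proj n z = z →
      g (y ⊗ₜ[ℂ] z) = g' (y ⊗ₜ[ℂ] z)) : g = g' := by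
  refine TensorProduct.ext (hY.ext_homog fun m y hy => hZ.ext_homog fun n z hz => ?_)
  exact H m n y z hy hz

lemma tensor_proj {m n : ℤ} {y : Y.carrier} {z : Z.carrier} (hy : Y.proj m y = y)
    (hz : Z.proj n z = z) : Homog (tensorProj Y Z) ((m + n : ℤ) : ZMod (4 * p))
      (y ⊗ₜ[ℂ] z) := by
  intro γ
  simp only [tensorProj, LinearMap.sum_apply, TensorProduct.map_tmul, hY.homog_of_proj hy _,
    hZ.homog_of_proj hz _]
  rw [Finset.sum_eq_single (m : ZMod (4 * p))]
  · push_cast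
    by_cases hγ : γ = m + n
    · simp [hγ]
    · rw [if_pos rfl, if_neg (show ¬γ - m = n from fun h => hγ (by rw [← h]; ring)),
        if_neg hγ, TensorProduct.tmul_zero]
  · intro b _ hb; simp [hb]
  · simp

omit hZ in
lemma tensorOp_tmul {m : ℤ} {y : Y.carrier} (hy : Y.proj m y = y) (z : Z.carrier)
    (g : Module.End ℂ Y.carrier) (g' : Module.End ℂ Z.carrier) :
    tensorOp g g' (y ⊗ₜ[ℂ] z) = g y ⊗ₜ[ℂ] z + q p ^ (-m) • y ⊗ₜ[ℂ] g' z := by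
  rw [tensorOp, LinearMap.add_apply, TensorProduct.map_tmul, TensorProduct.map_tmul,
    hY.phase_apply hy, ← TensorProduct.smul_tmul']
  rfl

omit hZ in
lemma phase_pow {a : ℤ} {y : Y.carrier} (hy : Y.proj a y = y) (j : ℕ) :
    (phase Y ^ j) y = q p ^ (-(j * a)) • y := by
  induction j with
  | zero => simp
  | succ j ih =>
    rw [pow_succ', Module.End.mul_apply, ih, map_smul, hY.phase_apply hy, smul_smul,
      ← zpow_add₀ (q_ne_zero p)]
    congr 2
    push_cast; ring

omit [NeZero p] hY hZ in
lemma pow_map_id (g : Module.End ℂ Y.carrier) (j : ℕ) :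
    (TensorProduct.map g LinearMap.id : Module.End ℂ (Y.carrier ⊗[ℂ] Z.carrier)) ^ j =
      TensorProduct.map (g ^ j) LinearMap.id := by
  rw [← Module.End.one_eq_id, TensorProduct.map_pow, one_pow]

omit hZ in
lemma phase_f (y : Y.carrier) : phase Y (f y) = Q p 1 • f (phase Y y) := by
  refine LinearMap.congr_fun (hY.ext_homog (g := phase Y ∘ₗ f) (g' := Q p 1 • (f ∘ₗ phase Y))
    fun n y hy => ?_) y
  rw [LinearMap.comp_apply, LinearMap.smul_apply, LinearMap.comp_apply,
    hY.phase_apply (hY.f_homog hy), hY.phase_apply hy, map_smul, smul_smul, Q,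
    ← zpow_add₀ (q_ne_zero p)]
  congr 2
  ring

omit hZ in
lemma phase_d (y : Y.carrier) : d (phase Y y) = Q p 1 • phase Y (d y) := by
  refine LinearMap.congr_fun (hY.ext_homog (g := d ∘ₗ phase Y) (g' := Q p 1 • (phase Y ∘ₗ d))
    fun n y hy => ?_) y
  rw [LinearMap.comp_apply, LinearMap.smul_apply, LinearMap.comp_apply,
    hY.phase_apply (hY.d_homog hy), hY.phase_apply hy, map_smul, smul_smul, Q,
    ← zpow_add₀ (q_ne_zero p)]
  congr 2
  ring

omit hZ in
-- f lowers the charge by 2, so the phase picks up q² when it is moved across f. This is the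
-- hypothesis of the q-binomial theorem.
lemma tensor_f_comm :
    (TensorProduct.map (phase Y) f' * TensorProduct.map f LinearMap.id :
      Module.End ℂ (Y.carrier ⊗[ℂ] Z.carrier)) =
      Q p 1 • (TensorProduct.map f LinearMap.id * TensorProduct.map (phase Y) f') := by
  refine TensorProduct.ext' fun y z => ?_
  rw [LinearMap.smul_apply, Module.End.mul_apply, Module.End.mul_apply, TensorProduct.map_tmul,
    TensorProduct.map_tmul, TensorProduct.map_tmul, TensorProduct.map_tmul, hY.phase_f,
    ← TensorProduct.smul_tmul']
  rfl

omit hZ in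
-- d raises the charge, so the order is opposite to that for f: in the binomial theorem the summand
-- K ⊗ d' now comes first.
lemma tensor_d_comm :
    (TensorProduct.map d LinearMap.id * TensorProduct.map (phase Y) d' :
      Module.End ℂ (Y.carrier ⊗[ℂ] Z.carrier)) =
      Q p 1 • (TensorProduct.map (phase Y) d' * TensorProduct.map d LinearMap.id) := by
  refine TensorProduct.ext' fun y z => ?_
  rw [LinearMap.smul_apply, Module.End.mul_apply, Module.End.mul_apply, TensorProduct.map_tmul,
    TensorProduct.map_tmul, TensorProduct.map_tmul, TensorProduct.map_tmul, hY.phase_d,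
    ← TensorProduct.smul_tmul']
  rfl

omit [NeZero p] hY hZ in
lemma map_id_pow_eq_zero {g : Module.End ℂ Y.carrier} (hg : g ^ p = 0) :
    (TensorProduct.map g LinearMap.id : Module.End ℂ (Y.carrier ⊗[ℂ] Z.carrier)) ^ p = 0 := by
  rw [← Module.End.one_eq_id, TensorProduct.map_pow, hg, TensorProduct.map_zero_left]

omit hY hZ in
lemma map_phase_pow_eq_zero {g : Module.End ℂ Z.carrier} (hg : g ^ p = 0) :
    (TensorProduct.map (phase Y) g : Module.End ℂ (Y.carrier ⊗[ℂ] Z.carrier)) ^ p = 0 := by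
  rw [TensorProduct.map_pow, hg, TensorProduct.map_zero_right]

/-- Letting F(n) act through Δ F(n) = ∑ F(i) ⊗ F(j) produces the q-binomial expansion of the n-th
divided power of f ⊗ 1 + K ⊗ f'; the braiding of F(j) with the first factor is the j-th power of the
phase. -/
lemma tensor_act (hp : 2 ≤ p) : TensorProduct.map Y.act Z.act ∘ₗ
    midBraid (Nich p) Z.carrier (Nich.proj p) Y.proj ∘ₗ
    (Nich.comul p).rTensor (Y.carrier ⊗[ℂ] Z.carrier) = actOf p (tensorOp f f') := by
  refine nich_tensor_ext fun n hn v => ?_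
  rw [actOf_F hp]
  have key : (TensorProduct.map Y.act Z.act ∘ₗ
    midBraid (Nich p) Z.carrier (Nich.proj p) Y.proj ∘ₗ
    (Nich.comul p).rTensor (Y.carrier ⊗[ℂ] Z.carrier)) ∘ₗ
      TensorProduct.mk ℂ (Nich p) (Y.carrier ⊗[ℂ] Z.carrier) (Nich.F p n) =
      dpow p (tensorOp f f') n := by
    refine hY.tensor_ext hZ fun a b y z hy hz => ?_
    rw [tensorOp, dpow_add hp (map_id_pow_eq_zero hY.f_pow) (map_phase_pow_eq_zero hZ.f_pow)
      (tensor_f_comm hY) hn]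
    simp only [LinearMap.comp_apply, TensorProduct.mk_apply, LinearMap.rTensor_tmul, comul_F hn,
      TensorProduct.sum_tmul, map_sum, LinearMap.sum_apply]
    refine Finset.sum_congr rfl fun x _ => ?_
    rw [midBraid_tmul (homog_F _) (hY.homog_of_proj hy), map_smul, TensorProduct.map_tmul,
      hY.act_F hp, hZ.act_F hp, bichar_neg_two_mul, Module.End.mul_apply, dpow, dpow, dpow, dpow,
      pow_map_id, TensorProduct.map_pow, LinearMap.smul_apply, LinearMap.smul_apply,
      LinearMap.smul_apply, LinearMap.smul_apply, TensorProduct.map_tmul, map_smul,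
      TensorProduct.map_tmul, hY.phase_pow hy, map_smul, ← TensorProduct.smul_tmul',
      ← TensorProduct.smul_tmul', TensorProduct.tmul_smul, smul_smul, smul_smul, smul_smul,
      smul_smul]
    congr 1
    ring
  exact LinearMap.congr_fun key v

/-- The coefficient of F(m) collects the products F(i)F(j) with i + j = m. Their structure constants
are the q-binomial coefficients in the expansion of (d ⊗ 1 + K ⊗ d')^m. -/
lemma tensor_coact (hp : 2 ≤ p) : (Nich.mul p).rTensor (Y.carrier ⊗[ℂ] Z.carrier) ∘ₗ
    midBraid (Nich p) Z.carrier Y.proj (Nich.proj p) ∘ₗ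
    TensorProduct.map Y.coact Z.coact = coactOf p (tensorOp d d') := by
  refine hY.tensor_ext hZ fun a b y z hy hz => coeff_ext fun m => ?_
  rw [coeff_coactOf, tensorOp, add_comm, sum_dpow_eq hp (map_phase_pow_eq_zero hZ.d_pow)
    (map_id_pow_eq_zero hY.d_pow) (tensor_d_comm hY) m.2.le]
  simp only [LinearMap.comp_apply, TensorProduct.map_tmul, hY.coact_apply, hZ.coact_apply,
    TensorProduct.sum_tmul, TensorProduct.tmul_sum, map_sum, LinearMap.smul_apply,
    LinearMap.sum_apply]
  have e1 : ∀ i ∈ Finset.range p, ∀ j ∈ Finset.range p,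
      coeff (Y.carrier ⊗[ℂ] Z.carrier) m ((Nich.mul p).rTensor (Y.carrier ⊗[ℂ] Z.carrier)
        (midBraid (Nich p) Z.carrier Y.proj (Nich.proj p)
          ((Nich.F p i ⊗ₜ[ℂ] (d ^ i) y) ⊗ₜ[ℂ] (Nich.F p j ⊗ₜ[ℂ] (d' ^ j) z)))) =
      if m.val = i + j then (qfac p m * q p ^ (-(j * (a + 2 * i) : ℤ))) •
        (dpow p d i y ⊗ₜ[ℂ] dpow p d' j z) else 0 := by
    intro i hi j hj
    rw [Finset.mem_range] at hi hj
    rw [midBraid_tmul (hY.homog_of_proj (hY.d_pow_homog hy i)) (homog_F j), bichar_comm,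
      bichar_neg_two_mul, map_smul, LinearMap.rTensor_tmul, mul_F, ← TensorProduct.smul_tmul',
      map_smul, map_smul, coeff_F_tmul]
    split_ifs with h
    · rw [dpow, dpow, LinearMap.smul_apply, LinearMap.smul_apply, ← TensorProduct.smul_tmul',
        TensorProduct.tmul_smul, smul_smul, smul_smul, smul_smul, qbinom, ← h]
      congr 1
      field_simp
    · simp
  have e2 := fun j (hj : j ∈ Finset.range p) =>
    (Finset.sum_congr rfl fun i hi => e1 i hi j hj).trans
      (sum_range_ite_eq_add (fun i => (qfac p m * q p ^ (-(j * (a + 2 * i) : ℤ))) •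
        (dpow p d i y ⊗ₜ[ℂ] dpow p d' j z)) m.2 j)
  rw [Finset.sum_congr rfl e2, Finset.smul_sum, ← sum_antidiagonal_eq_sum_range m.2 (fun j i =>
    (qfac p m * q p ^ (-(j * (a + 2 * i) : ℤ))) • (dpow p d i y ⊗ₜ[ℂ] dpow p d' j z))]
  refine Finset.sum_congr rfl fun x _ => ?_
  rw [Module.End.mul_apply, dpow, dpow, dpow, dpow,
    pow_map_id, TensorProduct.map_pow, LinearMap.smul_apply, LinearMap.smul_apply,
    LinearMap.smul_apply, LinearMap.smul_apply, TensorProduct.map_tmul, map_smul,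
    TensorProduct.map_tmul, hY.phase_pow (hY.d_pow_homog hy _), ← TensorProduct.smul_tmul',
    ← TensorProduct.smul_tmul', TensorProduct.tmul_smul, smul_smul, smul_smul, smul_smul,
    smul_smul, smul_smul, LinearMap.id_apply]
  congr 1
  ring

/-- The operators of a tensor product. -/
lemma isOps_tensor (hp : 2 ≤ p) :
    IsOps (tensorProj Y Z) (TensorProduct.map Y.act Z.act ∘ₗ
      midBraid (Nich p) Z.carrier (Nich.proj p) Y.proj ∘ₗ
      (Nich.comul p).rTensor (Y.carrier ⊗[ℂ] Z.carrier))
      ((Nich.mul p).rTensor (Y.carrier ⊗[ℂ] Z.carrier) ∘ₗ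
        midBraid (Nich p) Z.carrier Y.proj (Nich.proj p) ∘ₗ
        TensorProduct.map Y.coact Z.coact) (tensorOp f f') (tensorOp d d') where
  proj_comp α β := by
    refine hY.tensor_ext hZ fun a b y z hy hz => ?_
    rw [LinearMap.comp_apply, hY.tensor_proj hZ hy hz β]
    by_cases hβ : β = ((a + b : ℤ) : ZMod (4 * p))
    · rw [if_pos hβ, hY.tensor_proj hZ hy hz α]
      by_cases hα : α = β
      · rw [if_pos hα, hY.tensor_proj hZ hy hz α]
      · rw [if_neg hα, if_neg (fun h => hα (h.trans hβ.symm)), LinearMap.zero_apply]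
    · rw [if_neg hβ, map_zero]
      by_cases hα : α = β
      · rw [if_pos hα, hY.tensor_proj hZ hy hz α, hα, if_neg hβ]
      · rw [if_neg hα, LinearMap.zero_apply]
  proj_sum := by
    refine hY.tensor_ext hZ fun a b y z hy hz => ?_
    rw [LinearMap.sum_apply, Finset.sum_congr rfl fun γ _ => hY.tensor_proj hZ hy hz γ]
    simp
  act_eq := hY.tensor_act hZ hp
  coact_eq := hY.tensor_coact hZ hp
  f_proj α := by
    refine hY.tensor_ext hZ fun a b y z hy hz => ?_
    rw [LinearMap.comp_apply, LinearMap.comp_apply, hY.tensor_proj hZ hy hz α,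
      hY.tensorOp_tmul hy, map_add, map_smul, hY.tensor_proj hZ (hY.f_homog hy) hz,
      hY.tensor_proj hZ hy (hZ.f_homog hz)]
    have e : (α - 2 = ((a + (b - 2) : ℤ) : ZMod (4 * p))) ↔ α = ((a + b : ℤ) : ZMod (4 * p)) := by
      push_cast; constructor <;> intro h <;> linear_combination h
    have e' : (α - 2 = ((a - 2 + b : ℤ) : ZMod (4 * p))) ↔
        α = ((a + b : ℤ) : ZMod (4 * p)) := by
      push_cast; constructor <;> intro h <;> linear_combination h
    simp only [e, e']
    split_ifs
    · rw [hY.tensorOp_tmul hy]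
    · simp
  d_proj α := by
    refine hY.tensor_ext hZ fun a b y z hy hz => ?_
    rw [LinearMap.comp_apply, LinearMap.comp_apply, hY.tensor_proj hZ hy hz α,
      hY.tensorOp_tmul hy, map_add, map_smul, hY.tensor_proj hZ (hY.d_homog hy) hz,
      hY.tensor_proj hZ hy (hZ.d_homog hz)]
    have e : (α + 2 = ((a + (b + 2) : ℤ) : ZMod (4 * p))) ↔ α = ((a + b : ℤ) : ZMod (4 * p)) := by
      push_cast; constructor <;> intro h <;> linear_combination h
    have e' : (α + 2 = ((a + 2 + b : ℤ) : ZMod (4 * p))) ↔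
        α = ((a + b : ℤ) : ZMod (4 * p)) := by
      push_cast; constructor <;> intro h <;> linear_combination h
    simp only [e, e']
    split_ifs
    · rw [hY.tensorOp_tmul hy]
    · simp
  f_pow := add_pow_eq_zero hp (map_id_pow_eq_zero hY.f_pow) (map_phase_pow_eq_zero hZ.f_pow)
    (tensor_f_comm hY)
  d_pow := by
    rw [tensorOp, add_comm]
    exact add_pow_eq_zero hp (map_phase_pow_eq_zero hZ.d_pow) (map_id_pow_eq_zero hY.d_pow)
      (tensor_d_comm hY)
  rel n v hv := by
    have key : (tensorOp d d' ∘ₗ tensorOp f f') ∘ₗ tensorProj Y Z n =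
        (Q p 1 • (tensorOp f f' ∘ₗ tensorOp d d') + (1 - Q p (-n)) • LinearMap.id) ∘ₗ
          tensorProj Y Z n := by
      refine hY.tensor_ext hZ fun a b y z hy hz => ?_
      rw [LinearMap.comp_apply, LinearMap.comp_apply (g := tensorProj Y Z n),
        hY.tensor_proj hZ hy hz]
      split_ifs with hn
      · have hq : Q p (-n) = Q p (-(a + b)) := by
          rw [Q_neg, Q_neg, Q_eq_of_cast_eq hn]
        -- The mixed terms match up to the powers of q collected in `h1` and `h2`; the scalar terms
        -- combine by (1 − q^{−2a}) + q^{−2a}(1 − q^{−2b}) = 1 − q^{−2(a+b)}.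
        simp only [LinearMap.comp_apply, LinearMap.add_apply, LinearMap.smul_apply,
          LinearMap.id_apply, hY.tensorOp_tmul hy, map_add, map_smul,
          hY.tensorOp_tmul (hY.f_homog hy), hY.tensorOp_tmul (hY.d_homog hy), hY.rel a y hy,
          hZ.rel b z hz, TensorProduct.add_tmul, TensorProduct.tmul_add, TensorProduct.tmul_smul,
          ← TensorProduct.smul_tmul']
        have h1 : q p ^ (-(a - 2)) = q p ^ (-a) * Q p 1 := by
          rw [Q, ← zpow_add₀ (q_ne_zero p)]; congr 1; ring
        have h2 : q p ^ (-(a + 2)) = q p ^ (-a) / Q p 1 := by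
          rw [Q, ← zpow_sub₀ (q_ne_zero p)]; congr 1; ring
        have h3 : Q p (-a) = q p ^ (-a) * q p ^ (-a) := by
          rw [Q, ← zpow_add₀ (q_ne_zero p)]; congr 1; ring
        rw [hq, h1, h2, neg_add, Q_add, h3]
        have := Q_ne_zero p 1
        match_scalars <;> field_simp <;> ring
      · simp
    have := LinearMap.congr_fun key v
    rw [LinearMap.comp_apply, LinearMap.comp_apply (g := tensorProj Y Z n), hv] at this
    exact this

lemma tensor (hp : 2 ≤ p) :
    HasOps (RankOneNichols.tensor Y Z) (tensorOp f f') (tensorOp d d') :=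
  hY.isOps_tensor hZ hp

end Tensor

end HasOps

/-! ### One-vertex modules -/

section ProjOf

variable {ι : Type} [Fintype ι] [DecidableEq ι]

lemma pi_single_ext {V : Type} [AddCommGroup V] [Module ℂ V] {g h : (ι → ℂ) →ₗ[ℂ] V}
    (H : ∀ i, g (Pi.single i 1) = h (Pi.single i 1)) : g = h :=
  (Pi.basisFun ℂ ι).ext fun i => by simpa using H i

lemma projOf_comp (deg : ι → ZMod (4 * p)) (α β : ZMod (4 * p)) :
    projOf deg α ∘ₗ projOf deg β = if α = β then projOf deg α else 0 := by
  refine pi_single_ext fun i => ?_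
  rw [LinearMap.comp_apply, projOf_single]
  by_cases h : deg i = β
  · rw [if_pos h, projOf_single]
    by_cases h' : α = β
    · rw [if_pos h', projOf_single]
    · rw [if_neg h', if_neg (fun e => h' (e.symm.trans h)), LinearMap.zero_apply]
  · rw [if_neg h, map_zero]
    by_cases h' : α = β
    · rw [if_pos h', projOf_single, h', if_neg h]
    · rw [if_neg h', LinearMap.zero_apply]

lemma projOf_sum [NeZero p] (deg : ι → ZMod (4 * p)) : ∑ α, projOf deg α = LinearMap.id := by
  refine pi_single_ext fun i => ?_
  rw [LinearMap.sum_apply]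
  simp [projOf_single]

end ProjOf

lemma vtx_eq_single {n : ℕ} (i : Fin n) : vtx n i = Pi.single i 1 := by
  ext j
  simp [vtx, Pi.single_apply, Fin.ext_iff]

lemma vtx_eq_zero {n s : ℕ} (h : n ≤ s) : vtx n s = 0 := by
  ext j
  have := j.2
  simp only [vtx, Pi.zero_apply, ite_eq_right_iff, one_ne_zero, imp_false]
  omega

lemma vtx_ne_zero {n s : ℕ} (h : s < n) : vtx n s ≠ 0 := by
  intro h0
  have := congrFun h0 ⟨s, h⟩
  simp [vtx] at this

lemma vtx_ext {n : ℕ} {V : Type} [AddCommGroup V] [Module ℂ V] {g h : (Fin n → ℂ) →ₗ[ℂ] V}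
    (H : ∀ s < n, g (vtx n s) = h (vtx n s)) : g = h :=
  pi_single_ext fun i => by rw [← vtx_eq_single]; exact H i i.2

/-- The action of `F` on a one-vertex module. -/
def oneF (p n : ℕ) (a : ℤ) : Module.End ℂ (Fin n → ℂ) :=
  (Pi.basisFun ℂ (Fin n)).constr ℂ fun s =>
    (xi p * qint p (s.val - a) * qint p (s.val + 1)) • vtx n (s.val + 1)

/-- The coefficient of `F(1)` in the coaction on a one-vertex module. -/
def oneD (n : ℕ) : Module.End ℂ (Fin n → ℂ) :=
  (Pi.basisFun ℂ (Fin n)).constr ℂ fun s => if s.val = 0 then 0 else vtx n (s.val - 1)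

lemma oneF_vtx (p n : ℕ) (a : ℤ) (s : ℕ) : oneF p n a (vtx n s) =
    (xi p * qint p (s - a) * qint p (s + 1)) • vtx n (s + 1) := by
  rcases lt_or_ge s n with h | h
  · have h1 := vtx_eq_single (⟨s, h⟩ : Fin n)
    simp only at h1
    rw [h1, oneF, basisFun_constr_single]
  · rw [vtx_eq_zero h, vtx_eq_zero (show n ≤ s + 1 by omega)]; simp

lemma oneD_vtx_succ {n s : ℕ} (h : s + 1 < n) : oneD n (vtx n (s + 1)) = vtx n s := by
  have h1 := vtx_eq_single (⟨s + 1, h⟩ : Fin n)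
  simp only at h1
  rw [h1, oneD, basisFun_constr_single]
  simp

lemma oneD_vtx_zero (n : ℕ) : oneD n (vtx n 0) = 0 := by
  rcases Nat.eq_zero_or_pos n with rfl | h
  · rw [vtx_eq_zero le_rfl, map_zero]
  · have h1 := vtx_eq_single (⟨0, h⟩ : Fin n)
    simp only at h1
    rw [h1, oneD, basisFun_constr_single]
    simp

/-- The projections of a one-vertex module. -/
abbrev oneProj (p n : ℕ) (a : ℤ) : ZMod (4 * p) → (Fin n → ℂ) →ₗ[ℂ] (Fin n → ℂ) :=
  projOf fun s : Fin n => ((a - 2 * (s.val : ℤ) : ℤ) : ZMod (4 * p))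

lemma oneProj_vtx (p n : ℕ) (a : ℤ) (α : ZMod (4 * p)) (s : ℕ) :
    oneProj p n a α (vtx n s) =
      if α = ((a - 2 * (s : ℤ) : ℤ) : ZMod (4 * p)) then vtx n s else 0 := by
  rcases lt_or_ge s n with h | h
  · have h1 := vtx_eq_single (⟨s, h⟩ : Fin n)
    simp only at h1
    rw [h1, projOf_single]
    simp only [eq_comm]
  · rw [vtx_eq_zero h]; simp

lemma exists_oneF_pow (p n : ℕ) (a : ℤ) (s j : ℕ) :
    ∃ c : ℂ, (oneF p n a ^ j) (vtx n s) = c • vtx n (s + j) := by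
  induction j with
  | zero => exact ⟨1, by simp⟩
  | succ j ih =>
    obtain ⟨c, hc⟩ := ih
    rw [pow_succ', Module.End.mul_apply, hc, map_smul, oneF_vtx, smul_smul]
    exact ⟨_, rfl⟩

lemma oneD_pow_vtx {n s j : ℕ} (hs : s < n) :
    (oneD n ^ j) (vtx n s) = if j ≤ s then vtx n (s - j) else 0 := by
  induction j with
  | zero => simp
  | succ j ih =>
    rw [pow_succ', Module.End.mul_apply, ih]
    split_ifs with h1 h2 h2
    · rw [show s - j = s - (j + 1) + 1 by omega, oneD_vtx_succ (by omega)]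
    · rw [show s - j = 0 by omega, oneD_vtx_zero]
    · omega
    · simp

/-- `ha` says that F ▸ V_{n−1} would have coefficient zero at V_n, so cutting off at n respects the
commutation relation. It holds when a ≡ n − 1 modulo p, the case of the simple modules, and for
every a when n = p. -/
lemma isOps_oneVertex [NeZero p] (hp : 2 ≤ p) {n : ℕ} (hn : n ≤ p) {a : ℤ}
    (ha : qint p (n - 1 - a) * qint p n = 0) :
    IsOps (oneProj p n a) (actOf p (oneF p n a)) (coactOf p (oneD n)) (oneF p n a) (oneD n) where
  proj_comp := projOf_comp _
  proj_sum := projOf_sum _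
  act_eq := rfl
  coact_eq := rfl
  f_proj α := by
    refine vtx_ext fun s _ => ?_
    change oneF p n a (oneProj p n a α (vtx n s)) = oneProj p n a (α - 2) (oneF p n a (vtx n s))
    rw [oneProj_vtx, oneF_vtx, map_smul, oneProj_vtx]
    have e : (α - 2 = ((a - 2 * ((s + 1 : ℕ) : ℤ) : ℤ) : ZMod (4 * p))) ↔
        α = ((a - 2 * (s : ℤ) : ℤ) : ZMod (4 * p)) := by
      push_cast; constructor <;> intro h <;> linear_combination h
    simp only [e]
    split_ifs
    · rw [oneF_vtx]
    · simp
  d_proj α := by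
    refine vtx_ext fun s hs => ?_
    change oneD n (oneProj p n a α (vtx n s)) = oneProj p n a (α + 2) (oneD n (vtx n s))
    rw [oneProj_vtx]
    cases s with
    | zero =>
      rw [oneD_vtx_zero, map_zero]
      split_ifs
      · rw [oneD_vtx_zero]
      · simp
    | succ s =>
      rw [oneD_vtx_succ hs, oneProj_vtx]
      have e : (α + 2 = ((a - 2 * (s : ℤ) : ℤ) : ZMod (4 * p))) ↔
          α = ((a - 2 * ((s + 1 : ℕ) : ℤ) : ℤ) : ZMod (4 * p)) := by
        push_cast; constructor <;> intro h <;> linear_combination h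
      simp only [e]
      split_ifs
      · rw [oneD_vtx_succ hs]
      · simp
  f_pow := by
    refine vtx_ext fun s _ => ?_
    obtain ⟨c, hc⟩ := exists_oneF_pow p n a s p
    rw [hc, vtx_eq_zero (by omega)]
    simp
  d_pow := by
    refine vtx_ext fun s hs => ?_
    rw [oneD_pow_vtx hs, if_neg (by omega)]
    rfl
  rel k y hy := by
    have key : (oneD n ∘ₗ oneF p n a) ∘ₗ
        oneProj p n a k =
        (Q p 1 • (oneF p n a ∘ₗ oneD n) + (1 - Q p (-k)) • LinearMap.id) ∘ₗ
        oneProj p n a k := by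
      refine vtx_ext fun s hs => ?_
      rw [LinearMap.comp_apply, LinearMap.comp_apply (g := oneProj _ _ _ _), oneProj_vtx]
      split_ifs with hk
      · have hq : Q p (-k) = Q p (2 * s - a) := by
          rw [Q_neg, Q_eq_of_cast_eq hk, ← Q_neg]; congr 1; ring
        have h0 := sub_ne_zero.2 (Q_one_ne_one hp)
        have e1 : oneD n (oneF p n a (vtx n s)) =
            (xi p * qint p (s - a) * qint p (s + 1)) • vtx n s := by
          rw [oneF_vtx, map_smul]
          rcases lt_or_ge (s + 1) n with h | h
          · rw [oneD_vtx_succ h]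
          · obtain rfl : n = s + 1 := by omega
            push_cast at ha
            rw [add_sub_cancel_right] at ha
            rw [mul_assoc, ha]
            simp
        have e2 : oneF p n a (oneD n (vtx n s)) =
            (xi p * qint p (s - 1 - a) * qint p s) • vtx n s := by
          cases s with
          | zero => rw [oneD_vtx_zero]; simp
          | succ s => rw [oneD_vtx_succ hs, oneF_vtx]; push_cast; ring_nf
        rw [LinearMap.comp_apply, e1, LinearMap.add_apply, LinearMap.smul_apply,
          LinearMap.comp_apply, e2, LinearMap.smul_apply, LinearMap.id_apply, smul_smul,
          ← add_smul, hq]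
        congr 1
        rw [xi_eq]
        simp only [qint_eq, Q_add, Q_sub, two_mul]
        have := Q_ne_zero p s
        have := Q_ne_zero p a
        have := Q_ne_zero p 1
        field_simp
        ring
      · simp
    have := LinearMap.congr_fun key y
    rw [LinearMap.comp_apply, LinearMap.comp_apply (g := oneProj _ _ _ _), hy] at this
    exact this

lemma ops_oneVertex [NeZero p] (hp : 2 ≤ p) {n : ℕ} (hn : n ≤ p) {a : ℤ}
    (ha : qint p (n - 1 - a) * qint p n = 0) :
    HasOps (oneVertex p n a) (oneF p n a) (oneD n) :=
  isOps_oneVertex hp hn ha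

/-! ### Two-vertex modules -/

lemma vtx₂_eq_single (i : Fin p × Fin p) : vtx₂ p i.1 i.2 = Pi.single i 1 := by
  ext j
  simp [vtx₂, Pi.single_apply, Prod.ext_iff, Fin.ext_iff]

lemma vtx₂_eq_zero_left {s : ℕ} (h : p ≤ s) (t : ℕ) : vtx₂ p s t = 0 := by
  ext j
  have := j.1.2
  simp only [vtx₂, Pi.zero_apply, ite_eq_right_iff, one_ne_zero, imp_false, not_and]
  omega

lemma vtx₂_eq_zero_right {t : ℕ} (h : p ≤ t) (s : ℕ) : vtx₂ p s t = 0 := by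
  ext j
  have := j.2.2
  simp only [vtx₂, Pi.zero_apply, ite_eq_right_iff, one_ne_zero, imp_false, not_and]
  omega

lemma vtx₂_ext {V : Type} [AddCommGroup V] [Module ℂ V] {g h : (Fin p × Fin p → ℂ) →ₗ[ℂ] V}
    (H : ∀ s < p, ∀ t < p, g (vtx₂ p s t) = h (vtx₂ p s t)) : g = h :=
  pi_single_ext fun i => by rw [← vtx₂_eq_single]; exact H _ i.1.2 _ i.2.2

lemma constr_vtx₂ {V : Type} [AddCommGroup V] [Module ℂ V] (g : Fin p × Fin p → V) {s t : ℕ}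
    (hs : s < p) (ht : t < p) :
    (Pi.basisFun ℂ (Fin p × Fin p)).constr ℂ g (vtx₂ p s t) = g (⟨s, hs⟩, ⟨t, ht⟩) := by
  have h1 := vtx₂_eq_single ((⟨s, hs⟩, ⟨t, ht⟩) : Fin p × Fin p)
  simp only at h1
  rw [h1, basisFun_constr_single]

/-- The action of `F` on a two-vertex module. -/
def twoF (p : ℕ) (a b : ℤ) : Module.End ℂ (Fin p × Fin p → ℂ) :=
  (Pi.basisFun ℂ (Fin p × Fin p)).constr ℂ fun i =>
    (xi p * qint p (i.1.val + 2 * i.2.val - a - b) * qint p (i.1.val + 1)) •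
      vtx₂ p (i.1.val + 1) i.2.val +
    (xi p * (q p) ^ (2 * (i.1.val : ℤ) - a) * qint p (i.2.val - b) * qint p (i.2.val + 1)) •
      vtx₂ p i.1.val (i.2.val + 1)

/-- The coefficient of `F(1)` in the coaction on a two-vertex module. -/
def twoD (p : ℕ) : Module.End ℂ (Fin p × Fin p → ℂ) :=
  (Pi.basisFun ℂ (Fin p × Fin p)).constr ℂ fun i =>
    if i.1.val = 0 then 0 else vtx₂ p (i.1.val - 1) i.2.val

lemma twoF_vtx₂ (p : ℕ) (a b : ℤ) (s t : ℕ) : twoF p a b (vtx₂ p s t) =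
    (xi p * qint p (s + 2 * t - a - b) * qint p (s + 1)) • vtx₂ p (s + 1) t +
    (xi p * (q p) ^ (2 * (s : ℤ) - a) * qint p (t - b) * qint p (t + 1)) • vtx₂ p s (t + 1) := by
  rcases lt_or_ge s p with hs | hs
  · rcases lt_or_ge t p with ht | ht
    · rw [twoF, constr_vtx₂ _ hs ht]
    · simp [vtx₂_eq_zero_right ht, vtx₂_eq_zero_right (show p ≤ t + 1 by omega)]
  · simp [vtx₂_eq_zero_left hs, vtx₂_eq_zero_left (show p ≤ s + 1 by omega)]

lemma twoD_vtx₂_succ {s : ℕ} (hs : s + 1 < p) (t : ℕ) :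
    twoD p (vtx₂ p (s + 1) t) = vtx₂ p s t := by
  rcases lt_or_ge t p with ht | ht
  · rw [twoD, constr_vtx₂ _ hs ht]; simp
  · simp [vtx₂_eq_zero_right ht]

lemma twoD_vtx₂_zero (p t : ℕ) : twoD p (vtx₂ p 0 t) = 0 := by
  rcases Nat.eq_zero_or_pos p with rfl | hp
  · rw [vtx₂_eq_zero_left le_rfl, map_zero]
  rcases lt_or_ge t p with ht | ht
  · rw [twoD, constr_vtx₂ _ hp ht]; simp
  · simp [vtx₂_eq_zero_right ht]

lemma twoD_pow_vtx₂ {s : ℕ} (hs : s < p) (t j : ℕ) :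
    (twoD p ^ j) (vtx₂ p s t) = if j ≤ s then vtx₂ p (s - j) t else 0 := by
  induction j with
  | zero => simp
  | succ j ih =>
    rw [pow_succ', Module.End.mul_apply, ih]
    split_ifs with h1 h2 h2
    · rw [show s - j = s - (j + 1) + 1 by omega, twoD_vtx₂_succ (by omega)]
    · rw [show s - j = 0 by omega, twoD_vtx₂_zero]
    · omega
    · simp

/-- The projections of a two-vertex module. -/
abbrev twoProj (p : ℕ) (a b : ℤ) :
    ZMod (4 * p) → (Fin p × Fin p → ℂ) →ₗ[ℂ] (Fin p × Fin p → ℂ) :=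
  projOf fun i : Fin p × Fin p =>
    ((a + b - 2 * (i.1.val : ℤ) - 2 * (i.2.val : ℤ) : ℤ) : ZMod (4 * p))

lemma twoProj_vtx₂ (p : ℕ) (a b : ℤ) (α : ZMod (4 * p)) (s t : ℕ) :
    twoProj p a b α (vtx₂ p s t) =
      if α = ((a + b - 2 * (s : ℤ) - 2 * (t : ℤ) : ℤ) : ZMod (4 * p)) then vtx₂ p s t else 0 := by
  rcases lt_or_ge s p with hs | hs
  · rcases lt_or_ge t p with ht | ht
    · have h1 := vtx₂_eq_single ((⟨s, hs⟩, ⟨t, ht⟩) : Fin p × Fin p)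
      simp only at h1
      rw [h1, projOf_single]
      simp only [eq_comm]
    · simp [vtx₂_eq_zero_right ht]
  · simp [vtx₂_eq_zero_left hs]

/-- d moves only the first index, so the scalar term of the relation comes from the V_{s+1,t} part
of the action alone; the V_{s,t+1} part q-commutes with d. Nilpotency of f is not visible from the
formula and is supplied through the fusion map. -/
lemma isOps_twoVertex_of_pow [NeZero p] (hp : 2 ≤ p) {a b : ℤ} (hf : twoF p a b ^ p = 0) :
    IsOps (twoProj p a b) (actOf p (twoF p a b)) (coactOf p (twoD p)) (twoF p a b) (twoD p) where
  proj_comp := projOf_comp _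
  proj_sum := projOf_sum _
  act_eq := rfl
  coact_eq := rfl
  f_proj α := by
    refine vtx₂_ext fun s _ t _ => ?_
    change twoF p a b (twoProj p a b α (vtx₂ p s t)) =
      twoProj p a b (α - 2) (twoF p a b (vtx₂ p s t))
    rw [twoProj_vtx₂, twoF_vtx₂, map_add, map_smul, map_smul, twoProj_vtx₂, twoProj_vtx₂]
    have e : (α - 2 = ((a + b - 2 * ((s + 1 : ℕ) : ℤ) - 2 * t : ℤ) : ZMod (4 * p))) ↔
        α = ((a + b - 2 * (s : ℤ) - 2 * t : ℤ) : ZMod (4 * p)) := by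
      push_cast; constructor <;> intro h <;> linear_combination h
    have e' : (α - 2 = ((a + b - 2 * (s : ℤ) - 2 * ((t + 1 : ℕ) : ℤ) : ℤ) : ZMod (4 * p))) ↔
        α = ((a + b - 2 * (s : ℤ) - 2 * t : ℤ) : ZMod (4 * p)) := by
      push_cast; constructor <;> intro h <;> linear_combination h
    simp only [e, e']
    split_ifs
    · rw [twoF_vtx₂]
    · simp
  d_proj α := by
    refine vtx₂_ext fun s hs t _ => ?_
    change twoD p (twoProj p a b α (vtx₂ p s t)) =
      twoProj p a b (α + 2) (twoD p (vtx₂ p s t))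
    rw [twoProj_vtx₂]
    cases s with
    | zero =>
      rw [twoD_vtx₂_zero, map_zero]
      split_ifs
      · rw [twoD_vtx₂_zero]
      · simp
    | succ s =>
      rw [twoD_vtx₂_succ hs, twoProj_vtx₂]
      have e : (α + 2 = ((a + b - 2 * (s : ℤ) - 2 * t : ℤ) : ZMod (4 * p))) ↔
          α = ((a + b - 2 * ((s + 1 : ℕ) : ℤ) - 2 * t : ℤ) : ZMod (4 * p)) := by
        push_cast; constructor <;> intro h <;> linear_combination h
      simp only [e]
      split_ifs
      · rw [twoD_vtx₂_succ hs]
      · simp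
  f_pow := hf
  d_pow := by
    refine vtx₂_ext fun s hs t _ => ?_
    rw [twoD_pow_vtx₂ hs, if_neg (by omega)]
    rfl
  rel k y hy := by
    have key : (twoD p ∘ₗ twoF p a b) ∘ₗ twoProj p a b k =
        (Q p 1 • (twoF p a b ∘ₗ twoD p) + (1 - Q p (-k)) • LinearMap.id) ∘ₗ
          twoProj p a b k := by
      refine vtx₂_ext fun s hs t ht => ?_
      rw [LinearMap.comp_apply, LinearMap.comp_apply (g := twoProj _ _ _ _), twoProj_vtx₂]
      split_ifs with hk
      · have hq : Q p (-k) = Q p (2 * s + 2 * t - a - b) := by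
          rw [Q_neg, Q_eq_of_cast_eq hk, ← Q_neg]; congr 1; ring
        have h0 := sub_ne_zero.2 (Q_one_ne_one hp)
        have hA : xi p * qint p (s + 2 * t - a - b) * qint p (s + 1) =
            Q p 1 * (xi p * qint p (s - 1 + 2 * t - a - b) * qint p s) +
              (1 - Q p (2 * s + 2 * t - a - b)) := by
          rw [xi_eq]
          simp only [qint_eq, Q_add, Q_sub, two_mul]
          have := Q_ne_zero p s
          have := Q_ne_zero p t
          have := Q_ne_zero p a
          have := Q_ne_zero p b
          have := Q_ne_zero p 1
          field_simp
          ring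
        have hB : q p ^ (2 * (s : ℤ) - a) = Q p 1 * q p ^ (2 * ((s : ℤ) - 1) - a) := by
          rw [Q, ← zpow_add₀ (q_ne_zero p)]; congr 1; ring
        rw [LinearMap.comp_apply, LinearMap.add_apply, LinearMap.smul_apply,
          LinearMap.comp_apply, LinearMap.smul_apply, LinearMap.id_apply, hq, twoF_vtx₂, map_add,
          map_smul, map_smul]
        have e1 : (xi p * qint p (s + 2 * t - a - b) * qint p (s + 1)) •
            twoD p (vtx₂ p (s + 1) t) =
            (xi p * qint p (s + 2 * t - a - b) * qint p (s + 1)) • vtx₂ p s t := by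
          rcases lt_or_ge (s + 1) p with h | h
          · rw [twoD_vtx₂_succ h]
          -- At s + 1 = p the vector V_{s+1,t} is cut off; the coefficient ⟨p⟩ = 0 makes this
          -- harmless.
          · rw [(qint_eq_zero_iff hp ((s : ℤ) + 1)).2 ⟨1, by omega⟩]
            simp
        rw [e1, hA]
        cases s with
        | zero => rw [twoD_vtx₂_zero, twoD_vtx₂_zero]; simp
        | succ s =>
          rw [twoD_vtx₂_succ hs, twoD_vtx₂_succ hs, twoF_vtx₂, hB]
          push_cast
          rw [add_sub_cancel_right]
          module
      · simp
    have := LinearMap.congr_fun key y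
    rw [LinearMap.comp_apply, LinearMap.comp_apply (g := twoProj _ _ _ _), hy] at this
    exact this

lemma ops_twoVertex_of_pow [NeZero p] (hp : 2 ≤ p) {a b : ℤ} (hf : twoF p a b ^ p = 0) :
    HasOps (twoVertex p a b) (twoF p a b) (twoD p) :=
  isOps_twoVertex_of_pow hp hf

/-! ### The fusion map -/

section Fusion

variable [NeZero p] (p) (n m : ℕ) (a b : ℤ)

/-- The action of `F` on a tensor product of one-vertex modules. -/
def tenF : Module.End ℂ ((Fin n → ℂ) ⊗[ℂ] (Fin m → ℂ)) :=
  tensorOp (Y := oneVertex p n a) (Z := oneVertex p m b) (oneF p n a) (oneF p m b)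

/-- The coefficient of `F(1)` in the coaction on a tensor product of one-vertex modules. -/
def tenD : Module.End ℂ ((Fin n → ℂ) ⊗[ℂ] (Fin m → ℂ)) :=
  tensorOp (Y := oneVertex p n a) (Z := oneVertex p m b) (oneD n) (oneD m)

/-- The projections of a tensor product of one-vertex modules. -/
def tenProj (α : ZMod (4 * p)) : Module.End ℂ ((Fin n → ℂ) ⊗[ℂ] (Fin m → ℂ)) :=
  tensorProj (oneVertex p n a) (oneVertex p m b) α

/-- The fusion map. -/
def fus : (Fin n → ℂ) ⊗[ℂ] (Fin m → ℂ) →ₗ[ℂ] (Fin p × Fin p → ℂ) :=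
  TensorProduct.lift <| (Pi.basisFun ℂ (Fin n)).constr ℂ fun s =>
    (Pi.basisFun ℂ (Fin m)).constr ℂ fun t =>
      ∑ i ∈ Finset.range (t.val + 1),
        ((q p) ^ (-a * (i : ℤ)) * qbinom p s.val i) • vtx₂ p (s.val + i) (t.val - i)

variable {p n m a b}

lemma ops_ten (hp : 2 ≤ p) (hn : n ≤ p) (hm : m ≤ p) (ha : qint p (n - 1 - a) * qint p n = 0)
    (hb : qint p (m - 1 - b) * qint p m = 0) :
    HasOps (tensor (oneVertex p n a) (oneVertex p m b)) (tenF p n m a b) (tenD p n m a b) :=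
  (ops_oneVertex hp hn ha).tensor (ops_oneVertex hp hm hb) hp

lemma vtx_tmul_ext {V : Type} [AddCommGroup V] [Module ℂ V]
    {g h : (Fin n → ℂ) ⊗[ℂ] (Fin m → ℂ) →ₗ[ℂ] V}
    (H : ∀ s < n, ∀ t < m, g (vtx n s ⊗ₜ[ℂ] vtx m t) = h (vtx n s ⊗ₜ[ℂ] vtx m t)) : g = h :=
  TensorProduct.ext (vtx_ext fun s hs => vtx_ext fun t ht => H s hs t ht)

omit [NeZero p] in
lemma oneProj_vtx_self (s : ℕ) :
    oneProj p n a ((a - 2 * s : ℤ) : ZMod (4 * p)) (vtx n s) = vtx n s := by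
  rw [oneProj_vtx, if_pos rfl]

lemma tenF_tmul (hp : 2 ≤ p) (hn : n ≤ p) (ha : qint p (n - 1 - a) * qint p n = 0) (s t : ℕ) :
    tenF p n m a b (vtx n s ⊗ₜ[ℂ] vtx m t) =
      (xi p * qint p (s - a) * qint p (s + 1)) • (vtx n (s + 1) ⊗ₜ[ℂ] vtx m t) +
      (q p ^ (2 * (s : ℤ) - a) * (xi p * qint p (t - b) * qint p (t + 1))) •
        (vtx n s ⊗ₜ[ℂ] vtx m (t + 1)) := by
  have h1 : tenF p n m a b (vtx n s ⊗ₜ[ℂ] vtx m t) =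
      oneF p n a (vtx n s) ⊗ₜ[ℂ] vtx m t +
        q p ^ (-(a - 2 * s)) • vtx n s ⊗ₜ[ℂ] oneF p m b (vtx m t) :=
    (ops_oneVertex hp hn ha).tensorOp_tmul (Z := oneVertex p m b) (oneProj_vtx_self s) _ _ _
  rw [h1, oneF_vtx, oneF_vtx, ← TensorProduct.smul_tmul', TensorProduct.tmul_smul, smul_smul,
    neg_sub]

lemma tenD_tmul (hp : 2 ≤ p) (hn : n ≤ p) (ha : qint p (n - 1 - a) * qint p n = 0) (s t : ℕ) :
    tenD p n m a b (vtx n s ⊗ₜ[ℂ] vtx m t) =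
      oneD n (vtx n s) ⊗ₜ[ℂ] vtx m t +
        q p ^ (2 * (s : ℤ) - a) • vtx n s ⊗ₜ[ℂ] oneD m (vtx m t) := by
  have h1 : tenD p n m a b (vtx n s ⊗ₜ[ℂ] vtx m t) =
      oneD n (vtx n s) ⊗ₜ[ℂ] vtx m t +
        q p ^ (-(a - 2 * s)) • vtx n s ⊗ₜ[ℂ] oneD m (vtx m t) :=
    (ops_oneVertex hp hn ha).tensorOp_tmul (Z := oneVertex p m b) (oneProj_vtx_self s) _ _ _
  rw [h1, neg_sub]

lemma tenProj_tmul (hp : 2 ≤ p) (hn : n ≤ p) (hm : m ≤ p)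
    (ha : qint p (n - 1 - a) * qint p n = 0) (hb : qint p (m - 1 - b) * qint p m = 0)
    (s t : ℕ) (α : ZMod (4 * p)) : tenProj p n m a b α (vtx n s ⊗ₜ[ℂ] vtx m t) =
      if α = ((a + b - 2 * s - 2 * t : ℤ) : ZMod (4 * p)) then vtx n s ⊗ₜ[ℂ] vtx m t else 0 := by
  have := (ops_oneVertex hp hn ha).tensor_proj (ops_oneVertex hp hm hb)
    (oneProj_vtx_self (p := p) (a := a) (n := n) s) (oneProj_vtx_self (p := p) (a := b) (n := m) t) α
  rw [show a + b - 2 * s - 2 * t = a - 2 * s + (b - 2 * t) by ring]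
  exact this

/-- The image of `V_s ⊗ V_t` under the fusion map, for all `s` and `t`. -/
def fusVtx (p : ℕ) (a : ℤ) (s t : ℕ) : Fin p × Fin p → ℂ :=
  ∑ i ∈ Finset.range (t + 1), (q p ^ (-a * (i : ℤ)) * qbinom p s i) • vtx₂ p (s + i) (t - i)

omit [NeZero p] in
lemma fus_tmul {s t : ℕ} (hs : s < n) (ht : t < m) :
    fus p n m a (vtx n s ⊗ₜ[ℂ] vtx m t) = fusVtx p a s t := by
  have h1 := vtx_eq_single (⟨s, hs⟩ : Fin n)
  have h2 := vtx_eq_single (⟨t, ht⟩ : Fin m)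
  simp only at h1 h2
  rw [h1, h2, fus, TensorProduct.lift.tmul, basisFun_constr_single, basisFun_constr_single, fusVtx]

omit [NeZero p] in
lemma qbinom_eq_zero (hp : 2 ≤ p) {s i : ℕ} (h : p ≤ s + i) : qbinom p s i = 0 := by
  rw [qbinom, qfac_eq_zero hp h, zero_div]

omit [NeZero p] in
lemma qbinom_zero_right (hp : 2 ≤ p) {s : ℕ} (h : s < p) : qbinom p s 0 = 1 := by
  rw [qbinom, add_zero, qfac_zero, mul_one, div_self (qfac_ne_zero hp h)]

omit [NeZero p] in
lemma qbinom_zero_left (hp : 2 ≤ p) {s : ℕ} (h : s < p) : qbinom p 0 s = 1 := by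
  rw [qbinom, zero_add, qfac_zero, one_mul, div_self (qfac_ne_zero hp h)]

omit [NeZero p] in
lemma qbinom_pascal (hp : 2 ≤ p) {s i : ℕ} (h : s + i + 2 ≤ p) :
    qbinom p (s + 1) (i + 1) = qbinom p s (i + 1) + Q p (s + 1) * qbinom p (s + 1) i := by
  have h1 : qint p (i + 1) ≠ 0 := qint_ne_zero hp (by omega) (by omega)
  have h2 : qint p (s + 1) ≠ 0 := qint_ne_zero hp (by omega) (by omega)
  have h3 := qfac_ne_zero hp (show s < p by omega)
  have h4 := qfac_ne_zero hp (show i < p by omega)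
  simp only [qbinom]
  rw [show s + 1 + (i + 1) = s + i + 1 + 1 by ring, show s + (i + 1) = s + i + 1 by ring,
    show s + 1 + i = s + i + 1 by ring, qfac_succ p (s + i + 1), qfac_succ p s, qfac_succ p i]
  have e : qint p (((s + i + 1 : ℕ) : ℤ) + 1) = qint p (s + 1) + Q p (s + 1) * qint p (i + 1) := by
    rw [← qint_add]; congr 1; push_cast; ring
  rw [e]
  field_simp

omit [NeZero p] in
lemma qbinom_mul_right {s i : ℕ} (hp : 2 ≤ p) (h : s + i + 1 < p) :
    qbinom p s i * qint p (s + i + 1) = qbinom p s (i + 1) * qint p (i + 1) := by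
  have h1 : qint p (i + 1) ≠ 0 := qint_ne_zero hp (by omega) (by omega)
  have h3 := qfac_ne_zero hp (show s < p by omega)
  have h4 := qfac_ne_zero hp (show i < p by omega)
  simp only [qbinom]
  rw [show s + (i + 1) = s + i + 1 by ring, qfac_succ p (s + i), qfac_succ p i]
  push_cast
  field_simp

omit [NeZero p] in
lemma qbinom_succ_left {s i : ℕ} (hp : 2 ≤ p) (h : s + i + 1 < p) :
    qint p (s + 1) * qbinom p (s + 1) i = qbinom p s (i + 1) * qint p (i + 1) := by
  have h1 : qint p (i + 1) ≠ 0 := qint_ne_zero hp (by omega) (by omega)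
  have h2 : qint p (s + 1) ≠ 0 := qint_ne_zero hp (by omega) (by omega)
  have h3 := qfac_ne_zero hp (show s < p by omega)
  have h4 := qfac_ne_zero hp (show i < p by omega)
  simp only [qbinom]
  rw [show s + (i + 1) = s + i + 1 by ring, show s + 1 + i = s + i + 1 by ring,
    qfac_succ p s, qfac_succ p i]
  field_simp

omit [NeZero p] in
-- Both sides are written as sums over the vectors V_{s+j,t+1−j}; equality of the coefficients is
-- then one identity between q-integers. No bounds on s and t are needed, because each cut-off is
-- accompanied by a vanishing vector or a vanishing ⟨p⟩.
lemma twoF_fusVtx (hp : 2 ≤ p) (a b : ℤ) (s t : ℕ) : twoF p a b (fusVtx p a s t) =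
    (xi p * qint p (s - a) * qint p (s + 1)) • fusVtx p a (s + 1) t +
      (q p ^ (2 * (s : ℤ) - a) * (xi p * qint p (t - b) * qint p (t + 1))) •
        fusVtx p a s (t + 1) := by
  have e1 : (xi p * qint p (s - a) * qint p (s + 1)) • fusVtx p a (s + 1) t =
      ∑ j ∈ Finset.range (t + 1 + 1), (xi p * qint p (s - a) * qint p j *
        q p ^ (-a * ((j : ℤ) - 1)) * qbinom p s j) • vtx₂ p (s + j) (t + 1 - j) := by
    rw [Finset.sum_range_succ', fusVtx, Finset.smul_sum]
    simp only [CharP.cast_eq_zero, qint_zero, mul_zero, zero_mul, zero_smul, add_zero]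
    refine Finset.sum_congr rfl fun i _ => ?_
    rw [show s + 1 + i = s + (i + 1) by ring, show t + 1 - (i + 1) = t - i by omega]
    rcases lt_or_ge (s + i + 1) p with h | h
    · rw [smul_smul]
      congr 1
      push_cast
      rw [add_sub_cancel_right]
      linear_combination (xi p * qint p (s - a) * q p ^ (-a * (i : ℤ))) * qbinom_succ_left hp h
    · rw [vtx₂_eq_zero_left (show p ≤ s + (i + 1) by omega)]; simp
  have e2 : twoF p a b (fusVtx p a s t) =
      ∑ j ∈ Finset.range (t + 1 + 1), (q p ^ (-a * ((j : ℤ) - 1)) *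
          (xi p * qint p (s - j + 1 + 2 * t - a - b)) * qint p j * qbinom p s j) •
            vtx₂ p (s + j) (t + 1 - j) +
      ∑ j ∈ Finset.range (t + 1 + 1), (q p ^ (-a * (j : ℤ)) * qbinom p s j *
          (xi p * q p ^ (2 * ((s : ℤ) + j) - a) * qint p (t - j - b) * qint p (t - j + 1))) •
            vtx₂ p (s + j) (t + 1 - j) := by
    rw [Finset.sum_range_succ', Finset.sum_range_succ (n := t + 1)]
    simp only [CharP.cast_eq_zero, qint_zero, mul_zero, zero_mul, zero_smul, add_zero]
    rw [show (t : ℤ) - ((t + 1 : ℕ) : ℤ) + 1 = 0 by push_cast; ring, qint_zero]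
    simp only [mul_zero, zero_smul, add_zero]
    rw [fusVtx, map_sum, ← Finset.sum_add_distrib]
    refine Finset.sum_congr rfl fun i hi => ?_
    have hi' : i ≤ t := by rw [Finset.mem_range] at hi; omega
    rw [map_smul, twoF_vtx₂, smul_add, smul_smul, smul_smul, show t + 1 - (i + 1) = t - i by omega,
      show t + 1 - i = t - i + 1 by omega]
    push_cast [hi']
    congr 1
    · rcases lt_or_ge (s + i + 1) p with h | h
      · rw [show s + (i + 1) = s + i + 1 by ring]
        congr 1
        rw [add_sub_cancel_right, show (s : ℤ) - (i + 1) + 1 + 2 * t - a - b =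
          s + i + 2 * (t - i) - a - b by ring]
        linear_combination (q p ^ (-a * (i : ℤ)) * xi p *
          qint p (s + i + 2 * (t - i) - a - b)) * qbinom_mul_right hp h
      · rw [vtx₂_eq_zero_left (show p ≤ s + (i + 1) by omega),
          vtx₂_eq_zero_left (show p ≤ s + i + 1 by omega)]; simp
  rw [e1, e2, fusVtx, Finset.smul_sum, ← Finset.sum_add_distrib, ← Finset.sum_add_distrib]
  refine Finset.sum_congr rfl fun j _ => ?_
  rw [smul_smul, ← add_smul, ← add_smul]
  congr 1
  have hz : ∀ k : ℤ, q p ^ k ≠ 0 := fun k => zpow_ne_zero _ (q_ne_zero p)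
  have h1 : q p ^ (-a * ((j : ℤ) - 1)) = q p ^ (-a * (j : ℤ)) * q p ^ a := by
    rw [← zpow_add₀ (q_ne_zero p)]; congr 1; ring
  have h2 : q p ^ (2 * ((s : ℤ) + j) - a) = Q p s * Q p j / q p ^ a := by
    rw [zpow_sub₀ (q_ne_zero p), ← Q_add]; rfl
  have h3 : q p ^ (2 * (s : ℤ) - a) = Q p s / q p ^ a := by
    rw [zpow_sub₀ (q_ne_zero p)]; rfl
  have h4 : Q p a = q p ^ a * q p ^ a := by
    rw [← zpow_add₀ (q_ne_zero p), Q]; congr 1; ring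
  have h0 := sub_ne_zero.2 (Q_one_ne_one hp)
  rw [h1, h2, h3]
  simp only [qint_eq, Q_add, Q_sub, h4, two_mul]
  have := Q_ne_zero p s
  have := Q_ne_zero p t
  have := Q_ne_zero p j
  have := Q_ne_zero p b
  have := Q_ne_zero p 1
  have := hz a
  field_simp
  ring

omit [NeZero p] in
-- Pascal's rule: it separates the terms in which the leftmost F comes from the first factor from
-- those in which it comes from the second.
lemma twoD_fusVtx (hp : 2 ≤ p) (a : ℤ) {s t : ℕ} (hs : s < p) (ht : t < p) :
    twoD p (fusVtx p a s t) =
      (if s = 0 then 0 else fusVtx p a (s - 1) t) +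
        q p ^ (2 * (s : ℤ) - a) • (if t = 0 then 0 else fusVtx p a s (t - 1)) := by
  have e2 : (if t = 0 then 0 else fusVtx p a s (t - 1)) =
      ∑ i ∈ Finset.range t, (q p ^ (-a * (i : ℤ)) * qbinom p s i) • vtx₂ p (s + i) (t - (i + 1)) := by
    cases t with
    | zero => simp
    | succ t =>
      rw [if_neg (by omega), fusVtx]
      refine Finset.sum_congr rfl fun i _ => ?_
      rw [show t + 1 - 1 - i = t + 1 - (i + 1) by omega]
  have e0 : twoD p (fusVtx p a s t) = ∑ i ∈ Finset.range (t + 1),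
      (q p ^ (-a * (i : ℤ)) * qbinom p s i) •
        (if s + i = 0 then 0 else vtx₂ p (s + i - 1) (t - i)) := by
    rw [fusVtx, map_sum]
    refine Finset.sum_congr rfl fun i _ => ?_
    rw [map_smul]
    rcases lt_or_ge (s + i) p with h | h
    · congr 1
      split_ifs with h0
      · rw [h0, twoD_vtx₂_zero]
      · rw [show s + i = s + i - 1 + 1 by omega, twoD_vtx₂_succ (by omega)]; rfl
    · rw [qbinom_eq_zero hp h]; simp
  rw [e0, e2, Finset.sum_range_succ', Finset.smul_sum]
  have hq : ∀ i : ℕ, q p ^ (2 * (s : ℤ) - a) * q p ^ (-a * (i : ℤ)) =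
      q p ^ (-a * ((i + 1 : ℕ) : ℤ)) * Q p s := by
    intro i
    rw [Q, ← zpow_add₀ (q_ne_zero p), ← zpow_add₀ (q_ne_zero p)]
    congr 1; push_cast; ring
  cases s with
  | zero =>
    simp only [if_true, zero_add, smul_zero, add_zero]
    refine Finset.sum_congr rfl fun i hi => ?_
    rw [Finset.mem_range] at hi
    rw [if_neg (by omega), smul_smul, ← mul_assoc, hq, qbinom_zero_left hp (by omega),
      qbinom_zero_left hp (by omega)]
    simp
  | succ s =>
    rw [add_zero, if_neg (show ¬s + 1 = 0 by omega), if_neg (show ¬s + 1 = 0 by omega), fusVtx,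
      Finset.sum_range_succ' _ t, add_right_comm, ← Finset.sum_add_distrib]
    congr 1
    · refine Finset.sum_congr rfl fun i hi => ?_
      rw [if_neg (by omega), smul_smul, ← mul_assoc, hq,
        show s + 1 + (i + 1) - 1 = s + 1 + i by omega, show s + 1 - 1 + (i + 1) = s + 1 + i by omega,
        ← add_smul]
      rcases lt_or_ge (s + 1 + i) p with h | h
      · rw [qbinom_pascal hp (by omega), show s + 1 - 1 = s by omega]
        congr 1
        push_cast
        ring
      · rw [vtx₂_eq_zero_left h]; simp
    · rw [qbinom_zero_right hp hs, qbinom_zero_right hp (by omega)]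
      simp

lemma fus_tenF (hp : 2 ≤ p) (hn : n ≤ p) (ha : qint p (n - 1 - a) * qint p n = 0)
    (hb : qint p (m - 1 - b) * qint p m = 0) (v : (Fin n → ℂ) ⊗[ℂ] (Fin m → ℂ)) :
    fus p n m a (tenF p n m a b v) = twoF p a b (fus p n m a v) := by
  refine LinearMap.congr_fun (vtx_tmul_ext (g := fus p n m a ∘ₗ tenF p n m a b)
    (h := twoF p a b ∘ₗ fus p n m a) fun s hs t ht => ?_) v
  rw [LinearMap.comp_apply, LinearMap.comp_apply, fus_tmul hs ht, twoF_fusVtx hp,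
    tenF_tmul hp hn ha, map_add, map_smul, map_smul]
  congr 1
  · rcases lt_or_ge (s + 1) n with h | h
    · rw [fus_tmul h ht]
    · obtain rfl : n = s + 1 := by omega
      push_cast at ha
      rw [add_sub_cancel_right] at ha
      rw [mul_assoc, ha]
      simp
  · rcases lt_or_ge (t + 1) m with h | h
    · rw [fus_tmul hs h]
    · obtain rfl : m = t + 1 := by omega
      push_cast at hb
      rw [add_sub_cancel_right] at hb
      rw [mul_assoc (xi p), hb]
      simp

lemma fus_tenD (hp : 2 ≤ p) (hn : n ≤ p) (hm : m ≤ p) (ha : qint p (n - 1 - a) * qint p n = 0)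
    (v : (Fin n → ℂ) ⊗[ℂ] (Fin m → ℂ)) :
    fus p n m a (tenD p n m a b v) = twoD p (fus p n m a v) := by
  refine LinearMap.congr_fun (vtx_tmul_ext (g := fus p n m a ∘ₗ tenD p n m a b)
    (h := twoD p ∘ₗ fus p n m a) fun s hs t ht => ?_) v
  rw [LinearMap.comp_apply, LinearMap.comp_apply, fus_tmul hs ht,
    twoD_fusVtx hp a (by omega) (by omega), tenD_tmul hp hn ha, map_add, map_smul]
  congr 1
  · cases s with
    | zero => rw [oneD_vtx_zero]; simp
    | succ s => rw [oneD_vtx_succ hs, fus_tmul (by omega) ht]; rfl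
  · cases t with
    | zero => rw [oneD_vtx_zero]; simp
    | succ t => rw [oneD_vtx_succ ht, fus_tmul hs (by omega)]; rfl

lemma fus_tenProj (hp : 2 ≤ p) (hn : n ≤ p) (hm : m ≤ p)
    (ha : qint p (n - 1 - a) * qint p n = 0) (hb : qint p (m - 1 - b) * qint p m = 0)
    (α : ZMod (4 * p)) (v : (Fin n → ℂ) ⊗[ℂ] (Fin m → ℂ)) :
    fus p n m a (tenProj p n m a b α v) = twoProj p a b α (fus p n m a v) := by
  refine LinearMap.congr_fun (vtx_tmul_ext (g := fus p n m a ∘ₗ tenProj p n m a b α)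
    (h := twoProj p a b α ∘ₗ fus p n m a) fun s hs t ht => ?_) v
  rw [LinearMap.comp_apply, LinearMap.comp_apply, tenProj_tmul hp hn hm ha hb, fus_tmul hs ht,
    fusVtx, map_sum]
  split_ifs with h
  · rw [fus_tmul hs ht, fusVtx]
    refine Finset.sum_congr rfl fun i hi => ?_
    rw [Finset.mem_range] at hi
    rw [map_smul, twoProj_vtx₂, if_pos]
    rw [h]; congr 1; push_cast [show i ≤ t by omega]; ring
  · rw [map_zero]
    symm
    refine Finset.sum_eq_zero fun i hi => ?_
    rw [Finset.mem_range] at hi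
    rw [map_smul, twoProj_vtx₂, if_neg, smul_zero]
    intro h'
    apply h
    rw [h']; congr 1; push_cast [show i ≤ t by omega]; ring

omit [NeZero p] in
lemma fusVtx_apply_of_lt {s s₀ : ℕ} (h : s₀ < s) (t : ℕ) (j : Fin p × Fin p)
    (hj : j.1.val = s₀) : fusVtx p a s t j = 0 := by
  rw [fusVtx, Finset.sum_apply]
  refine Finset.sum_eq_zero fun i _ => ?_
  rw [Pi.smul_apply, vtx₂, if_neg (by omega), smul_zero]

omit [NeZero p] in
lemma fusVtx_apply_of_eq (hp : 2 ≤ p) (t : ℕ) (j : Fin p × Fin p) :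
    fusVtx p a j.1 t j = if j.2.val = t then 1 else 0 := by
  rw [fusVtx, Finset.sum_apply, Finset.sum_range_succ', Finset.sum_eq_zero]
  · simp [vtx₂, qbinom_zero_right hp j.1.2]
  · intro i _
    rw [Pi.smul_apply, vtx₂, if_neg (by omega), smul_zero]

omit [NeZero p] in
lemma exists_sum_vtx (v : (Fin n → ℂ) ⊗[ℂ] (Fin m → ℂ)) : ∃ c : ℕ → ℕ → ℂ,
    v = ∑ s ∈ Finset.range n, ∑ t ∈ Finset.range m, c s t • (vtx n s ⊗ₜ[ℂ] vtx m t) := by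
  induction v using TensorProduct.induction_on with
  | zero => exact ⟨fun _ _ => 0, by simp⟩
  | add v w hv hw =>
    obtain ⟨c, hc⟩ := hv
    obtain ⟨e, he⟩ := hw
    refine ⟨fun s t => c s t + e s t, ?_⟩
    conv_lhs => rw [hc, he]
    simp only [add_smul, Finset.sum_add_distrib]
  | tmul x y =>
    have hx : ∀ (k : ℕ) (x : Fin k → ℂ), x = ∑ s ∈ Finset.range k,
        (if h : s < k then x ⟨s, h⟩ else 0) • vtx k s := by
      intro k x
      rw [Finset.sum_range (fun s => (if h : s < k then x ⟨s, h⟩ else 0) • vtx k s)]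
      simp only [vtx_eq_single, Fin.is_lt, dite_true, Fin.eta]
      ext i
      simp [Finset.sum_apply, Pi.single_apply]
    refine ⟨fun s t => (if h : s < n then x ⟨s, h⟩ else 0) * (if h : t < m then y ⟨t, h⟩ else 0), ?_⟩
    conv_lhs => rw [hx n x, hx m y]
    rw [TensorProduct.sum_tmul]
    refine Finset.sum_congr rfl fun s _ => ?_
    rw [TensorProduct.tmul_sum]
    refine Finset.sum_congr rfl fun t _ => ?_
    rw [← TensorProduct.smul_tmul', TensorProduct.tmul_smul, smul_smul]

omit [NeZero p] in
-- Triangularity: V_s ⊗ V_t goes to V_{s,t} plus terms with larger first index, so the coefficients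
-- of an element of the kernel vanish by induction on s.
lemma fus_injective (hp : 2 ≤ p) (hn : n ≤ p) (hm : m ≤ p) :
    Function.Injective (fus p n m a) := by
  rw [← LinearMap.ker_eq_bot, LinearMap.ker_eq_bot']
  intro v hv
  obtain ⟨c, rfl⟩ := exists_sum_vtx v
  have e : ∑ s ∈ Finset.range n, ∑ t ∈ Finset.range m, c s t • fusVtx p a s t = 0 := by
    rw [← hv, map_sum]
    refine Finset.sum_congr rfl fun s hs => ?_
    rw [map_sum]
    refine Finset.sum_congr rfl fun t ht => ?_
    rw [map_smul, fus_tmul (Finset.mem_range.1 hs) (Finset.mem_range.1 ht)]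
  have key : ∀ s, s < n → ∀ t, t < m → c s t = 0 := by
    intro s
    induction s using Nat.strong_induction_on with
    | _ s ih =>
      intro hs t ht
      have h0 := congrFun e (⟨s, by omega⟩, ⟨t, by omega⟩)
      simp only [Finset.sum_apply, Pi.smul_apply, Pi.zero_apply] at h0
      rw [Finset.sum_eq_single s, Finset.sum_eq_single t] at h0
      · have := fusVtx_apply_of_eq (a := a) hp t ((⟨s, by omega⟩, ⟨t, by omega⟩) : Fin p × Fin p)
        simp only [if_true] at this
        simpa [this] using h0
      · intro t' _ htt
        have := fusVtx_apply_of_eq (a := a) hp t' ((⟨s, by omega⟩, ⟨t, by omega⟩) : Fin p × Fin p)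
        rw [if_neg (fun h => htt h.symm)] at this
        simp only at this
        rw [this, smul_zero]
      · intro h; simp at h; omega
      · intro s' hs' hss
        refine Finset.sum_eq_zero fun t' ht' => ?_
        rcases lt_or_gt_of_ne hss with h | h
        · rw [ih s' h (Finset.mem_range.1 hs') t' (Finset.mem_range.1 ht'), zero_smul]
        · rw [fusVtx_apply_of_lt h t' _ rfl, smul_zero]
      · intro h; simp at h; omega
  refine Finset.sum_eq_zero fun s hs => Finset.sum_eq_zero fun t ht => ?_
  rw [key s (Finset.mem_range.1 hs) t (Finset.mem_range.1 ht), zero_smul]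

lemma qint_self_mul (hp : 2 ≤ p) (k : ℤ) : qint p k * qint p p = 0 := by
  rw [(qint_eq_zero_iff hp (p : ℤ)).2 dvd_rfl, mul_zero]

/-- For n = m = p the fusion map is an injection between spaces of dimension p², hence a bijection.
It carries the operator of the tensor product, whose p-th power is zero, to `twoF`. Since ⟨p⟩ = 0,
the truncation condition holds for arbitrary a and b. -/
lemma twoF_pow (hp : 2 ≤ p) (a b : ℤ) : twoF p a b ^ p = 0 := by
  have hsurj : Function.Surjective (fus p p p a) := by
    refine (LinearMap.injective_iff_surjective_of_finrank_eq_finrank ?_).1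
      (fus_injective hp le_rfl le_rfl)
    simp
  have hcomm : ∀ j v, fus p p p a ((tenF p p p a b ^ j) v) =
      (twoF p a b ^ j) (fus p p p a v) := by
    intro j
    induction j with
    | zero => simp
    | succ j ih =>
      intro v
      rw [pow_succ, Module.End.mul_apply, ih, fus_tenF hp le_rfl (qint_self_mul hp _)
        (qint_self_mul hp _), pow_succ, Module.End.mul_apply]
  have hpow : tenF p p p a b ^ p = 0 :=
    (ops_ten hp le_rfl le_rfl (qint_self_mul hp _) (qint_self_mul hp _)).f_pow
  refine LinearMap.ext fun w => ?_
  obtain ⟨v, rfl⟩ := hsurj w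
  rw [← hcomm, hpow]
  simp

lemma ops_twoVertex (hp : 2 ≤ p) (a b : ℤ) :
    HasOps (twoVertex p a b) (twoF p a b) (twoD p) :=
  ops_twoVertex_of_pow hp (twoF_pow hp a b)

theorem isHom_fusionMap (hp : 2 ≤ p) (hn : n ≤ p) (hm : m ≤ p)
    (ha : qint p (n - 1 - a) * qint p n = 0) (hb : qint p (m - 1 - b) * qint p m = 0) :
    IsHom (Y := tensor (oneVertex p n a) (oneVertex p m b)) (Z := twoVertex p a b)
      (fusionMap p n m a b) :=
  isHom_of_ops (ops_ten hp hn hm ha hb) (ops_twoVertex hp a b) hp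
    (fus_tenProj hp hn hm ha hb) (fus_tenF hp hn ha hb) (fus_tenD hp hn hm ha)

omit [NeZero p] in
theorem fusionMap_injective (hp : 2 ≤ p) (hn : n ≤ p) (hm : m ≤ p) :
    Function.Injective (fusionMap p n m a b) :=
  fus_injective hp hn hm

end Fusion

/-! ### Simple modules -/

/-- A nonzero graded subspace that is stable under a nilpotent operator of degree `2` contains a
nonzero homogeneous vector that is killed by the operator. -/
lemma exists_homog_coinvariant [NeZero p] {V : Type} [AddCommGroup V] [Module ℂ V]
    {π : ZMod (4 * p) → V →ₗ[ℂ] V} {d : Module.End ℂ V} {N : ℕ}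
    (hcomp : ∀ α β, π α ∘ₗ π β = if α = β then π α else 0) (hsum : ∑ α, π α = LinearMap.id)
    (hdπ : ∀ α, d ∘ₗ π α = π (α + 2) ∘ₗ d) (hd : d ^ N = 0) {W : Submodule ℂ V}
    (hπW : ∀ α, ∀ w ∈ W, π α w ∈ W) (hdW : ∀ w ∈ W, d w ∈ W) (hW : W ≠ ⊥) :
    ∃ (α : ZMod (4 * p)) (w : V), w ∈ W ∧ w ≠ 0 ∧ π α w = w ∧ d w = 0 := by
  obtain ⟨v, hv, hv0⟩ := W.ne_bot_iff.1 hW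
  obtain ⟨α, hα⟩ : ∃ α, π α v ≠ 0 := by
    by_contra! h
    apply hv0
    have := LinearMap.congr_fun hsum v
    rw [LinearMap.sum_apply, Finset.sum_eq_zero fun α _ => h α] at this
    exact this.symm
  have hself : π α (π α v) = π α v := by
    have := LinearMap.congr_fun (hcomp α α) v
    simpa using this
  have key : ∀ k : ℕ, ∀ (α : ZMod (4 * p)) (w : V), w ∈ W → w ≠ 0 → π α w = w → (d ^ k) w = 0 →
      ∃ (α : ZMod (4 * p)) (w : V), w ∈ W ∧ w ≠ 0 ∧ π α w = w ∧ d w = 0 := by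
    intro k
    induction k with
    | zero => intro α w _ h0 _ h; exact absurd h h0
    | succ k ih =>
      intro α w hw h0 hα h
      by_cases hdw : d w = 0
      · exact ⟨α, w, hw, h0, hα, hdw⟩
      · refine ih (α + 2) (d w) (hdW w hw) hdw ?_ ?_
        · have := LinearMap.congr_fun (hdπ α) w
          simp only [LinearMap.comp_apply, hα] at this
          exact this.symm
        · rwa [pow_succ] at h
  exact key N α _ (hπW α v hv) hα hself (by rw [hd]; rfl)

/-- The coefficient of `V_s` in `F^s ▸ V_0`. -/
def oneCoef (p : ℕ) (a : ℤ) (s : ℕ) : ℂ :=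
  ∏ i ∈ Finset.range s, (xi p * qint p (i - a) * qint p (i + 1))

lemma oneF_pow_vtx_zero (p n : ℕ) (a : ℤ) (s : ℕ) :
    (oneF p n a ^ s) (vtx n 0) = oneCoef p a s • vtx n s := by
  induction s with
  | zero => simp [oneCoef]
  | succ s ih =>
    rw [pow_succ', Module.End.mul_apply, ih, map_smul, oneF_vtx, smul_smul, oneCoef,
      oneCoef, Finset.prod_range_succ]

lemma oneCoef_succ (p : ℕ) (a : ℤ) (s : ℕ) :
    oneCoef p a (s + 1) = oneCoef p a s * (xi p * qint p (s - a) * qint p (s + 1)) := by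
  rw [oneCoef, Finset.prod_range_succ]; rfl

/-- For i < r − 1 the number (r − 1 − a) − (i − a) = r − 1 − i lies strictly between 0 and p, so ⟨i
− a⟩ does not vanish. -/
lemma oneCoef_ne_zero (hp : 2 ≤ p) {r : ℕ} (hr : r ≤ p) {a : ℤ} (ha : (p : ℤ) ∣ r - 1 - a)
    {s : ℕ} (hs : s < r) : oneCoef p a s ≠ 0 := by
  have : NeZero p := ⟨by omega⟩
  rw [oneCoef, Finset.prod_ne_zero_iff]
  intro i hi
  rw [Finset.mem_range] at hi
  refine mul_ne_zero (mul_ne_zero (xi_ne_zero hp) ?_) (qint_ne_zero hp (by omega) (by omega))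
  rw [Ne, qint_eq_zero_iff hp]
  intro h
  have h1 := dvd_sub ha h
  rw [show (r : ℤ) - 1 - a - (i - a) = ((r - 1 - i : ℕ) : ℤ) by omega] at h1
  have := Nat.le_of_dvd (by omega) (Int.natCast_dvd_natCast.1 h1)
  omega

lemma oneD_apply {n k : ℕ} (hk : k + 1 < n) (w : Fin n → ℂ) :
    oneD n w ⟨k, by omega⟩ = w ⟨k + 1, hk⟩ := by
  refine LinearMap.congr_fun (vtx_ext
    (g := (LinearMap.proj (⟨k, by omega⟩ : Fin n) : (Fin n → ℂ) →ₗ[ℂ] ℂ) ∘ₗ oneD n)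
    (h := LinearMap.proj (⟨k + 1, hk⟩ : Fin n)) fun s hs => ?_) w
  rw [LinearMap.comp_apply, LinearMap.proj_apply, LinearMap.proj_apply]
  cases s with
  | zero => rw [oneD_vtx_zero]; simp [vtx]
  | succ s => rw [oneD_vtx_succ hs]; simp [vtx]

lemma eq_sum_vtx {n : ℕ} (w : Fin n → ℂ) : w = ∑ i : Fin n, w i • vtx n i := by
  ext j
  simp [vtx_eq_single, Finset.sum_apply, Pi.single_apply]

lemma oneD_ker {n : ℕ} (hn : 0 < n) {w : Fin n → ℂ} (hw : oneD n w = 0) :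
    ∃ c : ℂ, w = c • vtx n 0 := by
  refine ⟨w ⟨0, hn⟩, ?_⟩
  ext ⟨j, hj⟩
  cases j with
  | zero => simp [vtx]
  | succ k => rw [← oneD_apply hj w, hw]; simp [vtx]

lemma qint_mul_eq_zero_of_dvd [NeZero p] (hp : 2 ≤ p) {k m : ℤ} (h : (p : ℤ) ∣ k) :
    qint p k * qint p m = 0 := by
  rw [(qint_eq_zero_iff hp k).2 h, zero_mul]

lemma dvd_label (p r : ℕ) (ν : ZMod 4) : (p : ℤ) ∣ r - 1 - label p r ν :=
  ⟨ν.val, by rw [label]; ring⟩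

lemma ops_X [NeZero p] (hp : 2 ≤ p) {r : ℕ} (hr : r ≤ p) (ν : ZMod 4) :
    HasOps (X p r ν) (oneF p r (label p r ν)) (oneD r) :=
  ops_oneVertex hp hr (qint_mul_eq_zero_of_dvd hp (dvd_label p r ν))

lemma eq_top_of_vtx_zero_mem [NeZero p] (hp : 2 ≤ p) {r : ℕ} (hr : r ≤ p) {a : ℤ}
    (ha : (p : ℤ) ∣ r - 1 - a) {W : Submodule ℂ (Fin r → ℂ)} (hf : ∀ w ∈ W, oneF p r a w ∈ W)
    (hv : vtx r 0 ∈ W) : W = ⊤ := by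
  have hpow : ∀ s, (oneF p r a ^ s) (vtx r 0) ∈ W := by
    intro s
    induction s with
    | zero => simpa
    | succ s ih => rw [pow_succ', Module.End.mul_apply]; exact hf _ ih
  rw [eq_top_iff]
  intro x _
  rw [eq_sum_vtx x]
  refine W.sum_mem fun i _ => W.smul_mem _ ?_
  have h2 := oneCoef_ne_zero hp hr ha i.2
  have e : vtx r i = (oneCoef p a i)⁻¹ • (oneF p r a ^ i.val) (vtx r 0) := by
    rw [oneF_pow_vtx_zero, smul_smul, inv_mul_cancel₀ h2, one_smul]
  rw [e]
  exact W.smul_mem _ (hpow i)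

/-- A nonzero submodule contains a nonzero coinvariant; this is a multiple of V_0, which generates
everything under F. -/
theorem isSimple_oneVertex [NeZero p] (hp : 2 ≤ p) {r : ℕ} (h1 : 1 ≤ r) (hr : r ≤ p) {a : ℤ}
    (ha : (p : ℤ) ∣ r - 1 - a) : IsSimpleYD (oneVertex p r a) := by
  have hops := ops_oneVertex (a := a) hp hr (qint_mul_eq_zero_of_dvd hp ha)
  refine ⟨⟨⟨vtx r 0, 0, vtx_ne_zero h1⟩⟩, fun W hW => ?_⟩
  by_cases h0 : W = ⊥
  · exact Or.inl h0
  right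
  obtain ⟨hg, hf, hd⟩ := (hops.isSub_iff hp W).1 hW
  obtain ⟨α, w, hwW, hw0, -, hdw⟩ := exists_homog_coinvariant hops.proj_comp hops.proj_sum
    hops.d_proj hops.d_pow hg hd h0
  obtain ⟨c, rfl⟩ := oneD_ker h1 hdw
  have hc0 : c ≠ 0 := fun h => hw0 (by rw [h]; exact zero_smul ℂ (vtx r 0))
  exact eq_top_of_vtx_zero_mem hp hr ha hf ((W.smul_mem_iff hc0).1 hwW)

/-- A coinvariant `u` of a Yetter--Drinfeld module gives a morphism from the simple module whose
highest charge is that of `u`. -/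
theorem exists_isHom_oneVertex [NeZero p] (hp : 2 ≤ p) {r : ℕ} (hr : r ≤ p) {a : ℤ}
    (ha : (p : ℤ) ∣ r - 1 - a) {Y : YDData p} {f d : Module.End ℂ Y.carrier}
    (h : HasOps Y f d) {u : Y.carrier} (hu : Y.proj a u = u) (hdu : d u = 0)
    (hfu : (f ^ r) u = 0) :
    ∃ φ : (Fin r → ℂ) →ₗ[ℂ] Y.carrier, IsHom (Y := oneVertex p r a) (Z := Y) φ ∧
      (0 < r → φ (vtx r 0) = u) := by
  -- Compatibility with F forces this choice: F^s ▸ V_0 is `oneCoef p a s` times V_s.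
  let φ : (Fin r → ℂ) →ₗ[ℂ] Y.carrier := (Pi.basisFun ℂ (Fin r)).constr ℂ fun s =>
    (oneCoef p a s)⁻¹ • (f ^ s.val) u
  have hφ : ∀ s, φ (vtx r s) = (oneCoef p a s)⁻¹ • (f ^ s) u := by
    intro s
    rcases lt_or_ge s r with hs | hs
    · have h1 := vtx_eq_single (⟨s, hs⟩ : Fin r)
      simp only at h1
      rw [h1]
      exact basisFun_constr_single _ _
    · obtain ⟨k, rfl⟩ := Nat.exists_eq_add_of_le hs
      rw [vtx_eq_zero hs, map_zero, add_comm, pow_add, Module.End.mul_apply, hfu, map_zero,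
        smul_zero]
  have hops := ops_oneVertex (a := a) hp hr (qint_mul_eq_zero_of_dvd hp ha)
  refine ⟨φ, isHom_of_ops hops h hp ?_ ?_ ?_, fun _ => by simp [hφ, oneCoef]⟩
  · intro α
    refine LinearMap.congr_fun (vtx_ext (g := φ ∘ₗ oneProj p r a α) (h := Y.proj α ∘ₗ φ)
      fun s _ => ?_)
    rw [LinearMap.comp_apply, LinearMap.comp_apply, oneProj_vtx, hφ, map_smul,
      h.homog_of_proj (h.f_pow_homog hu s) α]
    split_ifs
    · rw [hφ]
    · simp
  · refine LinearMap.congr_fun (vtx_ext (g := φ ∘ₗ oneF p r a) (h := f ∘ₗ φ) fun s hs => ?_)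
    rw [LinearMap.comp_apply, LinearMap.comp_apply, oneF_vtx, map_smul, hφ, hφ, map_smul,
      ← Module.End.mul_apply, ← pow_succ']
    rcases lt_or_ge (s + 1) r with h1 | h1
    · have := oneCoef_ne_zero hp hr ha h1
      rw [oneCoef_succ] at this ⊢
      have h2 := right_ne_zero_of_mul this
      have h3 := left_ne_zero_of_mul this
      rw [smul_smul, mul_inv, mul_left_comm, mul_inv_cancel₀ h2, mul_one]
    · obtain rfl : r = s + 1 := by omega
      rw [hfu, smul_zero, smul_zero, smul_zero]
  · refine LinearMap.congr_fun (vtx_ext (g := φ ∘ₗ oneD r) (h := d ∘ₗ φ) fun s hs => ?_)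
    rw [LinearMap.comp_apply, LinearMap.comp_apply, hφ, map_smul]
    cases s with
    | zero => rw [oneD_vtx_zero, pow_zero]; simp [hdu]
    | succ s =>
      have := oneCoef_ne_zero hp hr ha hs
      rw [oneCoef_succ] at this
      have h2 := right_ne_zero_of_mul this
      have h3 := left_ne_zero_of_mul this
      -- The scalar ⟨s+1⟩(1 − q^{2(s−a)}) in d F^{s+1} u is the quotient of consecutive values of
      -- `oneCoef`.
      rw [oneD_vtx_succ hs, hφ, h.d_f_pow hp hu, hdu, map_zero, smul_zero, zero_add, smul_smul,
        oneCoef_succ, ← xi_mul_qint hp, mul_comm (qint p _), mul_inv, mul_assoc,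
        inv_mul_cancel₀ h2, mul_one]

/-! ### Two linked chains -/

/-- Vectors `T` of charge `n` and `u` of charge `n + 2ℓ` such that `u` is coinvariant,
`δ T = 1 ⊗ T + F ⊗ F^{ℓ-1} ▸ u + ⋯`, and `F^ℓ ▸ u ≠ 0`; here `n ≡ r - 1` modulo `p` and
`r + ℓ = p`. -/
structure TopPair [NeZero p] (Y : YDData p) (f d : Module.End ℂ Y.carrier) (r ℓ : ℕ) (n : ℤ)
    (T u : Y.carrier) : Prop where
  ops : HasOps Y f d
  r_pos : 1 ≤ r
  ell_pos : 1 ≤ ℓ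
  add_eq : r + ℓ = p
  dvd : (p : ℤ) ∣ r - 1 - n
  T_charge : Y.proj n T = T
  u_charge : Y.proj ((n + 2 * ℓ : ℤ)) u = u
  d_u : d u = 0
  d_T : d T = (f ^ (ℓ - 1)) u
  f_u : (f ^ ℓ) u ≠ 0

lemma end_pow_succ_apply {V : Type} [AddCommGroup V] [Module ℂ V] (f : Module.End ℂ V) (i : ℕ)
    (v : V) : f ((f ^ i) v) = (f ^ (i + 1)) v := by
  rw [pow_succ']; rfl

lemma end_pow_add_apply {V : Type} [AddCommGroup V] [Module ℂ V] (f : Module.End ℂ V) (i j : ℕ)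
    (v : V) : (f ^ i) ((f ^ j) v) = (f ^ (i + j)) v := by
  rw [pow_add]; rfl

namespace TopPair

variable [NeZero p] {Y : YDData p} {f d : Module.End ℂ Y.carrier} {r ℓ : ℕ} {n : ℤ}
  {T u : Y.carrier} (t : TopPair Y f d r ℓ n T u)
include t

lemma two_le : 2 ≤ p := by
  have := t.r_pos; have := t.ell_pos; have := t.add_eq; omega

lemma pow_apply_of_le {i : ℕ} (hi : p ≤ i) (v : Y.carrier) : (f ^ i) v = 0 := by
  obtain ⟨k, rfl⟩ := Nat.exists_eq_add_of_le hi
  rw [pow_add, t.ops.f_pow, zero_mul]; rfl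

lemma x_charge (i : ℕ) : Y.proj ((n - 2 * i : ℤ)) ((f ^ i) T) = (f ^ i) T :=
  HasOps.f_pow_homog t.ops t.T_charge i

lemma y_charge (i : ℕ) : Y.proj ((n + 2 * ℓ - 2 * i : ℤ)) ((f ^ i) u) = (f ^ i) u :=
  HasOps.f_pow_homog t.ops t.u_charge i

lemma Q_sub_label (k : ℤ) : Q p (k - n) = Q p (k + 1 - r) := by
  rw [Q_eq_Q_iff]
  obtain ⟨c, hc⟩ := t.dvd
  exact ⟨c, by linarith⟩

/-- The charge n + 2ℓ of u is congruent to ℓ − 1 modulo p, because r + ℓ = p. For i + 1 < p the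
scalar vanishes only at i + 1 = ℓ, so F^ℓ u is the one further coinvariant of this chain. -/
lemma d_y_succ (i : ℕ) : d ((f ^ (i + 1)) u) =
    (qint p (i + 1) * (1 - Q p (i + 1 - ℓ))) • (f ^ i) u := by
  rw [HasOps.d_f_pow t.ops t.two_le t.u_charge, t.d_u, map_zero, smul_zero, zero_add,
    ← sub_sub, sub_right_comm, t.Q_sub_label]
  congr 3
  rw [Q_eq_Q_iff]
  have : (r : ℤ) + ℓ = p := by exact_mod_cast t.add_eq
  exact ⟨-1, by linarith⟩

lemma d_x_succ (i : ℕ) : d ((f ^ (i + 1)) T) = Q p (i + 1) • (f ^ (i + ℓ)) u +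
    (qint p (i + 1) * (1 - Q p (i + 1 - r))) • (f ^ i) T := by
  have h1 := t.ell_pos
  rw [HasOps.d_f_pow t.ops t.two_le t.T_charge, t.d_T, end_pow_add_apply, t.Q_sub_label,
    show i + 1 + (ℓ - 1) = i + ℓ by omega]

lemma coef_ne_zero {i k : ℕ} (hi : i + 1 < p) (hk : k < p) (h : i + 1 ≠ k) :
    qint p (i + 1) * (1 - Q p (i + 1 - k)) ≠ 0 := by
  refine mul_ne_zero (qint_ne_zero t.two_le (by omega) (by omega)) (sub_ne_zero.2 fun h1 => ?_)
  rw [eq_comm, Q_eq_one_iff] at h1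
  have := Int.eq_zero_of_abs_lt_dvd h1 (by rw [abs_lt]; omega)
  omega

/-- From F^ℓ u ≠ 0 one climbs: d takes F^{ℓ+j+1} u to a nonzero multiple of F^{ℓ+j} u. This reaches
F^{p−1} u ≠ 0, which is an F-power of every earlier vector. -/
lemma y_ne_zero {i : ℕ} (hi : i < p) : (f ^ i) u ≠ 0 := by
  have h1 := t.add_eq; have h2 := t.r_pos; have h3 := t.ell_pos
  have key : ∀ j, ℓ + j < p → (f ^ (ℓ + j)) u ≠ 0 := by
    intro j
    induction j with
    | zero => intro _; exact t.f_u
    | succ j ih =>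
      intro hj h0
      have h4 := t.d_y_succ (ℓ + j)
      rw [show ℓ + j + 1 = ℓ + (j + 1) by ring, h0, map_zero, eq_comm, smul_eq_zero] at h4
      exact h4.elim (t.coef_ne_zero (by omega) (by omega) (by omega)) (ih (by omega))
  intro h0
  apply key (p - 1 - ℓ) (by omega)
  rw [show ℓ + (p - 1 - ℓ) = p - 1 - i + i by omega, ← end_pow_add_apply, h0, map_zero]

/-- At index r the descent within the chain of T breaks, and only the link to the chain of u
remains. -/
lemma d_x_r : d ((f ^ r) T) = Q p r • (f ^ (p - 1)) u := by
  obtain ⟨k, rfl⟩ := Nat.exists_eq_add_of_le' t.r_pos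
  have h1 := t.add_eq
  rw [t.d_x_succ, show p - 1 = k + ℓ by omega]
  push_cast
  rw [sub_self, Q_zero, sub_self, mul_zero, zero_smul, add_zero]

/-- F^r T ≠ 0 because d takes it to a nonzero multiple of F^{p−1} u. From there one climbs as for u;
the additional terms F^{i+ℓ} u vanish since i + ℓ ≥ p. -/
lemma x_ne_zero {i : ℕ} (hi : i < p) : (f ^ i) T ≠ 0 := by
  have h1 := t.add_eq; have h2 := t.r_pos; have h3 := t.ell_pos
  have key : ∀ j, r + j < p → (f ^ (r + j)) T ≠ 0 := by
    intro j
    induction j with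
    | zero =>
      intro _ h0
      have h4 := t.d_x_r
      rw [add_zero] at h0
      rw [h0, map_zero, eq_comm, smul_eq_zero] at h4
      exact h4.elim (Q_ne_zero p _) (t.y_ne_zero (by omega))
    | succ j ih =>
      intro hj h0
      have h4 := t.d_x_succ (r + j)
      rw [show r + j + 1 = r + (j + 1) by ring, h0, map_zero,
        t.pow_apply_of_le (show p ≤ r + j + ℓ by omega), smul_zero, zero_add, eq_comm,
        smul_eq_zero] at h4
      exact h4.elim (t.coef_ne_zero (by omega) (by omega) (by omega)) (ih (by omega))
  intro h0
  apply key (p - 1 - r) (by omega)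
  rw [show r + (p - 1 - r) = p - 1 - i + i by omega, ← end_pow_add_apply, h0, map_zero]

lemma proj_of_ne {a b : ℤ} {v : Y.carrier} (hv : Y.proj a v = v)
    (hab : ¬ ((4 * p : ℕ) : ℤ) ∣ b - a) : Y.proj b v = 0 := by
  rw [HasOps.homog_of_proj t.ops hv, if_neg]
  intro h
  exact hab ((ZMod.intCast_eq_intCast_iff_dvd_sub _ _ _).1 h.symm)

omit [NeZero p] t in
lemma not_dvd_of_lt {k : ℤ} (h0 : k ≠ 0) (h : |k| < 4 * p) : ¬ ((4 * p : ℕ) : ℤ) ∣ k :=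
  fun hk => h0 (Int.eq_zero_of_abs_lt_dvd hk (by push_cast; exact h))

/-- Applying F^{p−1−m} kills all terms of index above m and leaves F^{p−1} T and F^{p−1} u. Their
charges differ by 2ℓ, which is not divisible by 4p, so they can be separated. -/
lemma coeff_eq_zero {a b : ℕ → ℂ}
    (h : ∑ i ∈ Finset.range p, (a i • (f ^ i) T + b i • (f ^ i) u) = 0) :
    ∀ i < p, a i = 0 ∧ b i = 0 := by
  have h1 := t.add_eq; have h2 := t.r_pos; have h3 := t.ell_pos
  intro m
  induction m using Nat.strong_induction_on with
  | _ m ih =>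
    intro hm
    have e := congrArg (f ^ (p - 1 - m)) h
    rw [map_zero, map_sum, Finset.sum_eq_single m] at e
    · rw [map_add, map_smul, map_smul, end_pow_add_apply, end_pow_add_apply,
        show p - 1 - m + m = p - 1 by omega] at e
      have hb : b m = 0 := by
        have e1 := congrArg (Y.proj ((n + 2 * ℓ - 2 * ((p - 1 : ℕ) : ℤ) : ℤ))) e
        rw [map_zero, map_add, map_smul, map_smul, t.y_charge,
          t.proj_of_ne (t.x_charge (p - 1)) (not_dvd_of_lt (by omega) (by
            rw [abs_lt]; omega)), smul_zero, zero_add, smul_eq_zero] at e1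
        exact e1.resolve_right (t.y_ne_zero (by omega))
      rw [hb, zero_smul, add_zero, smul_eq_zero] at e
      exact ⟨e.resolve_right (t.x_ne_zero (by omega)), hb⟩
    · intro i hi him
      rw [Finset.mem_range] at hi
      rcases lt_or_gt_of_ne him with h4 | h4
      · rw [(ih i h4 hi).1, (ih i h4 hi).2, zero_smul, zero_smul, add_zero, map_zero]
      · rw [map_add, map_smul, map_smul, end_pow_add_apply, end_pow_add_apply,
          t.pow_apply_of_le (by omega), t.pow_apply_of_le (by omega), smul_zero, smul_zero,
          add_zero]
    · intro h4; exact absurd (Finset.mem_range.2 hm) h4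

/-- The vectors `F^i ▸ T` and `F^i ▸ u`. -/
def vec (_ : TopPair Y f d r ℓ n T u) : Fin p ⊕ Fin p → Y.carrier :=
  Sum.elim (fun i => (f ^ i.val) T) fun i => (f ^ i.val) u

lemma linearIndependent_vec : LinearIndependent ℂ t.vec := by
  rw [Fintype.linearIndependent_iff]
  intro g hg
  have := t.coeff_eq_zero (a := fun i => if h : i < p then g (Sum.inl ⟨i, h⟩) else 0)
    (b := fun i => if h : i < p then g (Sum.inr ⟨i, h⟩) else 0) (by
      rw [← hg, Fintype.sum_sum_type, Finset.sum_range, ← Finset.sum_add_distrib]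
      simp [vec])
  rintro (i | i)
  · simpa using (this i i.2).1
  · simpa using (this i i.2).2

end TopPair

namespace TopPair

variable [NeZero p] {Y : YDData p} {f d : Module.End ℂ Y.carrier} {r ℓ : ℕ} {n : ℤ}
  {T u : Y.carrier} (t : TopPair Y f d r ℓ n T u)
include t

/-! ### Subspaces spanned by parts of the two chains -/

/-- The span of the `F^i ▸ T` with `A i` and the `F^i ▸ u` with `C i`. -/
def chain (A C : ℕ → Prop) : Submodule ℂ Y.carrier :=
  Submodule.span ℂ (t.vec '' {k | Sum.elim (fun i : Fin p => A i) (fun i : Fin p => C i) k})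

lemma x_mem {A C : ℕ → Prop} {i : ℕ} (h : i < p → A i) : (f ^ i) T ∈ t.chain A C := by
  rcases lt_or_ge i p with hi | hi
  · exact Submodule.subset_span ⟨Sum.inl ⟨i, hi⟩, h hi, rfl⟩
  · rw [t.pow_apply_of_le hi]; exact Submodule.zero_mem _

lemma y_mem {A C : ℕ → Prop} {i : ℕ} (h : i < p → C i) : (f ^ i) u ∈ t.chain A C := by
  rcases lt_or_ge i p with hi | hi
  · exact Submodule.subset_span ⟨Sum.inr ⟨i, hi⟩, h hi, rfl⟩
  · rw [t.pow_apply_of_le hi]; exact Submodule.zero_mem _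

lemma chain_le {A C : ℕ → Prop} {V : Submodule ℂ Y.carrier}
    (hA : ∀ i < p, A i → (f ^ i) T ∈ V) (hC : ∀ i < p, C i → (f ^ i) u ∈ V) :
    t.chain A C ≤ V := by
  rw [chain, Submodule.span_le]
  rintro _ ⟨i | i, hi, rfl⟩
  · exact hA i i.2 hi
  · exact hC i i.2 hi

lemma chain_graded (A C : ℕ → Prop) : Graded Y (t.chain A C) := by
  intro α
  refine t.chain_le (V := (t.chain A C).comap (Y.proj α)) (fun i hi h => ?_) fun i hi h => ?_
  · rw [Submodule.mem_comap, HasOps.homog_of_proj t.ops (t.x_charge i)]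
    split_ifs
    · exact t.x_mem fun _ => h
    · exact Submodule.zero_mem _
  · rw [Submodule.mem_comap, HasOps.homog_of_proj t.ops (t.y_charge i)]
    split_ifs
    · exact t.y_mem fun _ => h
    · exact Submodule.zero_mem _

lemma chain_f {A C : ℕ → Prop} (hA : ∀ i, A i → A (i + 1)) (hC : ∀ i, C i → C (i + 1)) :
    ∀ w ∈ t.chain A C, f w ∈ t.chain A C := by
  refine t.chain_le (V := (t.chain A C).comap f) (fun i _ h => ?_) fun i _ h => ?_
  · rw [Submodule.mem_comap, end_pow_succ_apply]; exact t.x_mem fun _ => hA i h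
  · rw [Submodule.mem_comap, end_pow_succ_apply]; exact t.y_mem fun _ => hC i h

/-- Closure under d has to follow each link of the diagram; the exceptions i + 1 = r and i + 1 = ℓ
are the two places where the descent within a chain breaks. -/
lemma chain_d {A C : ℕ → Prop} (h0 : A 0 → C (ℓ - 1))
    (hA : ∀ i, A (i + 1) → (i + ℓ < p → C (i + ℓ)) ∧ (i + 1 ≠ r → A i))
    (hC : ∀ i, C (i + 1) → i + 1 ≠ ℓ → C i) :
    ∀ w ∈ t.chain A C, d w ∈ t.chain A C := by
  refine t.chain_le (V := (t.chain A C).comap d) (fun i _ h => ?_) fun i _ h => ?_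
  · rw [Submodule.mem_comap]
    cases i with
    | zero => rw [pow_zero, Module.End.one_apply, t.d_T]; exact t.y_mem fun _ => h0 h
    | succ i =>
      rw [t.d_x_succ]
      refine Submodule.add_mem _ (Submodule.smul_mem _ _ (t.y_mem (hA i h).1)) ?_
      by_cases h1 : i + 1 = r
      · rw [show (i : ℤ) + 1 - r = 0 by omega, Q_zero, sub_self, mul_zero, zero_smul]
        exact Submodule.zero_mem _
      · exact Submodule.smul_mem _ _ (t.x_mem fun _ => (hA i h).2 h1)
  · rw [Submodule.mem_comap]
    cases i with
    | zero => rw [pow_zero, Module.End.one_apply, t.d_u]; exact Submodule.zero_mem _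
    | succ i =>
      rw [t.d_y_succ]
      by_cases h1 : i + 1 = ℓ
      · rw [show (i : ℤ) + 1 - ℓ = 0 by omega, Q_zero, sub_self, mul_zero, zero_smul]
        exact Submodule.zero_mem _
      · exact Submodule.smul_mem _ _ (t.y_mem fun _ => hC i h h1)

lemma isSub_chain {A C : ℕ → Prop} (hA : ∀ i, A i → A (i + 1)) (hC : ∀ i, C i → C (i + 1))
    (h0 : A 0 → C (ℓ - 1))
    (hA' : ∀ i, A (i + 1) → (i + ℓ < p → C (i + ℓ)) ∧ (i + 1 ≠ r → A i))
    (hC' : ∀ i, C (i + 1) → i + 1 ≠ ℓ → C i) : IsSub Y (t.chain A C) :=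
  (HasOps.isSub_iff t.ops t.two_le _).2
    ⟨t.chain_graded A C, t.chain_f hA hC, t.chain_d h0 hA' hC'⟩

lemma chain_sup (A C A' C' : ℕ → Prop) :
    t.chain A C ⊔ t.chain A' C' = t.chain (fun i => A i ∨ A' i) fun i => C i ∨ C' i := by
  refine le_antisymm (sup_le (t.chain_le (fun i _ h => t.x_mem fun _ => Or.inl h)
    fun i _ h => t.y_mem fun _ => Or.inl h) (t.chain_le (fun i _ h => t.x_mem fun _ => Or.inr h)
    fun i _ h => t.y_mem fun _ => Or.inr h)) (t.chain_le ?_ ?_)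
  · rintro i _ (h | h)
    · exact Submodule.mem_sup_left (t.x_mem fun _ => h)
    · exact Submodule.mem_sup_right (t.x_mem fun _ => h)
  · rintro i _ (h | h)
    · exact Submodule.mem_sup_left (t.y_mem fun _ => h)
    · exact Submodule.mem_sup_right (t.y_mem fun _ => h)

lemma chain_mono {A C A' C' : ℕ → Prop} (hA : ∀ i < p, A i → A' i) (hC : ∀ i < p, C i → C' i) :
    t.chain A C ≤ t.chain A' C' :=
  t.chain_le (fun i hi h => t.x_mem fun _ => hA i hi h) fun i hi h => t.y_mem fun _ => hC i hi h

lemma chain_congr {A C A' C' : ℕ → Prop} (hA : ∀ i < p, (A i ↔ A' i))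
    (hC : ∀ i < p, (C i ↔ C' i)) : t.chain A C = t.chain A' C' :=
  le_antisymm (t.chain_mono (fun i hi => (hA i hi).1) fun i hi => (hC i hi).1)
    (t.chain_mono (fun i hi => (hA i hi).2) fun i hi => (hC i hi).2)

lemma chain_eq_bot {A C : ℕ → Prop} (hA : ∀ i, ¬ A i) (hC : ∀ i, ¬ C i) : t.chain A C = ⊥ :=
  le_bot_iff.1 (t.chain_le (fun i _ h => absurd h (hA i)) fun i _ h => absurd h (hC i))

lemma x_mem_chain_iff {A C : ℕ → Prop} {i : ℕ} (hi : i < p) :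
    (f ^ i) T ∈ t.chain A C ↔ A i := by
  refine ⟨fun h => ?_, fun h => t.x_mem fun _ => h⟩
  by_contra hA
  exact t.linearIndependent_vec.notMem_span_image (x := Sum.inl ⟨i, hi⟩) hA h

lemma y_mem_chain_iff {A C : ℕ → Prop} {i : ℕ} (hi : i < p) :
    (f ^ i) u ∈ t.chain A C ↔ C i := by
  refine ⟨fun h => ?_, fun h => t.y_mem fun _ => h⟩
  by_contra hC
  exact t.linearIndependent_vec.notMem_span_image (x := Sum.inr ⟨i, hi⟩) hC h

lemma chain_eq_top (hg : ∀ W, IsSub Y W → T ∈ W → W = ⊤) {A C : ℕ → Prop}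
    (hA : ∀ i < p, A i) (hC : ∀ i < p, C i) : t.chain A C = ⊤ := by
  rw [t.chain_congr (A' := fun _ => True) (C' := fun _ => True) (fun i hi => by simp [hA i hi])
    fun i hi => by simp [hC i hi]]
  refine hg _ (t.isSub_chain ?_ ?_ ?_ ?_ ?_) (t.x_mem (i := 0) fun _ => trivial) <;> simp

/-- The basis of the vectors `F^i ▸ T` and `F^i ▸ u`. -/
def basis (hg : ∀ W, IsSub Y W → T ∈ W → W = ⊤) : Module.Basis (Fin p ⊕ Fin p) ℂ Y.carrier :=
  Module.Basis.mk t.linearIndependent_vec (by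
    rw [← t.chain_eq_top hg (A := fun _ => True) (C := fun _ => True) (by simp) (by simp)]
    exact Submodule.span_mono (Set.image_subset_range _ _))

lemma basis_inl (hg : ∀ W, IsSub Y W → T ∈ W → W = ⊤) (i : Fin p) :
    t.basis hg (Sum.inl i) = (f ^ i.val) T := by
  rw [basis, Module.Basis.mk_apply]; rfl

lemma basis_inr (hg : ∀ W, IsSub Y W → T ∈ W → W = ⊤) (i : Fin p) :
    t.basis hg (Sum.inr i) = (f ^ i.val) u := by
  rw [basis, Module.Basis.mk_apply]; rfl

lemma finrank_eq (hg : ∀ W, IsSub Y W → T ∈ W → W = ⊤) :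
    Module.finrank ℂ Y.carrier = 2 * p := by
  rw [Module.finrank_eq_card_basis (t.basis hg)]
  simp [two_mul]

lemma chain_inf (hg : ∀ W, IsSub Y W → T ∈ W → W = ⊤) (A C A' C' : ℕ → Prop) :
    t.chain A C ⊓ t.chain A' C' = t.chain (fun i => A i ∧ A' i) fun i => C i ∧ C' i := by
  have hv : t.vec = t.basis hg := by
    rw [basis, Module.Basis.coe_mk]
  refine le_antisymm (fun w hw => ?_) (le_inf (t.chain_mono (fun i _ h => h.1) fun i _ h => h.1)
    (t.chain_mono (fun i _ h => h.2) fun i _ h => h.2))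
  rw [Submodule.mem_inf, chain, chain, hv, Module.Basis.mem_span_image,
    Module.Basis.mem_span_image] at hw
  rw [chain, hv, Module.Basis.mem_span_image]
  intro k hk
  have h1 := hw.1 hk
  have h2 := hw.2 hk
  rcases k with k | k <;> exact ⟨h1, h2⟩

lemma exists_eq_sum (hg : ∀ W, IsSub Y W → T ∈ W → W = ⊤) (w : Y.carrier) :
    ∃ a b : ℕ → ℂ, w = ∑ i ∈ Finset.range p, (a i • (f ^ i) T + b i • (f ^ i) u) := by
  refine ⟨fun i => if h : i < p then (t.basis hg).repr w (Sum.inl ⟨i, h⟩) else 0,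
    fun i => if h : i < p then (t.basis hg).repr w (Sum.inr ⟨i, h⟩) else 0, ?_⟩
  conv_lhs => rw [← (t.basis hg).sum_repr w]
  rw [Fintype.sum_sum_type, Finset.sum_range, ← Finset.sum_add_distrib]
  simp [basis_inl, basis_inr]

/-! ### Submodules -/

omit [NeZero p] t in
lemma pow_mem_of_le {W : Submodule ℂ Y.carrier} (hf : ∀ w ∈ W, f w ∈ W) {v : Y.carrier} {i j : ℕ}
    (hij : i ≤ j) (h : (f ^ i) v ∈ W) : (f ^ j) v ∈ W := by
  induction j, hij using Nat.le_induction with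
  | base => exact h
  | succ j _ ih => rw [← end_pow_succ_apply]; exact hf _ ih

lemma y_mem_pred {W : Submodule ℂ Y.carrier} (hd : ∀ w ∈ W, d w ∈ W) {i : ℕ} (hi : i + 1 < p)
    (hl : i + 1 ≠ ℓ) (h : (f ^ (i + 1)) u ∈ W) : (f ^ i) u ∈ W := by
  have h1 := t.add_eq; have h2 := t.r_pos
  have := hd _ h
  rw [t.d_y_succ] at this
  exact (W.smul_mem_iff (t.coef_ne_zero hi (by omega) hl)).1 this

lemma y_ell_mem {W : Submodule ℂ Y.carrier} (hd : ∀ w ∈ W, d w ∈ W) {i : ℕ} (hi : ℓ + i < p)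
    (h : (f ^ (ℓ + i)) u ∈ W) : (f ^ ℓ) u ∈ W := by
  induction i with
  | zero => exact h
  | succ i ih => exact ih (by omega) (t.y_mem_pred hd (i := ℓ + i) (by omega) (by omega) h)

lemma y_zero_mem {W : Submodule ℂ Y.carrier} (hd : ∀ w ∈ W, d w ∈ W) {i : ℕ} (hi : i < ℓ)
    (h : (f ^ i) u ∈ W) : u ∈ W := by
  have h1 := t.add_eq
  induction i with
  | zero => exact h
  | succ i ih => exact ih (by omega) (t.y_mem_pred hd (i := i) (by omega) (by omega) h)

lemma x_r_mem {W : Submodule ℂ Y.carrier} (hd : ∀ w ∈ W, d w ∈ W) {i : ℕ} (hi : r + i < p)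
    (h : (f ^ (r + i)) T ∈ W) : (f ^ r) T ∈ W := by
  have h1 := t.add_eq; have h2 := t.ell_pos
  induction i with
  | zero => exact h
  | succ i ih =>
    refine ih (by omega) ?_
    have := hd _ h
    rw [← add_assoc, t.d_x_succ, t.pow_apply_of_le (by omega), smul_zero, zero_add] at this
    exact (W.smul_mem_iff (t.coef_ne_zero (by omega) (by omega) (by omega))).1 this

lemma y_ell_mem_of_x_r_mem {W : Submodule ℂ Y.carrier} (hd : ∀ w ∈ W, d w ∈ W)
    (h : (f ^ r) T ∈ W) : (f ^ ℓ) u ∈ W := by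
  have h1 := t.add_eq; have h2 := t.r_pos
  have := hd _ h
  rw [t.d_x_r] at this
  refine t.y_ell_mem hd (i := p - 1 - ℓ) (by omega) ?_
  rw [show ℓ + (p - 1 - ℓ) = p - 1 by omega]
  exact (W.smul_mem_iff (Q_ne_zero p _)).1 this

lemma x_zero_mem {W : Submodule ℂ Y.carrier} (hf : ∀ w ∈ W, f w ∈ W) (hd : ∀ w ∈ W, d w ∈ W)
    (hy : (f ^ ℓ) u ∈ W) {i : ℕ} (hi : i < r) (h : (f ^ i) T ∈ W) : T ∈ W := by
  have h1 := t.add_eq; have h2 := t.ell_pos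
  induction i with
  | zero => exact h
  | succ i ih =>
    refine ih (by omega) ?_
    have := hd _ h
    rw [t.d_x_succ, W.add_mem_iff_right
      (W.smul_mem _ (pow_mem_of_le hf (show ℓ ≤ i + ℓ by omega) hy))] at this
    exact (W.smul_mem_iff (t.coef_ne_zero (by omega) (by omega) (by omega))).1 this

lemma u_mem {W : Submodule ℂ Y.carrier} (hd : ∀ w ∈ W, d w ∈ W) (h : T ∈ W) : u ∈ W := by
  have h1 := t.ell_pos
  refine t.y_zero_mem hd (i := ℓ - 1) (by omega) ?_
  rw [← t.d_T]; exact hd _ h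

/-- A submodule that contains a homogeneous vector of the charge of `F^i ▸ T` in which `F^i ▸ T`
occurs. -/
lemma mem_of_smul_add_mem {W : Submodule ℂ Y.carrier} (hf : ∀ w ∈ W, f w ∈ W)
    (hd : ∀ w ∈ W, d w ∈ W) {a b : ℂ} {i : ℕ} (hi : i < p) (ha : a ≠ 0)
    (h : a • (f ^ i) T + b • (f ^ (i + ℓ)) u ∈ W) :
    (f ^ ℓ) u ∈ W ∧ (f ^ r) T ∈ W ∧ (i < r → T ∈ W) := by
  have h1 := t.add_eq; have h2 := t.ell_pos
  have hr : (f ^ r) T ∈ W := by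
    -- Applying F^{p−1−i} turns the second term into a power F^{p−1+ℓ} u = 0 and isolates F^{p−1} T.
    have h3 := pow_mem_of_le hf (v := a • (f ^ i) T + b • (f ^ (i + ℓ)) u) (i := 0)
      (j := p - 1 - i) (by omega) (by simpa using h)
    rw [map_add, map_smul, map_smul, end_pow_add_apply, end_pow_add_apply,
      t.pow_apply_of_le (show p ≤ p - 1 - i + (i + ℓ) by omega), smul_zero, add_zero] at h3
    refine t.x_r_mem hd (i := p - 1 - r) (by omega) ?_
    rw [show r + (p - 1 - r) = p - 1 - i + i by omega]
    exact (W.smul_mem_iff ha).1 h3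
  have hy := t.y_ell_mem_of_x_r_mem hd hr
  refine ⟨hy, hr, fun hir => t.x_zero_mem hf hd hy hir ?_⟩
  rw [W.add_mem_iff_left (W.smul_mem _ (pow_mem_of_le hf (show ℓ ≤ i + ℓ by omega) hy))] at h
  exact (W.smul_mem_iff ha).1 h

/-- The charges n + 2ℓ − 2k with 0 ≤ k < p + ℓ are pairwise distinct modulo 4p. Hence the only
coincidences are those of F^i T with F^{i+ℓ} u. -/
lemma homog_components {W : Submodule ℂ Y.carrier} (hW : Graded Y W) {a b : ℕ → ℂ}
    (h : ∑ i ∈ Finset.range p, (a i • (f ^ i) T + b i • (f ^ i) u) ∈ W) :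
    (∀ i < p, a i • (f ^ i) T + b (i + ℓ) • (f ^ (i + ℓ)) u ∈ W) ∧
      ∀ i < ℓ, b i • (f ^ i) u ∈ W := by
  have h1 := t.add_eq; have h2 := t.ell_pos; have h3 := t.r_pos
  constructor
  · intro i hi
    have e := hW ((n - 2 * i : ℤ)) _ h
    rw [map_sum, Finset.sum_congr rfl fun j _ => by
      rw [map_add, map_smul, map_smul], Finset.sum_add_distrib] at e
    rw [Finset.sum_eq_single i] at e
    · rw [t.x_charge] at e
      rcases lt_or_ge (i + ℓ) p with hl | hl
      · rw [Finset.sum_eq_single (i + ℓ)] at e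
        · have := t.y_charge (i + ℓ)
          rw [show (n + 2 * ℓ - 2 * ((i + ℓ : ℕ) : ℤ) : ℤ) = n - 2 * i by push_cast; ring] at this
          rwa [this] at e
        · intro j hj hij
          rw [Finset.mem_range] at hj
          rw [t.proj_of_ne (t.y_charge j) (not_dvd_of_lt (by omega) (by rw [abs_lt]; omega)),
            smul_zero]
        · intro h4; exact absurd (Finset.mem_range.2 hl) h4
      · rw [t.pow_apply_of_le hl, smul_zero]
        rwa [Finset.sum_eq_zero] at e
        intro j hj
        rw [Finset.mem_range] at hj
        rw [t.proj_of_ne (t.y_charge j) (not_dvd_of_lt (by omega) (by rw [abs_lt]; omega)),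
          smul_zero]
    · intro j hj hij
      rw [Finset.mem_range] at hj
      rw [t.proj_of_ne (t.x_charge j) (not_dvd_of_lt (by omega) (by rw [abs_lt]; omega)),
        smul_zero]
    · intro h4; exact absurd (Finset.mem_range.2 hi) h4
  · intro i hi
    have e := hW ((n + 2 * ℓ - 2 * i : ℤ)) _ h
    rw [map_sum, Finset.sum_eq_single i] at e
    · rwa [map_add, map_smul, map_smul, t.y_charge,
        t.proj_of_ne (t.x_charge i) (not_dvd_of_lt (by omega) (by rw [abs_lt]; omega)),
        smul_zero, zero_add] at e
    · intro j hj hij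
      rw [Finset.mem_range] at hj
      rw [map_add, map_smul, map_smul,
        t.proj_of_ne (t.x_charge j) (not_dvd_of_lt (by omega) (by rw [abs_lt]; omega)),
        t.proj_of_ne (t.y_charge j) (not_dvd_of_lt (by omega) (by rw [abs_lt]; omega)),
        smul_zero, smul_zero, add_zero]
    · intro h4; exact absurd (Finset.mem_range.2 (by omega)) h4

/-- The submodules are determined by which of the vectors `F^ℓ ▸ u`, `u`, `F^r ▸ T`, `T` they
contain. -/
theorem le_of_tests (hg : ∀ W, IsSub Y W → T ∈ W → W = ⊤) {W W' : Submodule ℂ Y.carrier}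
    (hW : IsSub Y W) (hf' : ∀ w ∈ W', f w ∈ W') (h1 : (f ^ ℓ) u ∈ W → (f ^ ℓ) u ∈ W')
    (h2 : u ∈ W → u ∈ W') (h3 : (f ^ r) T ∈ W → (f ^ r) T ∈ W') (h4 : T ∈ W → T ∈ W') :
    W ≤ W' := by
  obtain ⟨hgr, hf, hd⟩ := (HasOps.isSub_iff t.ops t.two_le W).1 hW
  have h5 := t.add_eq
  intro w hw
  obtain ⟨a, b, rfl⟩ := t.exists_eq_sum hg w
  obtain ⟨c1, c2⟩ := t.homog_components hgr hw
  have ha : ∀ i < p, a i • (f ^ i) T ∈ W' := by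
    intro i hi
    by_cases ha : a i = 0
    · rw [ha, zero_smul]; exact W'.zero_mem
    · obtain ⟨-, e2, e3⟩ := t.mem_of_smul_add_mem hf hd hi ha (c1 i hi)
      refine W'.smul_mem _ ?_
      rcases lt_or_ge i r with hir | hir
      · exact pow_mem_of_le hf' (Nat.zero_le i) (h4 (e3 hir))
      · exact pow_mem_of_le hf' hir (h3 e2)
  refine W'.sum_mem fun i hi => W'.add_mem (ha i (Finset.mem_range.1 hi)) ?_
  rw [Finset.mem_range] at hi
  by_cases hb : b i = 0
  · rw [hb, zero_smul]; exact W'.zero_mem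
  refine W'.smul_mem _ ?_
  rcases lt_or_ge i ℓ with hil | hil
  · exact pow_mem_of_le hf' (Nat.zero_le i)
      (h2 (t.y_zero_mem hd hil ((W.smul_mem_iff hb).1 (c2 i hil))))
  · obtain ⟨j, rfl⟩ := Nat.exists_eq_add_of_le hil
    refine pow_mem_of_le hf' hil (h1 ?_)
    have e := c1 j (by omega)
    rw [add_comm j ℓ] at e
    -- If F^j T does not occur, the component is a multiple of F^{ℓ+j} u and d brings it down to F^ℓ
    -- u; if it does occur, it already forces F^ℓ u into the submodule.
    by_cases ha : a j = 0
    · rw [ha, zero_smul, zero_add] at e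
      exact t.y_ell_mem hd hi ((W.smul_mem_iff hb).1 e)
    · rw [add_comm ℓ j] at e
      exact (t.mem_of_smul_add_mem hf hd (by omega) ha e).1

/-- Each of the four test vectors generates F^ℓ u. A submodule without F^ℓ u therefore passes none
of the tests and is zero: the bottom piece lies in every nonzero submodule. -/
theorem y_ell_mem_of_ne_bot (hg : ∀ W, IsSub Y W → T ∈ W → W = ⊤) {W : Submodule ℂ Y.carrier}
    (hW : IsSub Y W) (h : W ≠ ⊥) : (f ^ ℓ) u ∈ W := by
  obtain ⟨hgr, hf, hd⟩ := (HasOps.isSub_iff t.ops t.two_le W).1 hW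
  by_contra h0
  refine h (le_bot_iff.1 (t.le_of_tests hg hW (by simp) (fun h => absurd h h0) (fun h1 => ?_)
    (fun h1 => ?_) fun h1 => ?_))
  · exact absurd (pow_mem_of_le hf (Nat.zero_le ℓ) h1) h0
  · exact absurd (t.y_ell_mem_of_x_r_mem hd h1) h0
  · exact absurd (pow_mem_of_le hf (Nat.zero_le ℓ) (t.u_mem hd h1)) h0

end TopPair

/-! ### The diagram of subquotients -/

/-- The vectors `F^{i-m} ▸ V_0` for `m ≤ i`, and `0` for `i < m`. -/
def shiftVec (p k : ℕ) (c : ℤ) (m i : ℕ) : Fin k → ℂ :=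
  if m ≤ i then (oneF p k c ^ (i - m)) (vtx k 0) else 0

lemma shiftVec_of_lt {k : ℕ} {c : ℤ} {m i : ℕ} (h : i < m) : shiftVec p k c m i = 0 :=
  if_neg (by omega)

lemma shiftVec_self {k : ℕ} {c : ℤ} {m : ℕ} : shiftVec p k c m m = vtx k 0 := by
  simp [shiftVec]

lemma shiftVec_of_le {k : ℕ} {c : ℤ} {m i : ℕ} (h : k + m ≤ i) : shiftVec p k c m i = 0 := by
  rw [shiftVec, if_pos (by omega), oneF_pow_vtx_zero, vtx_eq_zero (by omega), smul_zero]

lemma shiftVec_ne_zero (hp : 2 ≤ p) {k : ℕ} (hk : k ≤ p) {c : ℤ} (hc : (p : ℤ) ∣ k - 1 - c)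
    {m i : ℕ} (hmi : m ≤ i) (hi : i < k + m) : shiftVec p k c m i ≠ 0 := by
  rw [shiftVec, if_pos hmi, oneF_pow_vtx_zero]
  exact smul_ne_zero (oneCoef_ne_zero hp hk hc (by omega)) (vtx_ne_zero (by omega))

lemma oneF_shiftVec {k : ℕ} {c : ℤ} {m i : ℕ} (h : m ≤ i) :
    oneF p k c (shiftVec p k c m i) = shiftVec p k c m (i + 1) := by
  rw [shiftVec, if_pos h, shiftVec, if_pos (by omega), end_pow_succ_apply,
    show i + 1 - m = i - m + 1 by omega]

lemma oneProj_vtx_zero [NeZero p] {k : ℕ} {c : ℤ} : oneProj p k c c (vtx k 0) = vtx k 0 := by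
  rw [oneProj_vtx]; simp

lemma oneD_shiftVec [NeZero p] (hp : 2 ≤ p) {k : ℕ} (hk : k ≤ p) {c : ℤ}
    (hc : (p : ℤ) ∣ k - 1 - c) {m i : ℕ} (h : m ≤ i) :
    oneD k (shiftVec p k c m (i + 1)) =
      (qint p (i + 1 - m) * (1 - Q p (i - m - c))) • shiftVec p k c m i := by
  have hops := ops_oneVertex (a := c) hp hk (qint_mul_eq_zero_of_dvd hp hc)
  rw [shiftVec, if_pos (by omega), shiftVec, if_pos h, show i + 1 - m = i - m + 1 by omega]
  have : oneD k ((oneF p k c ^ (i - m + 1)) (vtx k 0)) =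
      Q p ((i - m : ℕ) + 1) • (oneF p k c ^ (i - m + 1)) (oneD k (vtx k 0)) +
        (qint p ((i - m : ℕ) + 1) * (1 - Q p ((i - m : ℕ) - c))) •
          (oneF p k c ^ (i - m)) (vtx k 0) :=
    HasOps.d_f_pow hops hp (n := c) (y := vtx k 0) oneProj_vtx_zero (i - m)
  rw [oneD_vtx_zero, map_zero, smul_zero, zero_add, Nat.cast_sub h] at this
  rw [this, show (i : ℤ) - m + 1 = i + 1 - m by ring]

lemma oneD_shiftVec_self {k : ℕ} {c : ℤ} {m : ℕ} : oneD k (shiftVec p k c m m) = 0 := by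
  rw [shiftVec_self, oneD_vtx_zero]

lemma shiftVec_charge [NeZero p] (hp : 2 ≤ p) {k : ℕ} (hk : k ≤ p) {c : ℤ}
    (hc : (p : ℤ) ∣ k - 1 - c) {e : ℤ} {m : ℕ} (he : ((e - 2 * m : ℤ) : ZMod (4 * p)) = c) {i : ℕ}
    (h : m ≤ i) : oneProj p k c ((e - 2 * i : ℤ)) (shiftVec p k c m i) = shiftVec p k c m i := by
  have hops := ops_oneVertex (a := c) hp hk (qint_mul_eq_zero_of_dvd hp hc)
  rw [shiftVec, if_pos h]
  have := HasOps.f_pow_homog hops (n := c) (y := vtx k 0) oneProj_vtx_zero (i - m)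
  have e1 : ((e - 2 * i : ℤ) : ZMod (4 * p)) = ((c - 2 * ((i - m : ℕ) : ℤ) : ℤ) : ZMod (4 * p)) := by
    rw [Nat.cast_sub h]
    push_cast at he ⊢
    rw [← he]; ring
  rw [e1]
  exact this

/-- In the second case k ≡ −m modulo p, and both sides equal (1 − q^{2(i+1−m)})(1 − q^{2(i+1)})/ξ
with the factors in different order. -/
lemma shift_coef [NeZero p] (hp : 2 ≤ p) {k e m : ℕ} {c : ℤ} (hc : (p : ℤ) ∣ k - 1 - c)
    (h : m = 0 ∧ k = e ∨ m = e ∧ k + e = p) (i : ℕ) :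
    qint p (i + 1 - m) * (1 - Q p (i - m - c)) = qint p (i + 1) * (1 - Q p (i + 1 - e)) := by
  have h1 : Q p (i - m - c) = Q p (i - m + 1 - k) := by
    rw [Q_eq_Q_iff]
    obtain ⟨x, hx⟩ := hc
    exact ⟨x, by linarith⟩
  rw [h1]
  rcases h with ⟨rfl, rfl⟩ | ⟨rfl, h⟩
  · simp
  · have h2 : Q p (i - m + 1 - k) = Q p (i + 1) := by
      rw [Q_eq_Q_iff]
      exact ⟨-1, by rw [← h]; push_cast; ring⟩
    apply mul_left_cancel₀ (xi_ne_zero hp)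
    rw [h2, ← mul_assoc, ← mul_assoc, xi_mul_qint hp, xi_mul_qint hp, mul_comm]

lemma homog_of_comp [NeZero p] {V : Type} [AddCommGroup V] [Module ℂ V]
    {π : ZMod (4 * p) → V →ₗ[ℂ] V} (hcomp : ∀ α β, π α ∘ₗ π β = if α = β then π α else 0)
    {α : ZMod (4 * p)} {v : V} (hv : π α v = v) : Homog π α v := by
  intro β
  have := LinearMap.congr_fun (hcomp β α) v
  rw [LinearMap.comp_apply, hv] at this
  rw [this]
  split_ifs with h
  · rw [h, hv]
  · rfl

namespace TopPair

variable [NeZero p] {Y : YDData p} {f d : Module.End ℂ Y.carrier} {r ℓ : ℕ} {n : ℤ}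
  {T u : Y.carrier} (t : TopPair Y f d r ℓ n T u)
include t

/-- The linear map that takes `F^i ▸ T` to `gx i` and `F^i ▸ u` to `gy i`. -/
def lift (hg : ∀ W, IsSub Y W → T ∈ W → W = ⊤) {V : Type} [AddCommGroup V] [Module ℂ V]
    (gx gy : ℕ → V) : Y.carrier →ₗ[ℂ] V :=
  (t.basis hg).constr ℂ (Sum.elim (fun i => gx i.val) fun i => gy i.val)

lemma lift_x (hg : ∀ W, IsSub Y W → T ∈ W → W = ⊤) {V : Type} [AddCommGroup V] [Module ℂ V]
    {gx gy : ℕ → V} {i : ℕ} (hx : p ≤ i → gx i = 0) : t.lift hg gx gy ((f ^ i) T) = gx i := by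
  rcases lt_or_ge i p with hi | hi
  · have := (t.basis hg).constr_basis ℂ
      (Sum.elim (fun i => gx i.val) fun i => gy i.val) (Sum.inl ⟨i, hi⟩)
    rwa [basis_inl] at this
  · rw [t.pow_apply_of_le hi, map_zero, hx hi]

lemma lift_y (hg : ∀ W, IsSub Y W → T ∈ W → W = ⊤) {V : Type} [AddCommGroup V] [Module ℂ V]
    {gx gy : ℕ → V} {i : ℕ} (hy : p ≤ i → gy i = 0) : t.lift hg gx gy ((f ^ i) u) = gy i := by
  rcases lt_or_ge i p with hi | hi
  · have := (t.basis hg).constr_basis ℂ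
      (Sum.elim (fun i => gx i.val) fun i => gy i.val) (Sum.inr ⟨i, hi⟩)
    rwa [basis_inr] at this
  · rw [t.pow_apply_of_le hi, map_zero, hy hi]

lemma chain_eqOn {A C : ℕ → Prop} {V : Type} [AddCommGroup V] [Module ℂ V]
    {g g' : Y.carrier →ₗ[ℂ] V} (hA : ∀ i < p, A i → g ((f ^ i) T) = g' ((f ^ i) T))
    (hC : ∀ i < p, C i → g ((f ^ i) u) = g' ((f ^ i) u)) : ∀ w ∈ t.chain A C, g w = g' w :=
  t.chain_le (V := LinearMap.eqLocus g g') hA hC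

/-- A linear map preserves charge, action and coaction on a subspace spanned by a part of the two
chains if it does so on the spanning vectors. -/
lemma chain_commutes {A C : ℕ → Prop} {V : Type} [AddCommGroup V] [Module ℂ V]
    {π : ZMod (4 * p) → V →ₗ[ℂ] V} {f' d' : Module.End ℂ V}
    (hcomp : ∀ α β, π α ∘ₗ π β = if α = β then π α else 0) {G : Y.carrier →ₗ[ℂ] V}
    (hπx : ∀ i < p, A i → π ((n - 2 * i : ℤ)) (G ((f ^ i) T)) = G ((f ^ i) T))
    (hπy : ∀ i < p, C i → π ((n + 2 * ℓ - 2 * i : ℤ)) (G ((f ^ i) u)) = G ((f ^ i) u))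
    (hfx : ∀ i < p, A i → G ((f ^ (i + 1)) T) = f' (G ((f ^ i) T)))
    (hfy : ∀ i < p, C i → G ((f ^ (i + 1)) u) = f' (G ((f ^ i) u)))
    (hdx : ∀ i < p, A i → G (d ((f ^ i) T)) = d' (G ((f ^ i) T)))
    (hdy : ∀ i < p, C i → G (d ((f ^ i) u)) = d' (G ((f ^ i) u))) :
    (∀ α, ∀ w ∈ t.chain A C, G (Y.proj α w) = π α (G w)) ∧
      (∀ w ∈ t.chain A C, G (f w) = f' (G w)) ∧ ∀ w ∈ t.chain A C, G (d w) = d' (G w) := by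
  refine ⟨fun α => t.chain_eqOn (g := G ∘ₗ Y.proj α) (g' := π α ∘ₗ G) (fun i hi h => ?_)
      (fun i hi h => ?_), t.chain_eqOn (g := G ∘ₗ f) (g' := f' ∘ₗ G) (fun i hi h => ?_)
      (fun i hi h => ?_), t.chain_eqOn (g := G ∘ₗ d) (g' := d' ∘ₗ G) hdx hdy⟩
  · rw [LinearMap.comp_apply, LinearMap.comp_apply,
      HasOps.homog_of_proj t.ops (t.x_charge i) α, homog_of_comp hcomp (hπx i hi h) α]
    split_ifs
    · rfl
    · exact map_zero _
  · rw [LinearMap.comp_apply, LinearMap.comp_apply,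
      HasOps.homog_of_proj t.ops (t.y_charge i) α, homog_of_comp hcomp (hπy i hi h) α]
    split_ifs
    · rfl
    · exact map_zero _
  · rw [LinearMap.comp_apply, LinearMap.comp_apply, end_pow_succ_apply]; exact hfx i hi h
  · rw [LinearMap.comp_apply, LinearMap.comp_apply, end_pow_succ_apply]; exact hfy i hi h

/-- The kernel of a morphism from a submodule is a submodule. -/
lemma isSub_ker {W : Submodule ℂ Y.carrier} (hW : IsSub Y W) {V : Type} [AddCommGroup V]
    [Module ℂ V] {π : ZMod (4 * p) → V →ₗ[ℂ] V} {f' d' : Module.End ℂ V} {G : Y.carrier →ₗ[ℂ] V}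
    (hG : (∀ α, ∀ w ∈ W, G (Y.proj α w) = π α (G w)) ∧
      (∀ w ∈ W, G (f w) = f' (G w)) ∧ ∀ w ∈ W, G (d w) = d' (G w)) :
    IsSub Y (W ⊓ LinearMap.ker G) := by
  obtain ⟨h1, h2, h3⟩ := (HasOps.isSub_iff t.ops t.two_le W).1 hW
  obtain ⟨hπ, hf, hd⟩ := hG
  refine (HasOps.isSub_iff t.ops t.two_le _).2 ⟨?_, ?_, ?_⟩
  · rintro α w ⟨hw, hk⟩
    exact ⟨h1 α w hw, LinearMap.mem_ker.2 (by rw [hπ α w hw, LinearMap.mem_ker.1 hk, map_zero])⟩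
  · rintro w ⟨hw, hk⟩
    exact ⟨h2 w hw, LinearMap.mem_ker.2 (by rw [hf w hw, LinearMap.mem_ker.1 hk, map_zero])⟩
  · rintro w ⟨hw, hk⟩
    exact ⟨h3 w hw, LinearMap.mem_ker.2 (by rw [hd w hw, LinearMap.mem_ker.1 hk, map_zero])⟩

/-- The kernel of `G` on the larger chain is a submodule, so its equality with the smaller chain
reduces to the four membership tests `h1`–`h4`. Surjectivity holds because the image contains V_0,
which generates. -/
theorem subquotientIso_chain (hg : ∀ W, IsSub Y W → T ∈ W → W = ⊤) {A C A' C' : ℕ → Prop}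
    (hW : IsSub Y (t.chain A C)) (hK : IsSub Y (t.chain A' C')) {k : ℕ} (hk : k ≤ p) {c : ℤ}
    (hc : (p : ℤ) ∣ k - 1 - c) {G : Y.carrier →ₗ[ℂ] (Fin k → ℂ)}
    (hG : (∀ α, ∀ w ∈ t.chain A C, G (Y.proj α w) = oneProj p k c α (G w)) ∧
      (∀ w ∈ t.chain A C, G (f w) = oneF p k c (G w)) ∧
      ∀ w ∈ t.chain A C, G (d w) = oneD k (G w))
    (hsurj : ∃ w ∈ t.chain A C, G w = vtx k 0)
    (h1 : C' ℓ ↔ C ℓ ∧ G ((f ^ ℓ) u) = 0) (h2 : C' 0 ↔ C 0 ∧ G u = 0)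
    (h3 : A' r ↔ A r ∧ G ((f ^ r) T) = 0) (h4 : A' 0 ↔ A 0 ∧ G T = 0) :
    SubquotientIso Y (t.chain A' C') (t.chain A C) hW (oneVertex p k c) := by
  have hp := t.two_le
  have e1 := t.add_eq; have e2 := t.r_pos; have e3 := t.ell_pos
  have hops := ops_oneVertex (a := c) hp hk (qint_mul_eq_zero_of_dvd hp hc)
  obtain ⟨w1, w2, w3⟩ := (HasOps.isSub_iff t.ops hp _).1 hW
  obtain ⟨k1, k2, k3⟩ := (HasOps.isSub_iff t.ops hp _).1 hK
  have hker := t.isSub_ker hW hG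
  obtain ⟨-, k2', -⟩ := (HasOps.isSub_iff t.ops hp _).1 hker
  have x0 : ∀ A C : ℕ → Prop, T ∈ t.chain A C ↔ A 0 := fun A C =>
    t.x_mem_chain_iff (i := 0) (by omega)
  have y0 : ∀ A C : ℕ → Prop, u ∈ t.chain A C ↔ C 0 := fun A C =>
    t.y_mem_chain_iff (i := 0) (by omega)
  have xr : ∀ A C : ℕ → Prop, (f ^ r) T ∈ t.chain A C ↔ A r := fun A C =>
    t.x_mem_chain_iff (by omega)
  have yl : ∀ A C : ℕ → Prop, (f ^ ℓ) u ∈ t.chain A C ↔ C ℓ := fun A C =>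
    t.y_mem_chain_iff (by omega)
  have hKer : t.chain A C ⊓ LinearMap.ker G = t.chain A' C' := by
    refine le_antisymm (t.le_of_tests hg hker k2 ?_ ?_ ?_ ?_)
      (t.le_of_tests hg hK k2' ?_ ?_ ?_ ?_) <;>
      simp only [Submodule.mem_inf, LinearMap.mem_ker, x0, y0, xr, yl, h1, h2, h3, h4, imp_self]
  refine ⟨G ∘ₗ (t.chain A C).subtype, isHom_of_ops (HasOps.sub t.ops hp hW w2 w3) hops hp
    (fun α ⟨w, hw⟩ => hG.1 α w hw) (fun ⟨w, hw⟩ => hG.2.1 w hw) (fun ⟨w, hw⟩ => hG.2.2 w hw),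
    ?_, ?_⟩
  · have htop : (t.chain A C).map G = ⊤ := by
      obtain ⟨w, hw, hGw⟩ := hsurj
      refine eq_top_of_vtx_zero_mem hp hk hc ?_ ⟨w, hw, hGw⟩
      rintro _ ⟨v, hv, rfl⟩
      exact ⟨f v, w2 v hv, hG.2.1 v hv⟩
    intro z
    have hz : z ∈ (t.chain A C).map G := by rw [htop]; trivial
    obtain ⟨w, hw, rfl⟩ := hz
    exact ⟨⟨w, hw⟩, rfl⟩
  · have e : (LinearMap.ker (G ∘ₗ (t.chain A C).subtype)).map (t.chain A C).subtype =
        t.chain A' C' := by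
      rw [LinearMap.ker_comp, Submodule.map_comap_subtype, hKer]
    exact e

/-- The subquotients formed from the chain of `u`. -/
theorem subquotientIso_y (hg : ∀ W, IsSub Y W → T ∈ W → W = ⊤) {C C' : ℕ → Prop}
    (hW : IsSub Y (t.chain (fun _ => False) C)) (hK : IsSub Y (t.chain (fun _ => False) C'))
    {k m : ℕ} {c : ℤ} (hc : (p : ℤ) ∣ k - 1 - c) (hkm : m = 0 ∧ k = ℓ ∨ m = ℓ ∧ k = r)
    (he : ((n + 2 * ℓ - 2 * m : ℤ) : ZMod (4 * p)) = c) (hC : ∀ i, C i ↔ m ≤ i)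
    (hC' : ∀ i < p, C' i ↔ k + m ≤ i) :
    SubquotientIso Y (t.chain (fun _ => False) C') (t.chain (fun _ => False) C) hW
      (oneVertex p k c) := by
  have hp := t.two_le
  have e1 := t.add_eq; have e2 := t.r_pos; have e3 := t.ell_pos
  have hk : k ≤ p := by omega
  have hops := ops_oneVertex (a := c) hp hk (qint_mul_eq_zero_of_dvd hp hc)
  -- The map sends F^m u to V_0 and follows the action of F; it is set to zero below index m and is
  -- used only on the part of the chain from m on.
  let G : Y.carrier →ₗ[ℂ] (Fin k → ℂ) := t.lift hg (fun _ => 0) (shiftVec p k c m)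
  have hy : ∀ i, G ((f ^ i) u) = shiftVec p k c m i := fun i =>
    t.lift_y hg fun h => shiftVec_of_le (by omega)
  have hx : ∀ i, G ((f ^ i) T) = 0 := fun i => t.lift_x hg fun _ => rfl
  have hz : ∀ i < p, C i → (shiftVec p k c m i = 0 ↔ C' i) := by
    intro i hi h
    rw [hC'  i hi]
    refine ⟨fun h0 => ?_, fun h0 => shiftVec_of_le h0⟩
    by_contra h1
    exact shiftVec_ne_zero hp hk hc ((hC i).1 h) (by omega) h0
  refine t.subquotientIso_chain hg hW hK hk hc (G := G) ?_ ⟨(f ^ m) u, t.y_mem fun _ => (hC m).2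
    le_rfl, by rw [hy, shiftVec_self]⟩ ?_ ?_ (by simp) (by simp)
  · refine t.chain_commutes (π := oneProj p k c) hops.proj_comp (fun i hi h => h.elim) ?_ (fun i hi h => h.elim) ?_
      (fun i hi h => h.elim) ?_
    · intro i _ h
      rw [hy]
      exact shiftVec_charge hp hk hc he ((hC i).1 h)
    · intro i _ h
      rw [hy, hy]
      exact (oneF_shiftVec ((hC i).1 h)).symm
    · intro i _ h
      rw [hy]
      have hmi := (hC i).1 h
      rcases Nat.eq_or_lt_of_le hmi with rfl | hlt
      · rw [oneD_shiftVec_self]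
        cases m with
        | zero => rw [pow_zero, Module.End.one_apply, t.d_u, map_zero]
        | succ j => rw [t.d_y_succ, map_smul, hy, shiftVec_of_lt (by omega), smul_zero]
      · obtain ⟨j, rfl⟩ : ∃ j, i = j + 1 := ⟨i - 1, by omega⟩
        rw [t.d_y_succ, map_smul, hy, oneD_shiftVec hp hk hc (by omega),
          shift_coef hp (e := ℓ) hc (by omega)]
  · rw [hy]
    have := hz ℓ (by omega) ((hC ℓ).2 (by omega))
    rw [this, iff_and_self]
    exact fun _ => (hC ℓ).2 (by omega)
  · have h0 : G u = shiftVec p k c m 0 := hy 0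
    rw [h0, hC' 0 (by omega)]
    constructor
    · intro h; omega
    · rintro ⟨h1, h2⟩
      rw [← hC' 0 (by omega)]
      exact (hz 0 (by omega) h1).1 h2

/-- The subquotients formed from the chain of `T`. -/
theorem subquotientIso_x (hg : ∀ W, IsSub Y W → T ∈ W → W = ⊤) {A C A' : ℕ → Prop}
    (hW : IsSub Y (t.chain A C)) (hK : IsSub Y (t.chain A' C))
    {k m : ℕ} {c : ℤ} (hc : (p : ℤ) ∣ k - 1 - c) (hkm : m = 0 ∧ k = r ∨ m = r ∧ k = ℓ)
    (he : ((n - 2 * m : ℤ) : ZMod (4 * p)) = c) (hA : ∀ i, A i ↔ m ≤ i)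
    (hA' : ∀ i < p, A' i ↔ k + m ≤ i) :
    SubquotientIso Y (t.chain A' C) (t.chain A C) hW (oneVertex p k c) := by
  have hp := t.two_le
  have e1 := t.add_eq; have e2 := t.r_pos; have e3 := t.ell_pos
  have hk : k ≤ p := by omega
  have hops := ops_oneVertex (a := c) hp hk (qint_mul_eq_zero_of_dvd hp hc)
  -- Killing the chain of u removes the linking terms in d F^i T, so that the part of the chain of T
  -- from index m on looks like a one-vertex module.
  let G : Y.carrier →ₗ[ℂ] (Fin k → ℂ) := t.lift hg (shiftVec p k c m) (fun _ => 0)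
  have hx : ∀ i, G ((f ^ i) T) = shiftVec p k c m i := fun i =>
    t.lift_x hg fun h => shiftVec_of_le (by omega)
  have hy : ∀ i, G ((f ^ i) u) = 0 := fun i => t.lift_y hg fun _ => rfl
  have hz : ∀ i < p, A i → (shiftVec p k c m i = 0 ↔ A' i) := by
    intro i hi h
    rw [hA' i hi]
    refine ⟨fun h0 => ?_, fun h0 => shiftVec_of_le h0⟩
    by_contra h1
    exact shiftVec_ne_zero hp hk hc ((hA i).1 h) (by omega) h0
  refine t.subquotientIso_chain hg hW hK hk hc (G := G) ?_ ⟨(f ^ m) T, t.x_mem fun _ => (hA m).2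
    le_rfl, by rw [hx, shiftVec_self]⟩ ?_ ?_ ?_ ?_
  · refine t.chain_commutes (π := oneProj p k c) hops.proj_comp ?_ ?_ ?_ ?_ ?_ ?_
    · intro i _ h
      rw [hx]
      exact shiftVec_charge hp hk hc he ((hA i).1 h)
    · intro i _ h
      rw [hy, map_zero]
    · intro i _ h
      rw [hx, hx]
      exact (oneF_shiftVec ((hA i).1 h)).symm
    · intro i _ h
      rw [hy, hy, map_zero]
    · intro i _ h
      rw [hx]
      have hmi := (hA i).1 h
      rcases Nat.eq_or_lt_of_le hmi with rfl | hlt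
      · rw [oneD_shiftVec_self]
        cases m with
        | zero => rw [pow_zero, Module.End.one_apply, t.d_T, hy]
        | succ j =>
          rw [t.d_x_succ, map_add, map_smul, map_smul, hx, hy, shiftVec_of_lt (by omega),
            smul_zero, smul_zero, add_zero]
      · obtain ⟨j, rfl⟩ : ∃ j, i = j + 1 := ⟨i - 1, by omega⟩
        rw [t.d_x_succ, map_add, map_smul, map_smul, hx, hy, smul_zero, zero_add,
          oneD_shiftVec hp hk hc (by omega), shift_coef hp (e := r) hc (by omega)]
    · intro i _ h
      rw [hy, map_zero]
      cases i with
      | zero => rw [pow_zero, Module.End.one_apply, t.d_u, map_zero]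
      | succ j => rw [t.d_y_succ, map_smul, hy, smul_zero]
  · rw [hy]; simp
  · have h0 : G u = 0 := hy 0
    simp [h0]
  · rw [hx]
    have := hz r (by omega) ((hA r).2 (by omega))
    rw [this, iff_and_self]
    exact fun _ => (hA r).2 (by omega)
  · have h0 : G T = shiftVec p k c m 0 := hx 0
    rw [h0, hA' 0 (by omega)]
    constructor
    · intro h; omega
    · rintro ⟨h1, h2⟩
      rw [← hA' 0 (by omega)]
      exact (hz 0 (by omega) h1).1 h2

end TopPair

/-- A homogeneous vector of `C + W` lies in the graded subspace `C`, if the component of its charge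
of `W` does. -/
lemma mem_of_mem_sup_of_proj_mem [NeZero p] {Y : YDData p} {C W : Submodule ℂ Y.carrier}
    (hC : Graded Y C) {α : ZMod (4 * p)} {z : Y.carrier} (hz : Y.proj α z = z)
    (hW : ∀ w ∈ W, Y.proj α w ∈ C) (h : z ∈ C ⊔ W) : z ∈ C := by
  obtain ⟨c, hc, w, hw, rfl⟩ := Submodule.mem_sup.1 h
  rw [← hz, map_add]
  exact C.add_mem (hC α c hc) (hW w hw)

/-! ### Indecomposability, the four extensions, the diagram, and morphisms -/

namespace TopPair

variable [NeZero p] {Y : YDData p} {f d : Module.End ℂ Y.carrier} {r ℓ : ℕ} {n : ℤ}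
  {T u : Y.carrier} (t : TopPair Y f d r ℓ n T u)
include t

lemma proj_chain_mem {A C : ℕ → Prop} {V : Submodule ℂ Y.carrier} {a : ℤ}
    (hA : ∀ i < p, A i → ((4 * p : ℕ) : ℤ) ∣ a - (n - 2 * i) → (f ^ i) T ∈ V)
    (hC : ∀ i < p, C i → ((4 * p : ℕ) : ℤ) ∣ a - (n + 2 * ℓ - 2 * i) → (f ^ i) u ∈ V) :
    ∀ w ∈ t.chain A C, Y.proj a w ∈ V := by
  refine t.chain_le (V := V.comap (Y.proj a)) (fun i hi h => ?_) fun i hi h => ?_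
  · rw [Submodule.mem_comap]
    by_cases h1 : ((4 * p : ℕ) : ℤ) ∣ a - (n - 2 * i)
    · rw [HasOps.homog_of_proj t.ops (t.x_charge i)]
      split_ifs
      · exact hA i hi h h1
      · exact V.zero_mem
    · rw [t.proj_of_ne (t.x_charge i) h1]; exact V.zero_mem
  · rw [Submodule.mem_comap]
    by_cases h1 : ((4 * p : ℕ) : ℤ) ∣ a - (n + 2 * ℓ - 2 * i)
    · rw [HasOps.homog_of_proj t.ops (t.y_charge i)]
      split_ifs
      · exact hC i hi h h1
      · exact V.zero_mem
    · rw [t.proj_of_ne (t.y_charge i) h1]; exact V.zero_mem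

/-- Any two nonzero submodules share the nonzero vector F^ℓ u. -/
theorem isIndecomposable (hg : ∀ W, IsSub Y W → T ∈ W → W = ⊤) : IsIndecomposableYD Y := by
  have e1 := t.add_eq; have e2 := t.r_pos; have e3 := t.ell_pos
  refine ⟨⟨⟨_, 0, t.f_u⟩⟩, fun W W' hW hW' hinf _ => ?_⟩
  by_contra! h
  refine t.f_u ((Submodule.mem_bot ℂ).1 ?_)
  rw [← hinf]
  exact ⟨t.y_ell_mem_of_ne_bot hg hW h.1, t.y_ell_mem_of_ne_bot hg hW' h.2⟩

/-- The span of u, …, F^{ℓ−1} u is a comodule complement. A graded complement must contain u, whose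
charge does not occur in the bottom piece, and if stable under F it would contain the bottom vector
F^ℓ u. -/
lemma actArrow_left (hg : ∀ W, IsSub Y W → T ∈ W → W = ⊤) :
    ActArrow Y ⊥ (t.chain (fun _ => False) (ℓ ≤ ·)) (t.chain (fun _ => False) fun _ => True) := by
  have e1 := t.add_eq; have e2 := t.r_pos; have e3 := t.ell_pos
  constructor
  · refine ⟨t.chain (fun _ => False) (· < ℓ), t.chain_graded _ _, (HasOps.coactStable_iff t.ops
      t.two_le _).2 (t.chain_d (by simp) (by simp) (fun i h _ => by omega)), ?_, ?_⟩
    · rw [t.chain_inf hg]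
      exact t.chain_eq_bot (by simp) (fun i h => by omega)
    · rw [t.chain_sup]
      exact t.chain_congr (by simp) (fun i _ => by simp [lt_or_ge])
  · rintro ⟨C, hgr, hact, hinf, hsup⟩
    have hu : u ∈ C := by
      refine mem_of_mem_sup_of_proj_mem hgr t.u_charge (t.proj_chain_mem (fun i _ h => h.elim)
        fun i hi h h1 => ?_) (hsup ▸ t.y_mem (i := 0) fun _ => trivial)
      exact absurd h1 (not_dvd_of_lt (by omega) (by rw [abs_lt]; omega))
    have : (f ^ ℓ) u ∈ C ⊓ t.chain (fun _ => False) (ℓ ≤ ·) :=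
      ⟨pow_mem_of_le ((HasOps.actStable_iff t.ops t.two_le _).1 hact) (i := 0) (Nat.zero_le ℓ) hu,
        t.y_mem fun _ => le_rfl⟩
    rw [hinf] at this
    exact t.f_u ((Submodule.mem_bot ℂ).1 this)

/-- The span of the F^i T with i ≥ r is a module complement. A graded complement must contain F^r T,
whose charge is absent from the bottom, and d takes F^r T to a nonzero multiple of F^{p−1} u. -/
lemma coactArrow_right (hg : ∀ W, IsSub Y W → T ∈ W → W = ⊤) :
    CoactArrow Y ⊥ (t.chain (fun _ => False) (ℓ ≤ ·)) (t.chain (r ≤ ·) (ℓ ≤ ·)) := by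
  have e1 := t.add_eq; have e2 := t.r_pos; have e3 := t.ell_pos
  constructor
  · refine ⟨t.chain (r ≤ ·) (fun _ => False), t.chain_graded _ _, (HasOps.actStable_iff t.ops
      t.two_le _).2 (t.chain_f (fun i h => by omega) (by simp)), ?_, ?_⟩
    · rw [t.chain_inf hg]
      exact t.chain_eq_bot (by simp) (by simp)
    · rw [t.chain_sup]
      exact t.chain_congr (by simp) (by simp)
  · rintro ⟨C, hgr, hcoact, hinf, hsup⟩
    have hx : (f ^ r) T ∈ C := by
      refine mem_of_mem_sup_of_proj_mem hgr (t.x_charge r) (t.proj_chain_mem (fun i _ h => h.elim)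
        fun i hi h h1 => ?_) (hsup ▸ t.x_mem fun _ => le_rfl)
      exact absurd h1 (not_dvd_of_lt (by omega) (by rw [abs_lt]; omega))
    have : d ((f ^ r) T) ∈ C ⊓ t.chain (fun _ => False) (ℓ ≤ ·) := by
      refine ⟨(HasOps.coactStable_iff t.ops t.two_le _).1 hcoact _ hx, ?_⟩
      rw [t.d_x_r]
      exact Submodule.smul_mem _ _ (t.y_mem fun _ => by omega)
    rw [hinf, Submodule.mem_bot, t.d_x_r, smul_eq_zero] at this
    exact this.elim (Q_ne_zero p _) (t.y_ne_zero (by omega))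

/-- The only other vector with the charge of T is F^ℓ u, which lies in the left submodule. Hence a
complement contains T itself, and stability under F would put F^r T into the left submodule. -/
lemma actArrow_right (hg : ∀ W, IsSub Y W → T ∈ W → W = ⊤) :
    ActArrow Y (t.chain (fun _ => False) fun _ => True) (t.chain (r ≤ ·) fun _ => True) ⊤ := by
  have e1 := t.add_eq; have e2 := t.r_pos; have e3 := t.ell_pos
  constructor
  · refine ⟨t.chain (· < r) (fun _ => True), t.chain_graded _ _, (HasOps.coactStable_iff t.ops
      t.two_le _).2 (t.chain_d (by simp) (fun i h => ⟨by simp, fun _ => by omega⟩) (by simp)),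
      ?_, ?_⟩
    · rw [t.chain_inf hg]
      exact t.chain_congr (fun i _ => by simp) (by simp)
    · rw [t.chain_sup]
      exact t.chain_eq_top hg (fun i _ => lt_or_ge i r) (by simp)
  · rintro ⟨C, hgr, hact, hinf, hsup⟩
    have hlC : t.chain (fun _ => False) (fun _ => True) ≤ C := hinf ▸ inf_le_left
    have hT : T ∈ C := by
      refine mem_of_mem_sup_of_proj_mem hgr t.T_charge (t.proj_chain_mem (fun i hi h h1 => ?_)
        fun i hi h h1 => hlC (t.y_mem fun _ => trivial)) (hsup ▸ Submodule.mem_top)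
      exact absurd h1 (not_dvd_of_lt (by omega) (by rw [abs_lt]; omega))
    have : (f ^ r) T ∈ C ⊓ t.chain (r ≤ ·) fun _ => True :=
      ⟨pow_mem_of_le ((HasOps.actStable_iff t.ops t.two_le _).1 hact) (i := 0) (Nat.zero_le r) hT,
        t.x_mem fun _ => le_rfl⟩
    rw [hinf, t.x_mem_chain_iff (by omega)] at this
    exact this

/-- As before a complement contains T, since F^ℓ u already lies in the right submodule. Then d T =
F^{ℓ−1} u would have to lie there too, but the chain of u enters it only from index ℓ on. -/
lemma coactArrow_left (hg : ∀ W, IsSub Y W → T ∈ W → W = ⊤) :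
    CoactArrow Y (t.chain (r ≤ ·) (ℓ ≤ ·)) (t.chain (r ≤ ·) fun _ => True) ⊤ := by
  have e1 := t.add_eq; have e2 := t.r_pos; have e3 := t.ell_pos
  constructor
  · refine ⟨t.chain (fun _ => True) (ℓ ≤ ·), t.chain_graded _ _, (HasOps.actStable_iff t.ops
      t.two_le _).2 (t.chain_f (by simp) (fun i h => by omega)), ?_, ?_⟩
    · rw [t.chain_inf hg]
      exact t.chain_congr (by simp) (by simp)
    · rw [t.chain_sup]
      exact t.chain_eq_top hg (by simp) (by simp)
  · rintro ⟨C, hgr, hcoact, hinf, hsup⟩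
    have hrC : t.chain (r ≤ ·) (ℓ ≤ ·) ≤ C := hinf ▸ inf_le_left
    have hT : T ∈ C := by
      refine mem_of_mem_sup_of_proj_mem hgr t.T_charge (t.proj_chain_mem (fun i hi h h1 => ?_)
        fun i hi h h1 => ?_) (hsup ▸ Submodule.mem_top)
      · exact hrC (t.x_mem fun _ => h)
      · refine hrC (t.y_mem fun _ => ?_)
        by_contra h2
        exact not_dvd_of_lt (by omega) (by rw [abs_lt]; omega) h1
    have : d T ∈ C ⊓ t.chain (r ≤ ·) fun _ => True := by
      refine ⟨(HasOps.coactStable_iff t.ops t.two_le _).1 hcoact _ hT, ?_⟩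
      rw [t.d_T]
      exact t.y_mem fun _ => trivial
    rw [hinf, t.d_T, t.y_mem_chain_iff (by omega)] at this
    omega

/-- The pieces are chains: the bottom consists of the F^i u with i ≥ ℓ, the left submodule of all
F^i u, and the right submodule is the bottom together with the F^i T, i ≥ r. The three congruences
of charges identify the subquotients by the charges of their highest vectors. -/
theorem hasDiamond (hg : ∀ W, IsSub Y W → T ∈ W → W = ⊤) {cT cL cR : ℤ}
    (hT : ((n : ℤ) : ZMod (4 * p)) = cT) (hL : ((n + 2 * ℓ : ℤ) : ZMod (4 * p)) = cL)
    (hR : ((n - 2 * r : ℤ) : ZMod (4 * p)) = cR) (dT : (p : ℤ) ∣ r - 1 - cT)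
    (dL : (p : ℤ) ∣ ℓ - 1 - cL) (dR : (p : ℤ) ∣ ℓ - 1 - cR) :
    HasDiamond Y (oneVertex p r cT) (oneVertex p ℓ cL) (oneVertex p ℓ cR) := by
  have e1 := t.add_eq; have e2 := t.r_pos; have e3 := t.ell_pos
  have h0 : IsSub Y (t.chain (fun _ => False) fun _ => False) :=
    t.isSub_chain (by simp) (by simp) (by simp) (by simp) (by simp)
  have hb : IsSub Y (t.chain (fun _ => False) (ℓ ≤ ·)) :=
    t.isSub_chain (by simp) (fun i h => by omega) (by simp) (by simp) (fun i h h' => by omega)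
  have hl : IsSub Y (t.chain (fun _ => False) (fun _ => True)) :=
    t.isSub_chain (by simp) (by simp) (by simp) (by simp) (by simp)
  have hr : IsSub Y (t.chain (r ≤ ·) (ℓ ≤ ·)) :=
    t.isSub_chain (fun i h => by omega) (fun i h => by omega) (fun h => by omega)
      (fun i h => ⟨fun h => by omega, fun h => by omega⟩) (fun i h h' => by omega)
  have hlr : IsSub Y (t.chain (r ≤ ·) (fun _ => True)) :=
    t.isSub_chain (fun i h => by omega) (by simp) (by simp)
      (fun i h => ⟨by simp, fun h => by omega⟩) (by simp)
  have htop' : IsSub Y (t.chain (fun _ => True) (fun _ => True)) :=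
    t.isSub_chain (by simp) (by simp) (by simp) (by simp) (by simp)
  have etop : t.chain (fun _ => True) (fun _ => True) = ⊤ := t.chain_eq_top hg (by simp) (by simp)
  have ebot : t.chain (fun _ => False) (fun _ => False) = ⊥ := t.chain_eq_bot (by simp) (by simp)
  have htop : IsSub Y ⊤ := etop ▸ htop'
  have esup : t.chain (fun _ => False) (fun _ => True) ⊔ t.chain (r ≤ ·) (ℓ ≤ ·) =
      t.chain (r ≤ ·) (fun _ => True) := by
    rw [t.chain_sup]; exact t.chain_congr (by simp) (by simp)
  refine ⟨t.chain (fun _ => False) (ℓ ≤ ·), t.chain (fun _ => False) fun _ => True,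
    t.chain (r ≤ ·) (ℓ ≤ ·), hb, hl, hr, htop, ?_, ?_, ?_, ?_, ?_, ?_, t.actArrow_left hg,
    t.coactArrow_right hg, esup ▸ t.actArrow_right hg, esup ▸ t.coactArrow_left hg⟩
  · rw [t.chain_inf hg]; exact t.chain_congr (by simp) (by simp)
  · have := t.subquotientIso_y hg hb h0 (k := r) (m := ℓ) dT (by omega) (by rw [← hT]; ring_nf)
      (fun i => Iff.rfl) (fun i hi => by simp only [false_iff]; omega)
    rwa [ebot] at this
  · exact t.subquotientIso_y hg hl hb (k := ℓ) (m := 0) dL (by omega) (by rw [← hL]; simp)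
      (by simp) (fun i hi => by simp)
  · exact t.subquotientIso_x hg hr (A' := fun _ => False) hb (k := ℓ) (m := r) dR (by omega)
      (by rw [← hR]) (fun i => Iff.rfl) (fun i hi => by simp only [false_iff]; omega)
  · rw [esup]
    have := t.subquotientIso_x hg htop' (A' := (r ≤ ·)) hlr (k := r) (m := 0) dT (by omega)
      (by rw [← hT]; simp) (by simp) (fun i hi => by simp)
    simp only [etop] at this
    exact this
  · intro W hW
    rw [esup]
    obtain ⟨hgr, hf, hd⟩ := (HasOps.isSub_iff t.ops t.two_le W).1 hW
    have x0 : ∀ A C : ℕ → Prop, T ∈ t.chain A C ↔ A 0 := fun A C =>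
      t.x_mem_chain_iff (i := 0) (by omega)
    have y0 : ∀ A C : ℕ → Prop, u ∈ t.chain A C ↔ C 0 := fun A C =>
      t.y_mem_chain_iff (i := 0) (by omega)
    have xr : ∀ A C : ℕ → Prop, (f ^ r) T ∈ t.chain A C ↔ A r := fun A C =>
      t.x_mem_chain_iff (by omega)
    have yl : ∀ A C : ℕ → Prop, (f ^ ℓ) u ∈ t.chain A C ↔ C ℓ := fun A C =>
      t.y_mem_chain_iff (by omega)
    have key : ∀ (A C : ℕ → Prop), IsSub Y (t.chain A C) → ((f ^ ℓ) u ∈ W ↔ C ℓ) →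
        (u ∈ W ↔ C 0) → ((f ^ r) T ∈ W ↔ A r) → (T ∈ W ↔ A 0) → W = t.chain A C := by
      intro A C hAC h1 h2 h3 h4
      refine le_antisymm (t.le_of_tests hg hW ((HasOps.isSub_iff t.ops t.two_le _).1 hAC).2.1
        ?_ ?_ ?_ ?_) (t.le_of_tests hg hAC hf ?_ ?_ ?_ ?_) <;>
        simp only [x0, y0, xr, yl, h1, h2, h3, h4, imp_self]
    -- The implications between the tests leave few patterns: T forces everything, and both F^r T
    -- and u force F^ℓ u, as does W ≠ 0.
    by_cases hT : T ∈ W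
    · exact Or.inr (Or.inr (Or.inr (Or.inr (Or.inr (hg W hW hT)))))
    by_cases hx : (f ^ r) T ∈ W
    · have hy := t.y_ell_mem_of_x_r_mem hd hx
      by_cases hu : u ∈ W
      · refine Or.inr (Or.inr (Or.inr (Or.inr (Or.inl (key _ _ hlr ?_ ?_ ?_ ?_))))) <;>
          simp [*] <;> omega
      · refine Or.inr (Or.inr (Or.inr (Or.inl (key _ _ hr ?_ ?_ ?_ ?_)))) <;>
          simp [*] <;> omega
    · by_cases hu : u ∈ W
      · have hy : (f ^ ℓ) u ∈ W := pow_mem_of_le hf (i := 0) (Nat.zero_le ℓ) hu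
        refine Or.inr (Or.inr (Or.inl (key _ _ hl ?_ ?_ ?_ ?_))) <;> simp [*]
      · by_cases hW0 : W = ⊥
        · exact Or.inl hW0
        have hy := t.y_ell_mem_of_ne_bot hg hW hW0
        refine Or.inr (Or.inl (key _ _ hb ?_ ?_ ?_ ?_)) <;> simp [*] <;> omega

/-- The morphism from a module generated by `T` to another module with such a pair. -/
theorem exists_isHom (hg : ∀ W, IsSub Y W → T ∈ W → W = ⊤) {Z : YDData p}
    {f' d' : Module.End ℂ Z.carrier} {T' u' : Z.carrier} (t' : TopPair Z f' d' r ℓ n T' u') :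
    ∃ φ : Y.carrier →ₗ[ℂ] Z.carrier, IsHom (Y := Y) (Z := Z) φ ∧ Function.Injective φ := by
  have e1 := t.add_eq; have e2 := t.r_pos; have e3 := t.ell_pos
  let φ := t.lift hg (fun i => (f' ^ i) T') (fun i => (f' ^ i) u')
  have hx : ∀ i, φ ((f ^ i) T) = (f' ^ i) T' := fun i =>
    t.lift_x hg fun h => t'.pow_apply_of_le h _
  have hy : ∀ i, φ ((f ^ i) u) = (f' ^ i) u' := fun i =>
    t.lift_y hg fun h => t'.pow_apply_of_le h _
  have etop : t.chain (fun _ => True) (fun _ => True) = ⊤ := t.chain_eq_top hg (by simp) (by simp)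
  have hφ := t.chain_commutes (A := fun _ => True) (C := fun _ => True) (f' := f') (d' := d')
    t'.ops.proj_comp (G := φ) (fun i _ _ => by rw [hx]; exact t'.x_charge i)
    (fun i _ _ => by rw [hy]; exact t'.y_charge i)
    (fun i _ _ => by rw [hx, hx, end_pow_succ_apply])
    (fun i _ _ => by rw [hy, hy, end_pow_succ_apply])
    (fun i _ _ => by
      rw [hx]
      cases i with
      | zero =>
        rw [pow_zero, Module.End.one_apply, t.d_T, hy, pow_zero, Module.End.one_apply, t'.d_T]
      | succ i => rw [t.d_x_succ, t'.d_x_succ, map_add, map_smul, map_smul, hx, hy])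
    (fun i _ _ => by
      rw [hy]
      cases i with
      | zero =>
        rw [pow_zero, Module.End.one_apply, t.d_u, pow_zero, Module.End.one_apply, t'.d_u,
          map_zero]
      | succ i => rw [t.d_y_succ, t'.d_y_succ, map_smul, hy])
  rw [etop] at hφ
  have hsub : IsSub Y ⊤ := by
    rw [← etop]
    exact t.isSub_chain (by simp) (by simp) (by simp) (by simp) (by simp)
  have hker := t.isSub_ker hsub hφ
  rw [top_inf_eq] at hker
  refine ⟨φ, isHom_of_ops t.ops t'.ops t.two_le (fun α w => hφ.1 α w trivial)
    (fun w => hφ.2.1 w trivial) (fun w => hφ.2.2 w trivial), ?_⟩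
  -- A nonzero kernel would contain F^ℓ u, whose image F^ℓ u' is nonzero.
  rw [← LinearMap.ker_eq_bot]
  by_contra h
  have := LinearMap.mem_ker.1 (t.y_ell_mem_of_ne_bot hg hker h)
  rw [hy] at this
  exact t'.f_u this

/-- The kernel of d is graded, so the homogeneous components a F^i T + b F^{i+ℓ} u can be treated
one by one. The coefficient of T is left open: T has the charge of the coinvariant F^ℓ u, and only
the charges of coinvariants are used later. -/
lemma coeff_of_coinvariant {a b : ℕ → ℂ}
    (h : d (∑ i ∈ Finset.range p, (a i • (f ^ i) T + b i • (f ^ i) u)) = 0) :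
    ∀ i < p, (i ≠ 0 → a i = 0) ∧ (i ≠ 0 → i ≠ ℓ → b i = 0) := by
  have e1 := t.add_eq; have e2 := t.r_pos; have e3 := t.ell_pos
  have hgr : Graded Y (LinearMap.ker d) := by
    intro α w hw
    have := LinearMap.congr_fun (t.ops.d_proj α) w
    rw [LinearMap.comp_apply, LinearMap.comp_apply, LinearMap.mem_ker.1 hw, map_zero] at this
    exact this
  obtain ⟨c1, c2⟩ := t.homog_components hgr (LinearMap.mem_ker.2 h)
  have ha : ∀ i, i + 1 < p → a (i + 1) = 0 := by
    intro i hi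
    have e := LinearMap.mem_ker.1 (c1 (i + 1) hi)
    rw [map_add, map_smul, map_smul] at e
    by_cases hir : i + 1 = r
    · rw [hir, t.d_x_r, t.pow_apply_of_le (i := r + ℓ) (by omega), map_zero, smul_zero, add_zero,
        smul_smul, smul_eq_zero, mul_eq_zero] at e
      rw [hir]
      exact (e.resolve_right (t.y_ne_zero (by omega))).resolve_right (Q_ne_zero p _)
    · have e4 := congrArg (f ^ (p - 1 - i)) e
      rw [t.d_x_succ, show i + 1 + ℓ = i + ℓ + 1 by ring, t.d_y_succ] at e4
      simp only [map_add, map_smul, end_pow_add_apply, map_zero] at e4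
      rw [t.pow_apply_of_le (show p ≤ p - 1 - i + (i + ℓ) by omega), smul_zero, smul_zero,
        smul_zero, zero_add, add_zero, smul_smul, smul_eq_zero, mul_eq_zero] at e4
      exact (e4.resolve_right (t.x_ne_zero (by omega))).resolve_right
        (t.coef_ne_zero hi (by omega) hir)
  intro i hi
  constructor
  · intro h0
    obtain ⟨j, rfl⟩ := Nat.exists_eq_succ_of_ne_zero h0
    exact ha j hi
  · intro h0 hl
    obtain ⟨j, rfl⟩ := Nat.exists_eq_succ_of_ne_zero h0
    have key : b (j + 1) • (f ^ (j + 1)) u ∈ LinearMap.ker d := by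
      rcases lt_or_ge (j + 1) ℓ with h4 | h4
      · exact c2 _ h4
      · obtain ⟨m, hm⟩ : ∃ m, j + 1 = m + 1 + ℓ := ⟨j - ℓ, by omega⟩
        have := c1 (m + 1) (by omega)
        rwa [ha m (by omega), zero_smul, zero_add, ← hm] at this
    rw [LinearMap.mem_ker, map_smul, t.d_y_succ, smul_smul, smul_eq_zero, mul_eq_zero] at key
    exact (key.resolve_right (t.y_ne_zero (by omega))).resolve_right
      (t.coef_ne_zero hi (by omega) hl)

/-- A nonzero homogeneous coinvariant has the charge of `T` or that of `u`. -/
lemma charge_of_coinvariant (hg : ∀ W, IsSub Y W → T ∈ W → W = ⊤) {α : ZMod (4 * p)}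
    {w : Y.carrier} (hα : Y.proj α w = w) (hw : w ≠ 0) (hd : d w = 0) :
    α = n ∨ α = ((n + 2 * ℓ : ℤ) : ZMod (4 * p)) := by
  by_contra! h
  apply hw
  rw [← hα]
  obtain ⟨a, b, rfl⟩ := t.exists_eq_sum hg w
  have hc := t.coeff_of_coinvariant hd
  rw [map_sum]
  refine Finset.sum_eq_zero fun i hi => ?_
  obtain ⟨ha, hb⟩ := hc i (Finset.mem_range.1 hi)
  rw [map_add, map_smul, map_smul, HasOps.homog_of_proj t.ops (t.x_charge i) α,
    HasOps.homog_of_proj t.ops (t.y_charge i) α]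
  have h1 : a i • (if α = ((n - 2 * i : ℤ) : ZMod (4 * p)) then (f ^ i) T else 0) = 0 := by
    by_cases h0 : i = 0
    · subst h0
      rw [if_neg (by simpa using h.1), smul_zero]
    · rw [ha h0, zero_smul]
  have h2 : b i • (if α = ((n + 2 * ℓ - 2 * i : ℤ) : ZMod (4 * p)) then (f ^ i) u else 0) = 0 := by
    by_cases h0 : i = 0
    · subst h0
      rw [if_neg (by simpa using h.2), smul_zero]
    · by_cases hl : i = ℓ
      · rw [hl, if_neg (by simpa using h.1), smul_zero]
      · rw [hb h0 hl, zero_smul]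
  rw [h1, h2, add_zero]

end TopPair

/-! ### The modules `P[r]_ν` -/

section TwoVertexTop

/-- The operator `V_{s,t} ↦ V_{s+1,t}`. -/
def shiftLeft (p : ℕ) : Module.End ℂ (Fin p × Fin p → ℂ) :=
  (Pi.basisFun ℂ (Fin p × Fin p)).constr ℂ fun i => vtx₂ p (i.1.val + 1) i.2.val

lemma shiftLeft_vtx₂ (s t : ℕ) : shiftLeft p (vtx₂ p s t) = vtx₂ p (s + 1) t := by
  rcases lt_or_ge s p with hs | hs
  · rcases lt_or_ge t p with ht | ht
    · rw [shiftLeft, constr_vtx₂ _ hs ht]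
    · rw [vtx₂_eq_zero_right ht, vtx₂_eq_zero_right ht, map_zero]
  · rw [vtx₂_eq_zero_left hs, vtx₂_eq_zero_left (by omega), map_zero]

/-- The span of the `V_{s,t}` with `s + t = N`. -/
def level (p N : ℕ) : Submodule ℂ (Fin p × Fin p → ℂ) :=
  Submodule.span ℂ {v | ∃ s t, s + t = N ∧ vtx₂ p s t = v}

lemma vtx₂_mem_level (s t : ℕ) : vtx₂ p s t ∈ level p (s + t) :=
  Submodule.subset_span ⟨s, t, rfl, rfl⟩

lemma level_le {N : ℕ} {V : Submodule ℂ (Fin p × Fin p → ℂ)}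
    (h : ∀ s t, s + t = N → vtx₂ p s t ∈ V) : level p N ≤ V := by
  rw [level, Submodule.span_le]
  rintro _ ⟨s, t, hst, rfl⟩
  exact h s t hst

lemma twoF_pow_mem_level (a b : ℤ) (N : ℕ) : (twoF p a b ^ N) (vtx₂ p 0 0) ∈ level p N := by
  induction N with
  | zero => exact vtx₂_mem_level 0 0
  | succ N ih =>
    rw [← end_pow_succ_apply]
    refine (level_le (V := (level p (N + 1)).comap (twoF p a b)) fun s t hst => ?_) ih
    rw [Submodule.mem_comap, twoF_vtx₂]
    refine Submodule.add_mem _ (Submodule.smul_mem _ _ ?_) (Submodule.smul_mem _ _ ?_)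
    · rw [← hst, show s + t + 1 = s + 1 + t by ring]; exact vtx₂_mem_level _ _
    · rw [← hst, show s + t + 1 = s + (t + 1) by ring]; exact vtx₂_mem_level _ _

/-- d removes the F that the shift has added on the left; the bound ensures that the shift truncates
nothing. This gives d T = F^{ℓ−1} u for the vector T of the two-vertex module. -/
lemma twoD_shiftLeft {N : ℕ} (hN : N + 1 < p) {v : Fin p × Fin p → ℂ} (hv : v ∈ level p N) :
    twoD p (shiftLeft p v) = v := by
  refine (level_le (V := LinearMap.eqLocus (twoD p ∘ₗ shiftLeft p) LinearMap.id)
    fun s t hst => ?_) hv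
  rw [LinearMap.mem_eqLocus, LinearMap.comp_apply, shiftLeft_vtx₂, twoD_vtx₂_succ (by omega)]
  rfl

lemma twoProj_shiftLeft (a b : ℤ) {N : ℕ} {α : ZMod (4 * p)}
    (hα : α = ((a + b - 2 * (N + 1) : ℤ) : ZMod (4 * p))) {v : Fin p × Fin p → ℂ}
    (hv : v ∈ level p N) : twoProj p a b α (shiftLeft p v) = shiftLeft p v := by
  have h : level p N ≤ LinearMap.eqLocus (twoProj p a b α ∘ₗ shiftLeft p) (shiftLeft p) := by
    refine level_le fun s t hst => ?_
    rw [LinearMap.mem_eqLocus, LinearMap.comp_apply, shiftLeft_vtx₂, twoProj_vtx₂, if_pos]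
    rw [hα, ← hst]; push_cast; ring
  exact h hv

/-- Coordinates with first index 0 are fed only by the second summand of the action, so they evolve
among themselves. -/
lemma twoF_apply_zero (a b : ℤ) {t : ℕ} (ht : t + 1 < p) (v : Fin p × Fin p → ℂ) :
    twoF p a b v (⟨0, by omega⟩, ⟨t + 1, ht⟩) =
      (xi p * q p ^ (-a) * qint p (t - b) * qint p (t + 1)) * v (⟨0, by omega⟩, ⟨t, by omega⟩) := by
  refine LinearMap.congr_fun (vtx₂_ext
    (g := (LinearMap.proj ((⟨0, by omega⟩, ⟨t + 1, ht⟩) : Fin p × Fin p) :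
      (Fin p × Fin p → ℂ) →ₗ[ℂ] ℂ) ∘ₗ twoF p a b)
    (h := (xi p * q p ^ (-a) * qint p (t - b) * qint p (t + 1)) •
      (LinearMap.proj ((⟨0, by omega⟩, ⟨t, by omega⟩) : Fin p × Fin p) :
        (Fin p × Fin p → ℂ) →ₗ[ℂ] ℂ)) fun s hs t' ht' => ?_) v
  rw [LinearMap.comp_apply, LinearMap.smul_apply, LinearMap.proj_apply, LinearMap.proj_apply,
    twoF_vtx₂]
  by_cases h1 : s = 0 ∧ t' = t
  · obtain ⟨rfl, rfl⟩ := h1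
    simp [vtx₂]
  · have e1 : vtx₂ p (s + 1) t' (⟨0, by omega⟩, ⟨t + 1, ht⟩) = 0 := if_neg (by simp)
    have e2 : vtx₂ p s (t' + 1) (⟨0, by omega⟩, ⟨t + 1, ht⟩) = 0 := if_neg (by simp; omega)
    have e3 : vtx₂ p s t' (⟨0, by omega⟩, ⟨t, by omega⟩) = 0 := if_neg (by simp; omega)
    rw [Pi.add_apply, Pi.smul_apply, Pi.smul_apply, e1, e2, e3]
    simp

/-- The coefficient at V_{0,N} is a product over t < N of nonzero constants with ⟨t − b⟩⟨t + 1⟩. As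
b ≡ N modulo p and N < p, no factor vanishes. -/
lemma twoF_pow_ne_zero [NeZero p] (hp : 2 ≤ p) {a b : ℤ} {N : ℕ} (hN : N < p)
    (hb : (p : ℤ) ∣ N - b) : (twoF p a b ^ N) (vtx₂ p 0 0) ≠ 0 := by
  have key : ∀ M (hM : M ≤ N), (twoF p a b ^ M) (vtx₂ p 0 0) (⟨0, by omega⟩, ⟨M, by omega⟩) ≠ 0 := by
    intro M
    induction M with
    | zero => intro _; simp [vtx₂]
    | succ M ih =>
      intro hM
      rw [← end_pow_succ_apply, twoF_apply_zero]
      refine mul_ne_zero (mul_ne_zero (mul_ne_zero (mul_ne_zero (xi_ne_zero hp)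
        (zpow_ne_zero _ (q_ne_zero p))) ?_) (qint_ne_zero hp (by omega) (by omega))) (ih (by omega))
      rw [Ne, qint_eq_zero_iff hp]
      intro h
      have h1 := dvd_sub hb h
      have := Int.le_of_dvd (by omega) h1
      omega
  intro h
  apply key N le_rfl
  rw [h]; rfl

end TwoVertexTop

lemma topVector_eq [NeZero p] (hp : 2 ≤ p) {ℓ : ℕ} (hl : ℓ - 1 < p) (a b : ℤ) :
    topVector p ℓ a b = shiftLeft p ((twoF p a b ^ (ℓ - 1)) (vtx₂ p 0 0)) := by
  have h : qfac p (ℓ - 1) • actOf p (twoF p a b) (Nich.F p (ℓ - 1) ⊗ₜ[ℂ] vtx₂ p 0 0) =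
      (twoF p a b ^ (ℓ - 1)) (vtx₂ p 0 0) := by
    rw [actOf_F hp, dpow, LinearMap.smul_apply, smul_smul, mul_inv_cancel₀ (qfac_ne_zero hp hl),
      one_smul]
  exact congrArg (shiftLeft p) h

theorem topPair_twoVertex [NeZero p] {r ℓ : ℕ} (hr : 1 ≤ r) (hl : 1 ≤ ℓ) (hrl : r + ℓ = p)
    {a b n : ℤ} (hab : a + b - 2 * ℓ = n) (ha : (p : ℤ) ∣ r - 1 - n) (hb : (p : ℤ) ∣ ℓ - b) :
    TopPair (twoVertex p a b) (twoF p a b) (twoD p) r ℓ n (topVector p ℓ a b) (vtx₂ p 0 0) where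
  ops := ops_twoVertex (by omega) a b
  r_pos := hr
  ell_pos := hl
  add_eq := hrl
  dvd := ha
  T_charge := by
    rw [topVector_eq (by omega) (by omega)]
    refine twoProj_shiftLeft a b ?_ (twoF_pow_mem_level (p := p) a b (ℓ - 1))
    rw [show a + b - 2 * (((ℓ - 1 : ℕ) : ℤ) + 1) = n by omega]
  u_charge := by
    have := twoProj_vtx₂ p a b ((a + b - 2 * (0 : ℕ) - 2 * (0 : ℕ) : ℤ)) 0 0
    rw [if_pos rfl, show a + b - 2 * ((0 : ℕ) : ℤ) - 2 * ((0 : ℕ) : ℤ) = n + 2 * ℓ by omega] at this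
    exact this
  d_u := twoD_vtx₂_zero p 0
  d_T := by
    rw [topVector_eq (by omega) (by omega)]
    exact twoD_shiftLeft (by omega) (twoF_pow_mem_level (p := p) a b (ℓ - 1))
  f_u := twoF_pow_ne_zero (by omega) (by omega) hb

lemma mem_gen (Y : YDData p) (v : Y.carrier) : v ∈ gen Y v := by
  simp only [gen, Submodule.mem_sInf, Set.mem_ofPred_eq]
  exact fun W hW => hW.2

lemma gen_le {Y : YDData p} {v : Y.carrier} {W : Submodule ℂ Y.carrier} (hW : IsSub Y W)
    (hv : v ∈ W) : gen Y v ≤ W :=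
  sInf_le ⟨hW, hv⟩

lemma restrict_pow_apply {V : Type} [AddCommGroup V] [Module ℂ V] {f : Module.End ℂ V}
    {W : Submodule ℂ V} (hf : ∀ w ∈ W, f w ∈ W) (i : ℕ) (w : W) :
    (((f.restrict hf) ^ i) w : V) = (f ^ i) w := by
  induction i with
  | zero => rfl
  | succ i ih =>
    rw [← end_pow_succ_apply, ← end_pow_succ_apply, LinearMap.coe_restrict_apply, ih]

/-- The submodule generated by `T`. -/
theorem TopPair.sub_gen [NeZero p] {Z : YDData p} {f d : Module.End ℂ Z.carrier} {r ℓ : ℕ} {n : ℤ}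
    {T u : Z.carrier} (t : TopPair Z f d r ℓ n T u) :
    ∃ (f' d' : Module.End ℂ (gen Z T)) (T' u' : gen Z T),
      TopPair (sub Z (gen Z T) (isSub_gen Z T)) f' d' r ℓ n T' u' ∧
      ∀ W, IsSub (sub Z (gen Z T) (isSub_gen Z T)) W → T' ∈ W → W = ⊤ := by
  obtain ⟨h1, h2, h3⟩ := (HasOps.isSub_iff t.ops t.two_le _).1 (isSub_gen Z T)
  have hT := mem_gen Z T
  have hu := t.u_mem h3 hT
  have hops := HasOps.sub t.ops t.two_le (isSub_gen Z T) h2 h3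
  refine ⟨f.restrict h2, d.restrict h3, ⟨T, hT⟩, ⟨u, hu⟩, ⟨hops, t.r_pos, t.ell_pos, t.add_eq,
    t.dvd, Subtype.ext t.T_charge, Subtype.ext t.u_charge, Subtype.ext t.d_u,
    Subtype.ext (t.d_T.trans (restrict_pow_apply h2 (ℓ - 1) ⟨u, hu⟩).symm), fun h => t.f_u ?_⟩, ?_⟩
  · exact (restrict_pow_apply h2 ℓ ⟨u, hu⟩).symm.trans (congrArg Subtype.val h)
  · intro W hW hTW
    obtain ⟨w1, w2, w3⟩ := (HasOps.isSub_iff hops t.two_le W).1 hW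
    let W' : Submodule ℂ Z.carrier := Submodule.map (gen Z T).subtype W
    have hW' : IsSub Z W' := by
      refine (HasOps.isSub_iff t.ops t.two_le W').2 ⟨?_, ?_, ?_⟩
      · rintro α _ ⟨w, hw, rfl⟩
        exact ⟨_, w1 α w hw, rfl⟩
      · rintro _ ⟨w, hw, rfl⟩
        exact ⟨_, w2 w hw, rfl⟩
      · rintro _ ⟨w, hw, rfl⟩
        exact ⟨_, w3 w hw, rfl⟩
    have hle : gen Z T ≤ W' := gen_le hW' ⟨_, hTW, rfl⟩
    rw [eq_top_iff]
    rintro ⟨x, hx⟩ -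
    obtain ⟨w, hw, hwx⟩ := hle hx
    have : w = ⟨x, hx⟩ := Subtype.ext hwx
    rwa [← this]

/-- The module `P[r]_ν` is generated by a vector `T` as in `TopPair`. -/
theorem topPair_P [NeZero p] {r : ℕ} (hr : 1 ≤ r) (hrp : r < p) (ν : ZMod 4) :
    ∃ (f d : Module.End ℂ (P p r ν).carrier) (T u : (P p r ν).carrier),
      TopPair (P p r ν) f d r (p - r) (label p r ν) T u ∧
      ∀ W, IsSub (P p r ν) W → T ∈ W → W = ⊤ := by
  have t := topPair_twoVertex (p := p) (r := r) (ℓ := p - r) hr (by omega) (by omega)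
    (a := (p : ℤ) - 1) (b := (p : ℤ) - r - (ν.val : ℤ) * p) (n := label p r ν)
    (by rw [label, Nat.cast_sub hrp.le]; ring) (dvd_label p r ν)
    ⟨ν.val, by rw [Nat.cast_sub hrp.le]; ring⟩
  have h := t.sub_gen
  have e : P p r ν = sub _ _ (isSub_gen (twoVertex p ((p : ℤ) - 1) ((p : ℤ) - r - (ν.val : ℤ) * p))
      (topVector p (p - r) ((p : ℤ) - 1) ((p : ℤ) - r - (ν.val : ℤ) * p))) := if_pos hrp
  rw [e]
  exact h

lemma P_self (ν : ZMod 4) : P p p ν = X p p ν := if_neg (lt_irrefl p)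

/-- The label involves the representative of ν in 0, …, 3; another representative changes it by a
multiple of 4p. -/
lemma label_cast_of_eq {r : ℕ} {ν : ZMod 4} {n : ℤ} (k : ℤ) (hk : ((k : ℤ) : ZMod 4) = ν)
    (hn : n = r - 1 - k * p) : ((n : ℤ) : ZMod (4 * p)) = (label p r ν : ℤ) := by
  have h : ((k : ℤ) : ZMod 4) = ((ν.val : ℤ) : ZMod 4) := by
    rw [hk]; simp
  rw [ZMod.intCast_eq_intCast_iff_dvd_sub] at h ⊢
  obtain ⟨c, hc⟩ := h
  refine ⟨-c, ?_⟩
  rw [hn, label]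
  have : (ν.val : ℤ) = k + 4 * c := by push_cast at hc; linarith
  rw [this]; push_cast; ring

theorem hasDiamond_P [NeZero p] {r : ℕ} (hr : 1 ≤ r) (hrp : r < p) (ν : ZMod 4) :
    HasDiamond (P p r ν) (X p r ν) (X p (p - r) (ν - 1)) (X p (p - r) (ν + 1)) := by
  obtain ⟨f, d, T, u, t, hg⟩ := topPair_P hr hrp ν
  -- With n = r − 1 − νp, the charge n + 2(p−r) of u equals (p−r) − 1 − (ν−1)p, and the charge n −
  -- 2r of F^r T equals (p−r) − 1 − (ν+1)p.
  refine t.hasDiamond hg rfl (label_cast_of_eq (ν.val - 1) (by simp) ?_)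
    (label_cast_of_eq (ν.val + 1) (by simp) ?_) (dvd_label p r ν) (dvd_label p _ _)
    (dvd_label p _ _)
  · rw [label, Nat.cast_sub hrp.le]; ring
  · rw [label, Nat.cast_sub hrp.le]; ring

/-! ### Kernels -/

lemma coeff_lTensor {V W : Type} [AddCommGroup V] [Module ℂ V] [AddCommGroup W] [Module ℂ W]
    (φ : V →ₗ[ℂ] W) (j : Fin p) (z : Nich p ⊗[ℂ] V) :
    coeff W j (φ.lTensor (Nich p) z) = φ (coeff V j z) := by
  induction z using TensorProduct.induction_on with
  | zero => simp
  | tmul b v => simp [coeff]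
  | add x y hx hy => rw [map_add, map_add, map_add, map_add, hx, hy]

lemma coeff_coact_of_isHom {Y Z : YDData p} {φ : Y.carrier →ₗ[ℂ] Z.carrier}
    (hφ : IsHom (Y := Y) (Z := Z) φ) (j : Fin p) (y : Y.carrier) :
    coeff Z.carrier j (Z.coact (φ y)) = φ (coeff Y.carrier j (Y.coact y)) := by
  rw [← coeff_lTensor]
  exact congrArg (coeff Z.carrier j) (LinearMap.congr_fun hφ.coact y)

/-- The kernel of a morphism is a submodule. -/
lemma isSub_ker_of_isHom {Y Z : YDData p} {φ : Y.carrier →ₗ[ℂ] Z.carrier}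
    (hφ : IsHom (Y := Y) (Z := Z) φ) : IsSub Y (LinearMap.ker φ) where
  graded α w hw := by
    have := LinearMap.congr_fun (hφ.proj α) w
    rw [LinearMap.comp_apply, LinearMap.comp_apply, LinearMap.mem_ker.1 hw, map_zero] at this
    exact this
  act b w hw := by
    have := LinearMap.congr_fun hφ.act (b ⊗ₜ w)
    rw [LinearMap.comp_apply, LinearMap.comp_apply, LinearMap.lTensor_tmul, LinearMap.mem_ker.1 hw,
      TensorProduct.tmul_zero, map_zero] at this
    exact this
  coact j w hw := by
    rw [LinearMap.mem_ker, ← coeff_coact_of_isHom hφ, LinearMap.mem_ker.1 hw, map_zero, map_zero]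

/-- For a ≡ r − 1 the scalar 1 − q^{2(r−1−a)} in d F^r u vanishes: F^r u is again coinvariant, and
whether it is zero decides between the two kinds of summands. -/
lemma HasOps.d_f_pow_eq_zero [NeZero p] {Y : YDData p} {f d : Module.End ℂ Y.carrier}
    (h : HasOps Y f d) (hp : 2 ≤ p) {r : ℕ} {a : ℤ} (ha : (p : ℤ) ∣ r - 1 - a) {u : Y.carrier}
    (hu : Y.proj a u = u) (hdu : d u = 0) : d ((f ^ r) u) = 0 := by
  cases r with
  | zero => exact hdu
  | succ k =>
    have h1 : Q p (k - a) = 1 := by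
      rw [Q_eq_one_iff]
      push_cast at ha
      rwa [add_sub_cancel_right] at ha
    rw [HasOps.d_f_pow h hp hu, hdu, map_zero, smul_zero, zero_add, h1, sub_self, mul_zero,
      zero_smul]

/-! ### Levels of a tensor product of one-vertex modules -/

section Levels

variable {n m : ℕ}

/-- The span of the `V_s ⊗ V_t` with `s + t = N`. -/
def tensorLevel (n m N : ℕ) : Submodule ℂ ((Fin n → ℂ) ⊗[ℂ] (Fin m → ℂ)) :=
  Submodule.span ℂ {v | ∃ s t, s + t = N ∧ vtx n s ⊗ₜ[ℂ] vtx m t = v}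

lemma tmul_mem_tensorLevel (s t : ℕ) : vtx n s ⊗ₜ[ℂ] vtx m t ∈ tensorLevel n m (s + t) :=
  Submodule.subset_span ⟨s, t, rfl, rfl⟩

lemma tensorLevel_le {N : ℕ} {V : Submodule ℂ ((Fin n → ℂ) ⊗[ℂ] (Fin m → ℂ))}
    (h : ∀ s t, s + t = N → vtx n s ⊗ₜ[ℂ] vtx m t ∈ V) : tensorLevel n m N ≤ V := by
  rw [tensorLevel, Submodule.span_le]
  rintro _ ⟨s, t, hst, rfl⟩
  exact h s t hst

/-- The `s`-th coordinate, which is `0` for `s ≥ n`. -/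
def coordN (n s : ℕ) : (Fin n → ℂ) →ₗ[ℂ] ℂ :=
  if h : s < n then LinearMap.proj ⟨s, h⟩ else 0

lemma coordN_vtx {s s' : ℕ} (h : s' < n) : coordN n s (vtx n s') = if s = s' then 1 else 0 := by
  by_cases hs : s < n
  · rw [coordN, dif_pos hs]; rfl
  · rw [coordN, dif_neg hs, if_neg (by omega)]; rfl

lemma coordN_of_le {s : ℕ} (h : n ≤ s) : coordN n s = 0 := dif_neg (by omega)

/-- The coefficient of `V_s ⊗ V_t`, which is `0` for `s ≥ n` and for `t ≥ m`. -/
def coordT (n m s t : ℕ) : (Fin n → ℂ) ⊗[ℂ] (Fin m → ℂ) →ₗ[ℂ] ℂ :=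
  (TensorProduct.lid ℂ ℂ).toLinearMap ∘ₗ TensorProduct.map (coordN n s) (coordN m t)

lemma coordT_tmul (s t : ℕ) (x : Fin n → ℂ) (y : Fin m → ℂ) :
    coordT n m s t (x ⊗ₜ[ℂ] y) = coordN n s x * coordN m t y := by
  simp [coordT]

lemma coordT_of_le_left {s : ℕ} (h : n ≤ s) (t : ℕ) : coordT n m s t = 0 := by
  rw [coordT, coordN_of_le h, TensorProduct.map_zero_left, LinearMap.comp_zero]

lemma coordT_of_le_right {t : ℕ} (h : m ≤ t) (s : ℕ) : coordT n m s t = 0 := by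
  rw [coordT, coordN_of_le h, TensorProduct.map_zero_right, LinearMap.comp_zero]

lemma coordT_eq_zero {v : (Fin n → ℂ) ⊗[ℂ] (Fin m → ℂ)} (h : ∀ s t, coordT n m s t v = 0) :
    v = 0 := by
  obtain ⟨c, rfl⟩ := exists_sum_vtx v
  refine Finset.sum_eq_zero fun s hs => Finset.sum_eq_zero fun t ht => ?_
  rw [Finset.mem_range] at hs ht
  have := h s t
  rw [map_sum, Finset.sum_eq_single s, map_sum, Finset.sum_eq_single t, map_smul, coordT_tmul,
    coordN_vtx hs, coordN_vtx ht, if_pos rfl, if_pos rfl, smul_eq_mul, mul_one, mul_one] at this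
  · rw [this, zero_smul]
  · intro t' ht' hne
    rw [map_smul, coordT_tmul, coordN_vtx (Finset.mem_range.1 ht'), if_neg hne.symm, mul_zero,
      smul_zero]
  · intro h'; exact absurd (Finset.mem_range.2 ht) h'
  · intro s' hs' hne
    rw [map_sum]
    refine Finset.sum_eq_zero fun t' ht' => ?_
    rw [map_smul, coordT_tmul, coordN_vtx (Finset.mem_range.1 hs'), if_neg hne.symm, zero_mul,
      smul_zero]
  · intro h'; exact absurd (Finset.mem_range.2 hs) h'

lemma coordT_of_mem_level {N s t : ℕ} (hst : s + t ≠ N) {v : (Fin n → ℂ) ⊗[ℂ] (Fin m → ℂ)}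
    (hv : v ∈ tensorLevel n m N) : coordT n m s t v = 0 := by
  have : tensorLevel n m N ≤ LinearMap.ker (coordT n m s t) := by
    refine tensorLevel_le fun s' t' h => ?_
    rw [LinearMap.mem_ker, coordT_tmul]
    rcases lt_or_ge s' n with hs | hs
    · rcases lt_or_ge t' m with ht | ht
      · rw [coordN_vtx hs, coordN_vtx ht]
        by_cases h1 : s = s'
        · rw [if_neg (show t ≠ t' by omega), mul_zero]
        · rw [if_neg h1, zero_mul]
      · rw [vtx_eq_zero ht, map_zero, mul_zero]
    · rw [vtx_eq_zero hs, map_zero, zero_mul]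
  exact LinearMap.mem_ker.1 (this hv)

variable [NeZero p] {a b : ℤ} (hp : 2 ≤ p) (hn : n ≤ p) (ha : qint p (n - 1 - a) * qint p n = 0)
include hp hn ha

lemma tenF_mem_level {N : ℕ} {v : (Fin n → ℂ) ⊗[ℂ] (Fin m → ℂ)} (hv : v ∈ tensorLevel n m N) :
    tenF p n m a b v ∈ tensorLevel n m (N + 1) := by
  refine (tensorLevel_le (V := (tensorLevel n m (N + 1)).comap (tenF p n m a b))
    fun s t hst => ?_) hv
  rw [Submodule.mem_comap, tenF_tmul hp hn ha, ← hst]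
  refine Submodule.add_mem _ (Submodule.smul_mem _ _ ?_) (Submodule.smul_mem _ _ ?_)
  · rw [show s + t + 1 = s + 1 + t by ring]; exact tmul_mem_tensorLevel _ _
  · exact tmul_mem_tensorLevel s (t + 1)

lemma tenF_pow_mem_level {N : ℕ} {v : (Fin n → ℂ) ⊗[ℂ] (Fin m → ℂ)} (hv : v ∈ tensorLevel n m N)
    (j : ℕ) : (tenF p n m a b ^ j) v ∈ tensorLevel n m (N + j) := by
  induction j with
  | zero => exact hv
  | succ j ih =>
    rw [← end_pow_succ_apply]
    exact tenF_mem_level hp hn ha ih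

lemma coordT_tenD {s t : ℕ} (v : (Fin n → ℂ) ⊗[ℂ] (Fin m → ℂ)) :
    coordT n m s t (tenD p n m a b v) =
      coordT n m (s + 1) t v + q p ^ (2 * (s : ℤ) - a) * coordT n m s (t + 1) v := by
  refine LinearMap.congr_fun (vtx_tmul_ext (g := coordT n m s t ∘ₗ tenD p n m a b)
    (h := coordT n m (s + 1) t + q p ^ (2 * (s : ℤ) - a) • coordT n m s (t + 1))
    fun s' hs' t' ht' => ?_) v
  rw [LinearMap.comp_apply, tenD_tmul hp hn ha, LinearMap.add_apply, LinearMap.smul_apply, map_add,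
    map_smul, coordT_tmul, coordT_tmul, coordT_tmul, coordT_tmul, coordN_vtx hs', coordN_vtx ht',
    coordN_vtx hs', coordN_vtx ht']
  congr 1
  · cases s' with
    | zero => rw [oneD_vtx_zero, map_zero]; simp
    | succ s' =>
      rw [oneD_vtx_succ hs', coordN_vtx (by omega)]
      simp
  · by_cases h1 : s = s'
    · subst h1
      congr 2
      cases t' with
      | zero => rw [oneD_vtx_zero, map_zero]; simp
      | succ t' =>
        rw [oneD_vtx_succ ht', coordN_vtx (by omega)]
        simp
    · rw [if_neg h1, zero_mul, zero_mul, smul_zero, smul_zero]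

/-- The equation d v = 0 expresses each coefficient at (s+1, t) through that at (s, t+1). For N ≥ m
the one at s = 0 is out of range, so all of them vanish by induction on s. -/
lemma eq_zero_of_tenD_eq_zero {N : ℕ} (hN : m ≤ N) {v : (Fin n → ℂ) ⊗[ℂ] (Fin m → ℂ)}
    (hv : v ∈ tensorLevel n m N) (h : tenD p n m a b v = 0) : v = 0 := by
  have key : ∀ s t, s + t = N → coordT n m s t v = 0 := by
    intro s
    induction s with
    | zero => intro t ht; rw [coordT_of_le_right (by omega)]; rfl
    | succ s ih =>
      intro t ht
      rcases lt_or_ge (s + 1) n with hs | hs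
      · rcases lt_or_ge t m with htm | htm
        · have := coordT_tenD (b := b) hp hn ha (s := s) (t := t) v
          rwa [h, map_zero, ih (t + 1) (by omega), mul_zero, add_zero, eq_comm] at this
        · rw [coordT_of_le_right htm]; rfl
      · rw [coordT_of_le_left hs]; rfl
  refine coordT_eq_zero fun s t => ?_
  by_cases hst : s + t = N
  · exact key s t hst
  · exact coordT_of_mem_level hst hv

/-- d(V_{s+1} ⊗ V_t) is V_s ⊗ V_t plus a multiple of V_{s+1} ⊗ V_{t−1}, which permits an induction
on t. The bound N + 1 < n keeps s + 1 in range. -/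
lemma exists_tenD_eq {N : ℕ} (hN : N + 1 < n) {w : (Fin n → ℂ) ⊗[ℂ] (Fin m → ℂ)}
    (hw : w ∈ tensorLevel n m N) : ∃ v ∈ tensorLevel n m (N + 1), tenD p n m a b v = w := by
  have key : ∀ t s, s + t = N →
      vtx n s ⊗ₜ[ℂ] vtx m t ∈ (tensorLevel n m (N + 1)).map (tenD p n m a b) := by
    intro t
    induction t with
    | zero =>
      intro s hs
      refine ⟨vtx n (s + 1) ⊗ₜ vtx m 0, by
        rw [← hs, show s + 0 + 1 = s + 1 + 0 by ring]; exact tmul_mem_tensorLevel _ _, ?_⟩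
      rw [tenD_tmul hp hn ha, oneD_vtx_zero, TensorProduct.tmul_zero, smul_zero, add_zero,
        oneD_vtx_succ (by omega)]
    | succ t ih =>
      intro s hs
      rcases lt_or_ge (t + 1) m with ht | ht
      · have h1 : tenD p n m a b (vtx n (s + 1) ⊗ₜ vtx m (t + 1)) ∈
            (tensorLevel n m (N + 1)).map (tenD p n m a b) := ⟨_, by
          rw [← hs, show s + (t + 1) + 1 = s + 1 + (t + 1) by ring]
          exact tmul_mem_tensorLevel _ _, rfl⟩
        rw [tenD_tmul hp hn ha, oneD_vtx_succ (by omega), oneD_vtx_succ ht] at h1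
        exact (Submodule.add_mem_iff_left _ (Submodule.smul_mem _ _ (ih (s + 1) (by omega)))).1 h1
      · rw [vtx_eq_zero ht, TensorProduct.tmul_zero]; exact Submodule.zero_mem _
  obtain ⟨v, hv, h⟩ := tensorLevel_le (fun s t hst => key t s hst) hw
  exact ⟨v, hv, h⟩

/-- There is a coinvariant of each level less than `n` and `m`. -/
lemma exists_coinvariant_level {N : ℕ} (hNn : N < n) (hNm : N < m) :
    ∃ u ∈ tensorLevel n m N, tenD p n m a b u = 0 ∧ coordT n m N 0 u ≠ 0 := by
  -- The solution of c_{s+1} = −q^{2s−a} c_s with c_0 = 1, the condition for the terms of d to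
  -- cancel in pairs.
  let c : ℕ → ℂ := fun s => ∏ i ∈ Finset.range s, (-q p ^ (2 * (i : ℤ) - a))
  have hc : ∀ s, c (s + 1) = -q p ^ (2 * (s : ℤ) - a) * c s := by
    intro s; simp only [c]; rw [Finset.prod_range_succ, mul_comm]
  refine ⟨∑ s ∈ Finset.range (N + 1), c s • (vtx n s ⊗ₜ[ℂ] vtx m (N - s)), ?_, ?_, ?_⟩
  · refine Submodule.sum_mem _ fun s hs => Submodule.smul_mem _ _ ?_
    rw [Finset.mem_range] at hs
    have := tmul_mem_tensorLevel (n := n) (m := m) s (N - s)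
    rwa [show s + (N - s) = N by omega] at this
  · rw [map_sum, Finset.sum_congr rfl fun s _ => by
      rw [map_smul, tenD_tmul hp hn ha, smul_add], Finset.sum_add_distrib, Finset.sum_range_succ',
      Finset.sum_range_succ (n := N), oneD_vtx_zero, TensorProduct.zero_tmul, smul_zero, add_zero,
      Nat.sub_self, oneD_vtx_zero, TensorProduct.tmul_zero, smul_zero, smul_zero, add_zero,
      ← Finset.sum_add_distrib]
    refine Finset.sum_eq_zero fun s hs => ?_
    rw [Finset.mem_range] at hs
    obtain ⟨k, rfl⟩ : ∃ k, N = s + 1 + k := ⟨N - (s + 1), by omega⟩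
    rw [oneD_vtx_succ (by omega), show s + 1 + k - (s + 1) = k by omega,
      show s + 1 + k - s = k + 1 by omega, oneD_vtx_succ (by omega), smul_smul, ← add_smul, hc]
    rw [show -q p ^ (2 * (s : ℤ) - a) * c s + c s * q p ^ (2 * (s : ℤ) - a) = 0 by ring, zero_smul]
  · rw [map_sum, Finset.sum_eq_single N]
    · rw [map_smul, coordT_tmul, coordN_vtx hNn, Nat.sub_self, coordN_vtx (by omega), if_pos rfl,
        if_pos rfl, mul_one, smul_eq_mul, mul_one]
      simp only [c]
      exact Finset.prod_ne_zero_iff.2 fun i _ => neg_ne_zero.2 (zpow_ne_zero _ (q_ne_zero p))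
    · intro s hs hne
      rw [Finset.mem_range] at hs
      rw [map_smul, coordT_tmul, coordN_vtx (by omega), if_neg hne.symm, zero_mul, smul_zero]
    · intro h; exact absurd (Finset.mem_range.2 (by omega)) h

lemma coordT_tenF {s : ℕ} (hs : s + 1 < n) (v : (Fin n → ℂ) ⊗[ℂ] (Fin m → ℂ)) :
    coordT n m (s + 1) 0 (tenF p n m a b v) =
      (xi p * qint p (s - a) * qint p (s + 1)) * coordT n m s 0 v := by
  refine LinearMap.congr_fun (vtx_tmul_ext (g := coordT n m (s + 1) 0 ∘ₗ tenF p n m a b)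
    (h := (xi p * qint p (s - a) * qint p (s + 1)) • coordT n m s 0) fun s' hs' t' ht' => ?_) v
  have e1 : coordN m 0 (vtx m (t' + 1)) = 0 := by
    rcases lt_or_ge (t' + 1) m with h | h
    · rw [coordN_vtx h, if_neg (by omega)]
    · rw [vtx_eq_zero h, map_zero]
  rw [LinearMap.comp_apply, tenF_tmul hp hn ha, LinearMap.smul_apply, map_add, map_smul, map_smul,
    coordT_tmul, coordT_tmul, coordT_tmul, e1, mul_zero, smul_zero, add_zero]
  by_cases h1 : s = s'
  · subst h1
    rw [coordN_vtx hs, coordN_vtx hs', if_pos rfl, if_pos rfl]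
  · have e2 : coordN n (s + 1) (vtx n (s' + 1)) = 0 := by
      rcases lt_or_ge (s' + 1) n with h | h
      · rw [coordN_vtx h, if_neg (by omega)]
      · rw [vtx_eq_zero h, map_zero]
    rw [e2, coordN_vtx hs', if_neg h1, zero_mul, smul_zero, smul_zero]

omit ha in
-- Only the coordinate at V_{N+i} ⊗ V_0 is followed: there F acts as on the first factor alone, with
-- nonzero coefficients as long as the index stays below n.
lemma tenF_pow_ne_zero (hdvd : (p : ℤ) ∣ n - 1 - a) {N j : ℕ} (hNj : N + j < n)
    {u : (Fin n → ℂ) ⊗[ℂ] (Fin m → ℂ)} (hu : coordT n m N 0 u ≠ 0) :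
    (tenF p n m a b ^ j) u ≠ 0 := by
  have ha := qint_mul_eq_zero_of_dvd hp (m := n) hdvd
  have key : ∀ i ≤ j, coordT n m (N + i) 0 ((tenF p n m a b ^ i) u) ≠ 0 := by
    intro i
    induction i with
    | zero => intro _; exact hu
    | succ i ih =>
      intro hi
      rw [← end_pow_succ_apply, ← add_assoc, coordT_tenF hp hn ha (by omega)]
      refine mul_ne_zero (mul_ne_zero (mul_ne_zero (xi_ne_zero hp) ?_)
        (qint_ne_zero hp (by omega) (by omega))) (ih (by omega))
      rw [Ne, qint_eq_zero_iff hp]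
      intro h
      have := Int.le_of_dvd (by omega) (dvd_sub hdvd h)
      omega
  intro h
  apply key j le_rfl
  rw [h, map_zero]

lemma tenProj_of_mem_level (hm : m ≤ p) (hb : qint p (m - 1 - b) * qint p m = 0) {N : ℕ}
    {α : ZMod (4 * p)} (hα : α = ((a + b - 2 * N : ℤ) : ZMod (4 * p)))
    {v : (Fin n → ℂ) ⊗[ℂ] (Fin m → ℂ)} (hv : v ∈ tensorLevel n m N) :
    tenProj p n m a b α v = v := by
  have h : tensorLevel n m N ≤ LinearMap.eqLocus (tenProj p n m a b α) LinearMap.id := by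
    refine tensorLevel_le fun s t hst => ?_
    rw [LinearMap.mem_eqLocus, tenProj_tmul hp hn hm ha hb, if_pos]
    · rfl
    · rw [hα, ← hst]; push_cast; ring
  exact h hv

end Levels

/-! ### The summands of a tensor product of simple modules -/

section Summands

variable [NeZero p] {r₁ r₂ : ℕ} (hp : 2 ≤ p) (h1 : 1 ≤ r₁) (h1' : r₁ ≤ p) (h2 : 1 ≤ r₂)
  (h2' : r₂ ≤ p) (ν₁ ν₂ : ZMod 4)
include hp h1 h1' h2 h2'

omit h1 h2 in
lemma ops_tensor_X : HasOps (tensor (X p r₁ ν₁) (X p r₂ ν₂))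
    (tenF p r₁ r₂ (label p r₁ ν₁) (label p r₂ ν₂))
    (tenD p r₁ r₂ (label p r₁ ν₁) (label p r₂ ν₂)) :=
  ops_ten hp h1' h2' (qint_mul_eq_zero_of_dvd hp (dvd_label p r₁ ν₁))
    (qint_mul_eq_zero_of_dvd hp (dvd_label p r₂ ν₂))

omit [NeZero p] hp h1 h1' h2 h2' in
lemma label_add_cast {s : ℕ} {N : ℤ} (hN : (r₁ : ℤ) + r₂ - 1 - s = 2 * N) :
    ((label p s (ν₁ + ν₂) : ℤ) : ZMod (4 * p)) =
      ((label p r₁ ν₁ + label p r₂ ν₂ - 2 * N : ℤ) : ZMod (4 * p)) := by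
  refine (label_cast_of_eq (ν₁.val + ν₂.val) (by simp) ?_).symm
  rw [label, label, ← hN]; ring

omit h1 h2 h2' in
lemma exists_coinvariant {N : ℕ} (hN1 : N < r₁) (hN2 : N < r₂) :
    ∃ u ∈ tensorLevel r₁ r₂ N, tenD p r₁ r₂ (label p r₁ ν₁) (label p r₂ ν₂) u = 0 ∧
      coordT r₁ r₂ N 0 u ≠ 0 :=
  exists_coinvariant_level hp h1' (qint_mul_eq_zero_of_dvd hp (dvd_label p r₁ ν₁)) hN1 hN2

/-- The coinvariant u of level N = (r₁ + r₂ − 1 − s)/2 has the highest charge of X(s). It defines a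
morphism once F^s u = 0. For s = p this is nilpotency; otherwise F^s u is a coinvariant of level N +
s ≥ max(r₁, r₂), hence zero. Injectivity follows from simplicity and u ≠ 0. -/
theorem exists_isHom_X {s : ℕ} (hs : s ∈ range₁ p r₁ r₂ ∨ s = p ∧ s ∈ range₂ p r₁ r₂) :
    ∃ φ : (X p s (ν₁ + ν₂)).carrier →ₗ[ℂ] (tensor (X p r₁ ν₁) (X p r₂ ν₂)).carrier,
      IsHom (Y := X p s (ν₁ + ν₂)) (Z := tensor (X p r₁ ν₁) (X p r₂ ν₂)) φ ∧
      Function.Injective φ := by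
  have hops := ops_tensor_X hp h1' h2' ν₁ ν₂
  have ha := qint_mul_eq_zero_of_dvd hp (m := r₁) (dvd_label p r₁ ν₁)
  have hb := qint_mul_eq_zero_of_dvd hp (m := r₂) (dvd_label p r₂ ν₂)
  obtain ⟨N, hN, hN1, hN2, hs1, hsp⟩ : ∃ N : ℕ, (r₁ : ℤ) + r₂ - 1 - s = 2 * N ∧ N < r₁ ∧ N < r₂ ∧
      1 ≤ s ∧ s ≤ p := by
    simp only [range₁, range₂, Finset.mem_filter, Finset.mem_Icc] at hs
    obtain ⟨N, hN⟩ : ∃ N : ℤ, (r₁ : ℤ) + r₂ - 1 - s = 2 * N := by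
      rcases hs with ⟨-, -, -, c, hc⟩ | ⟨-, -, -, c, hc⟩
      · rcases abs_cases ((r₁ : ℤ) - r₂) with ⟨h, h6⟩ | ⟨h, h6⟩
        · exact ⟨r₂ - 1 - c, by omega⟩
        · exact ⟨r₁ - 1 - c, by omega⟩
      · exact ⟨r₁ + r₂ - p - 1 - c, by omega⟩
    have h3 : 0 ≤ N ∧ N < r₁ ∧ N < r₂ := by
      rcases hs with ⟨-, h4, h5, -⟩ | ⟨h4, -, h5, -⟩
      · rcases abs_cases ((r₁ : ℤ) - r₂) with ⟨h, h6⟩ | ⟨h, h6⟩ <;>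
        rcases abs_cases ((r₁ : ℤ) + r₂ - p) with ⟨h', h7⟩ | ⟨h', h7⟩ <;> omega
      · omega
    refine ⟨N.toNat, by omega, by omega, by omega, ?_, ?_⟩ <;> omega
  obtain ⟨u, hu, hdu, hcu⟩ := exists_coinvariant hp h1' ν₁ ν₂ hN1 hN2
  have hcharge : (tensor (X p r₁ ν₁) (X p r₂ ν₂)).proj (label p s (ν₁ + ν₂)) u = u :=
    tenProj_of_mem_level hp h1' ha h2' hb (label_add_cast ν₁ ν₂ hN) hu
  have hpow : (tenF p r₁ r₂ (label p r₁ ν₁) (label p r₂ ν₂) ^ s) u = 0 := by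
    by_cases hsp' : s = p
    · rw [hsp']; exact LinearMap.congr_fun hops.f_pow u
    · have hs' : s ∈ range₁ p r₁ r₂ := hs.resolve_right fun h => hsp' h.1
      refine eq_zero_of_tenD_eq_zero (b := label p r₂ ν₂) hp h1' ha (N := N + s) ?_
        (tenF_pow_mem_level hp h1' ha hu s) ?_
      · simp only [range₁, Finset.mem_filter, Finset.mem_Icc] at hs'
        have := neg_abs_le ((r₁ : ℤ) - r₂)
        omega
      · exact HasOps.d_f_pow_eq_zero hops hp (dvd_label p s (ν₁ + ν₂)) hcharge hdu
  obtain ⟨φ, hφ, hφ0⟩ := exists_isHom_oneVertex hp hsp (dvd_label p s (ν₁ + ν₂)) hops hcharge hdu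
    hpow
  refine ⟨φ, hφ, LinearMap.ker_eq_bot.1 ?_⟩
  refine ((isSimple_oneVertex hp hs1 hsp (dvd_label p s (ν₁ + ν₂))).2 _
    (isSub_ker_of_isHom hφ)).resolve_right fun h => hcu ?_
  have h0 : u = 0 := by
    rw [← hφ0 hs1]
    exact LinearMap.congr_fun (LinearMap.ker_eq_top.1 h) _
  rw [h0, map_zero]

/-- Write s = 2p − r₁ − r₂ + 1 + 2N and let u be the coinvariant of level N. Since N + (p − s) < r₁,
the vector F^{p−s} u is nonzero and F^{p−s−1} u has a preimage T under d, one level higher. -/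
theorem exists_topPair {s : ℕ} (hs : s ∈ range₂ p r₁ r₂) (hsp : s < p) :
    ∃ T u, TopPair (tensor (X p r₁ ν₁) (X p r₂ ν₂))
      (tenF p r₁ r₂ (label p r₁ ν₁) (label p r₂ ν₂))
      (tenD p r₁ r₂ (label p r₁ ν₁) (label p r₂ ν₂)) s (p - s) (label p s (ν₁ + ν₂)) T u := by
  have hops := ops_tensor_X hp h1' h2' ν₁ ν₂
  have ha := qint_mul_eq_zero_of_dvd hp (m := r₁) (dvd_label p r₁ ν₁)
  have hb := qint_mul_eq_zero_of_dvd hp (m := r₂) (dvd_label p r₂ ν₂)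
  simp only [range₂, Finset.mem_filter, Finset.mem_Icc] at hs
  obtain ⟨⟨hs1, -⟩, h3, c, hc⟩ := hs
  obtain ⟨N, rfl⟩ : ∃ N : ℕ, c = N := ⟨c.toNat, by omega⟩
  obtain ⟨u, hu, hdu, hcu⟩ := exists_coinvariant (r₂ := r₂) hp h1' ν₁ ν₂ (N := N)
    (by omega) (by omega)
  obtain ⟨T, hT, hdT⟩ := exists_tenD_eq (b := label p r₂ ν₂) hp h1' ha (N := N + (p - s - 1))
    (by omega) (tenF_pow_mem_level (b := label p r₂ ν₂) hp h1' ha hu (p - s - 1))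
  refine ⟨T, u, hops, hs1, by omega, by omega, dvd_label p s _,
    tenProj_of_mem_level hp h1' ha h2' hb (label_add_cast ν₁ ν₂ (by omega)) hT,
    tenProj_of_mem_level hp h1' ha h2' hb ?_ hu, hdu, hdT,
    tenF_pow_ne_zero hp h1' (dvd_label p r₁ ν₁) (by omega) hcu⟩
  have := label_add_cast (p := p) ν₁ ν₂ (r₁ := r₁) (r₂ := r₂) (s := s) (N := (N + (p - s) : ℤ))
    (by omega)
  rw [Int.cast_add, this, ← Int.cast_add]
  congr 1
  rw [Nat.cast_sub hsp.le]
  ring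

end Summands

/-! ### Decompositions into direct sums -/

lemma HasOps.isHom_d [NeZero p] {Y Z : YDData p} {f d : Module.End ℂ Y.carrier}
    {f' d' : Module.End ℂ Z.carrier} (hY : HasOps Y f d) (hZ : HasOps Z f' d') (hp : 2 ≤ p)
    {φ : Y.carrier →ₗ[ℂ] Z.carrier} (hφ : IsHom (Y := Y) (Z := Z) φ) (y : Y.carrier) :
    φ (d y) = d' (φ y) := by
  have := coeff_coact_of_isHom hφ ⟨1, by omega⟩ y
  rw [HasOps.coeff_coact hY, HasOps.coeff_coact hZ, pow_one, pow_one] at this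
  exact this.symm

lemma Iso.symm {Y Z : YDData p} (h : Iso Y Z) : Iso Z Y := by
  obtain ⟨e, he⟩ := h
  refine ⟨e.symm, ⟨fun α => ?_, ?_, ?_⟩⟩
  · ext z
    obtain ⟨y, rfl⟩ := e.surjective z
    apply e.injective
    have := LinearMap.congr_fun (he.proj α) y
    simp only [LinearMap.comp_apply, LinearEquiv.coe_coe] at this
    simp [this]
  · refine TensorProduct.ext' fun b z => ?_
    obtain ⟨y, rfl⟩ := e.surjective z
    apply e.injective
    have := LinearMap.congr_fun he.act (b ⊗ₜ y)
    simp only [LinearMap.comp_apply, LinearEquiv.coe_coe, LinearMap.lTensor_tmul] at this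
    simp [this]
  · ext1 z
    obtain ⟨y, rfl⟩ := e.surjective z
    have := LinearMap.congr_fun he.coact y
    simp only [LinearMap.comp_apply, LinearEquiv.coe_coe] at this
    rw [LinearMap.comp_apply, LinearMap.comp_apply, LinearEquiv.coe_coe,
      e.symm_apply_apply, this, ← LinearMap.lTensor_comp_apply]
    simp

section DirectSum

variable {ι : Type} [Fintype ι] [DecidableEq ι] {Y : ι → YDData p} {M : YDData p}

/-- The map from a direct sum given by maps from the summands. -/
def sumMap (φ : ∀ i, (Y i).carrier →ₗ[ℂ] M.carrier) : (∀ i, (Y i).carrier) →ₗ[ℂ] M.carrier :=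
  ∑ i, φ i ∘ₗ LinearMap.proj i

omit [DecidableEq ι] in
lemma sumMap_apply (φ : ∀ i, (Y i).carrier →ₗ[ℂ] M.carrier) (v : ∀ i, (Y i).carrier) :
    sumMap φ v = ∑ i, φ i (v i) := by
  simp [sumMap]

lemma sumMap_comp_single (φ : ∀ i, (Y i).carrier →ₗ[ℂ] M.carrier) (i : ι) :
    sumMap φ ∘ₗ LinearMap.single ℂ (fun i => (Y i).carrier) i = φ i := by
  ext y
  rw [LinearMap.comp_apply, sumMap_apply, Finset.sum_eq_single i]
  · simp
  · intro j _ hj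
    simp [hj]
  · simp

lemma isHom_sumMap {φ : ∀ i, (Y i).carrier →ₗ[ℂ] M.carrier}
    (hφ : ∀ i, IsHom (Y := Y i) (Z := M) (φ i)) :
    IsHom (Y := directSum Y) (Z := M) (sumMap φ) where
  proj α := by
    refine LinearMap.ext fun (v : ∀ i, (Y i).carrier) => ?_
    have h : ∀ i, φ i ((Y i).proj α (v i)) = M.proj α (φ i (v i)) := fun i =>
      LinearMap.congr_fun ((hφ i).proj α) (v i)
    have e1 : sumMap φ (fun i => (Y i).proj α (v i)) = M.proj α (sumMap φ v) := by
      rw [sumMap_apply, sumMap_apply, map_sum]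
      exact Finset.sum_congr rfl fun i _ => h i
    exact e1
  act := by
    refine TensorProduct.ext' fun b (v : ∀ i, (Y i).carrier) => ?_
    have h : ∀ i, φ i ((Y i).act (b ⊗ₜ[ℂ] v i)) = M.act (b ⊗ₜ[ℂ] φ i (v i)) := fun i =>
      LinearMap.congr_fun (hφ i).act (b ⊗ₜ[ℂ] v i)
    have e1 : sumMap φ (fun i => (Y i).act (b ⊗ₜ[ℂ] v i)) = M.act (b ⊗ₜ[ℂ] sumMap φ v) := by
      rw [sumMap_apply, sumMap_apply, TensorProduct.tmul_sum, map_sum]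
      exact Finset.sum_congr rfl fun i _ => h i
    exact e1
  coact := by
    have e1 : M.coact ∘ₗ sumMap φ = (sumMap φ).lTensor (Nich p) ∘ₗ
        ∑ i, (LinearMap.single ℂ (fun i => (Y i).carrier) i).lTensor (Nich p) ∘ₗ
          (Y i).coact ∘ₗ LinearMap.proj i := by
      refine LinearMap.ext fun v => ?_
      rw [LinearMap.comp_apply, LinearMap.comp_apply, sumMap_apply, map_sum, LinearMap.sum_apply,
        map_sum]
      refine Finset.sum_congr rfl fun i _ => ?_
      rw [LinearMap.comp_apply, LinearMap.comp_apply, ← LinearMap.lTensor_comp_apply,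
        sumMap_comp_single]
      exact LinearMap.congr_fun (hφ i).coact (v i)
    exact e1

omit [Fintype ι] [DecidableEq ι] in
lemma pi_pow_apply {V : ι → Type} [∀ i, AddCommGroup (V i)] [∀ i, Module ℂ (V i)]
    (d : ∀ i, Module.End ℂ (V i)) (k : ℕ) (v : ∀ i, V i) (i : ι) :
    ((LinearMap.pi fun i => d i ∘ₗ LinearMap.proj i : Module.End ℂ (∀ i, V i)) ^ k) v i =
      (d i ^ k) (v i) := by
  induction k with
  | zero => rfl
  | succ k ih =>
    rw [← end_pow_succ_apply, ← end_pow_succ_apply, ← ih]; rfl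

variable [NeZero p]

/-- Injective morphisms whose sources have homogeneous coinvariants of different charges have
independent images. -/
theorem sumMap_injective (hp : 2 ≤ p) {f d : ∀ i, Module.End ℂ (Y i).carrier}
    (hY : ∀ i, HasOps (Y i) (f i) (d i)) {f' d' : Module.End ℂ M.carrier} (hM : HasOps M f' d')
    {φ : ∀ i, (Y i).carrier →ₗ[ℂ] M.carrier} (hφ : ∀ i, IsHom (Y := Y i) (Z := M) (φ i))
    (hinj : ∀ i, Function.Injective (φ i)) {S : ι → Set (ZMod (4 * p))}
    (hS : ∀ i α w, (Y i).proj α w = w → w ≠ 0 → d i w = 0 → α ∈ S i)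
    (hdisj : ∀ i j, i ≠ j → Disjoint (S i) (S j)) : Function.Injective (sumMap φ) := by
  rw [← LinearMap.ker_eq_bot]
  by_contra hker
  have hker' : IsSub (directSum Y) (LinearMap.ker (sumMap φ)) :=
    isSub_ker_of_isHom (isHom_sumMap hφ)
  have key : ∃ (α : ZMod (4 * p)) (w : ∀ i, (Y i).carrier), w ∈ LinearMap.ker (sumMap φ) ∧ w ≠ 0 ∧
      (LinearMap.pi fun i => (Y i).proj α ∘ₗ LinearMap.proj i : Module.End ℂ _) w = w ∧
      (LinearMap.pi fun i => d i ∘ₗ LinearMap.proj i : Module.End ℂ _) w = 0 := by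
    refine exists_homog_coinvariant (p := p) (N := p)
      (π := fun α => LinearMap.pi fun i => (Y i).proj α ∘ₗ LinearMap.proj i)
      (d := LinearMap.pi fun i => d i ∘ₗ LinearMap.proj i)
      (W := LinearMap.ker (sumMap φ)) ?_ ?_ ?_ ?_ hker'.graded ?_ hker
    · intro α β
      refine LinearMap.ext fun v => funext fun i => ?_
      have := LinearMap.congr_fun ((hY i).proj_comp α β) (v i)
      by_cases h : α = β
      · rw [if_pos h] at this ⊢; exact this
      · rw [if_neg h] at this ⊢; exact this
    · refine LinearMap.ext fun v => funext fun i => ?_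
      have := HasOps.sum_proj (hY i) (v i)
      rw [LinearMap.sum_apply, Finset.sum_apply]
      exact this
    · intro α
      refine LinearMap.ext fun v => funext fun i => ?_
      exact LinearMap.congr_fun ((hY i).d_proj α) (v i)
    · refine LinearMap.ext fun v => funext fun i => ?_
      rw [pi_pow_apply, (hY i).d_pow]
      rfl
    · intro v hv
      rw [LinearMap.mem_ker, sumMap_apply]
      have e : d' (sumMap φ v) = 0 := by rw [LinearMap.mem_ker.1 hv, map_zero]
      rw [sumMap_apply, map_sum] at e
      rw [← e]
      exact Finset.sum_congr rfl fun i _ => HasOps.isHom_d (hY i) hM hp (hφ i) (v i)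
  obtain ⟨α, w, hwK, hw0, hα, hdw⟩ := key
  have hα' : ∀ i, (Y i).proj α (w i) = w i := fun i => congrFun hα i
  have hdw' : ∀ i, d i (w i) = 0 := fun i => congrFun hdw i
  obtain ⟨i, hi⟩ : ∃ i, w i ≠ 0 := by
    by_contra! h
    exact hw0 (funext h)
  -- All components of w are coinvariants of one common charge, so by disjointness of the charge
  -- sets at most one of them is nonzero; injectivity of that single morphism then gives the
  -- contradiction.
  have hz : ∀ j, j ≠ i → w j = 0 := by
    intro j hj
    by_contra h
    exact Set.disjoint_left.1 (hdisj j i hj) (hS j α _ (hα' j) h (hdw' j))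
      (hS i α _ (hα' i) hi (hdw' i))
  have e := LinearMap.mem_ker.1 hwK
  rw [sumMap_apply, Finset.sum_eq_single i (fun j _ hj => by rw [hz j hj, map_zero])
    (by simp)] at e
  exact hi (hinj i (e.trans (map_zero _).symm))

theorem iso_directSum (hp : 2 ≤ p) {f' d' : Module.End ℂ M.carrier} (hM : HasOps M f' d')
    {S : ι → Set (ZMod (4 * p))}
    (H : ∀ i, ∃ (f d : Module.End ℂ (Y i).carrier) (φ : (Y i).carrier →ₗ[ℂ] M.carrier),
      HasOps (Y i) f d ∧ IsHom (Y := Y i) (Z := M) φ ∧ Function.Injective φ ∧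
      ∀ α w, (Y i).proj α w = w → w ≠ 0 → d w = 0 → α ∈ S i)
    (hdisj : ∀ i j, i ≠ j → Disjoint (S i) (S j)) (hfin : Module.Finite ℂ M.carrier)
    (hdim : Module.finrank ℂ M.carrier = ∑ i, Module.finrank ℂ (Y i).carrier) :
    Iso M (directSum Y) := by
  choose f d φ hY hφ hinj hS using H
  have h := sumMap_injective hp hY hM hφ hinj hS hdisj
  have hfin' : ∀ i, Module.Finite ℂ (Y i).carrier := fun i => Module.Finite.of_injective _ (hinj i)
  have e : Module.finrank ℂ (∀ i, (Y i).carrier) = Module.finrank ℂ M.carrier := by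
    rw [Module.finrank_pi_fintype, hdim]
  exact Iso.symm ⟨LinearEquiv.ofInjectiveOfFinrankEq (sumMap φ) h e, isHom_sumMap hφ⟩

end DirectSum

/-! ### The dimension count -/

lemma range₁_comm (p r₁ r₂ : ℕ) : range₁ p r₁ r₂ = range₁ p r₂ r₁ := by
  rw [range₁, range₁, abs_sub_comm (r₁ : ℤ), add_comm (r₁ : ℤ)]

lemma range₂_comm (p r₁ r₂ : ℕ) : range₂ p r₁ r₂ = range₂ p r₂ r₁ := by
  rw [range₂, range₂, sub_right_comm (2 * (p : ℤ))]

lemma sum_arith (k c : ℕ) : ∑ j ∈ Finset.range k, (c + 1 + 2 * j) = k * c + k * k := by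
  induction k with
  | zero => simp
  | succ k ih => rw [Finset.sum_range_succ, ih]; ring

lemma sum_range₁ {p r₁ r₂ : ℕ} (h : r₁ ≤ r₂) (h2 : r₂ ≤ p) :
    ∑ s ∈ range₁ p r₁ r₂, s =
      (min r₁ (p - r₂)) * (r₂ - r₁) + (min r₁ (p - r₂)) * (min r₁ (p - r₂)) := by
  -- The range is r₂ − r₁ + 1, r₂ − r₁ + 3, … with min(r₁, p − r₂) terms.
  rw [← sum_arith, ← Finset.sum_image (f := fun s : ℕ => s) (g := fun j => r₂ - r₁ + 1 + 2 * j)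
    (fun x _ y _ hxy => by simpa using hxy)]
  refine Finset.sum_congr ?_ fun _ _ => rfl
  ext s
  simp only [range₁, Finset.mem_filter, Finset.mem_Icc, Finset.mem_image, Finset.mem_range]
  have e1 : |(r₁ : ℤ) - r₂| = r₂ - r₁ := by rw [abs_of_nonpos (by omega)]; ring
  rw [e1]
  rcases abs_cases ((r₁ : ℤ) + r₂ - p) with ⟨e2, h3⟩ | ⟨e2, h3⟩ <;> rw [e2]
  · constructor
    · rintro ⟨-, h4, h5, c, hc⟩
      exact ⟨c.toNat, by omega, by omega⟩
    · rintro ⟨j, hj, rfl⟩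
      exact ⟨by omega, by omega, by omega, ⟨j, by omega⟩⟩
  · constructor
    · rintro ⟨-, h4, h5, c, hc⟩
      exact ⟨c.toNat, by omega, by omega⟩
    · rintro ⟨j, hj, rfl⟩
      exact ⟨by omega, by omega, by omega, ⟨j, by omega⟩⟩

lemma sum_range₂ {p r₁ r₂ : ℕ} (h1 : r₁ ≤ p) (h2 : r₂ ≤ p) :
    ∑ s ∈ range₂ p r₁ r₂, (if s < p then 2 * p else p) = p * (r₁ + r₂ - p) := by
  -- With e = r₁ + r₂ − p, or 0 if this is negative, the j-th index is s = p + 1 − e + 2j, and s < p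
  -- means 2j + 1 < e. Each term below p accounts for two units of e, and for odd e the last term s
  -- = p accounts for one.
  have key : ∀ e : ℕ, ∑ j ∈ Finset.range ((e + 1) / 2), (if 2 * j + 1 < e then 2 * p else p) =
      p * e := by
    intro e
    induction e using Nat.strong_induction_on with
    | _ e ih =>
      rcases e with _ | _ | e
      · simp
      · simp
      · have h3 : ∀ j ∈ Finset.range ((e + 1) / 2),
            (if 2 * (j + 1) + 1 < e + 1 + 1 then 2 * p else p) =
              if 2 * j + 1 < e then 2 * p else p := by
          intro j _
          by_cases h : 2 * j + 1 < e
          · rw [if_pos h, if_pos (by omega)]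
          · rw [if_neg h, if_neg (by omega)]
        rw [show (e + 1 + 1 + 1) / 2 = (e + 1) / 2 + 1 by omega, Finset.sum_range_succ',
          if_pos (by omega), Finset.sum_congr rfl h3, ih e (by omega)]
        ring
  have himage : range₂ p r₁ r₂ = (Finset.range ((r₁ + r₂ - p + 1) / 2)).image
      fun j => 2 * p + 1 + 2 * j - r₁ - r₂ := by
    ext s
    simp only [range₂, Finset.mem_filter, Finset.mem_Icc, Finset.mem_image, Finset.mem_range]
    constructor
    · rintro ⟨h3, h4, c, hc⟩
      exact ⟨c.toNat, by omega, by omega⟩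
    · rintro ⟨j, hj, rfl⟩
      exact ⟨by omega, by omega, ⟨j, by omega⟩⟩
  rw [← key, himage, Finset.sum_image ?_]
  · refine Finset.sum_congr rfl fun j hj => ?_
    rw [Finset.mem_range] at hj
    by_cases h : 2 * j + 1 < r₁ + r₂ - p
    · rw [if_pos h, if_pos (by omega)]
    · rw [if_neg h, if_neg (by omega)]
  · intro x _ y _ (hxy : 2 * p + 1 + 2 * x - r₁ - r₂ = 2 * p + 1 + 2 * y - r₁ - r₂)
    omega

/-- Assume r₁ ≤ r₂ and put m = p − r₂. If r₁ ≤ m there are no projective terms and the sum is r₁(r₂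
− r₁) + r₁²; otherwise it is m(r₂ − r₁) + m² + p(r₁ − m). Both equal r₁ r₂. -/
lemma sum_dim {p r₁ r₂ : ℕ} (h1 : r₁ ≤ p) (h2 : r₂ ≤ p) :
    ∑ s ∈ range₁ p r₁ r₂, s + ∑ s ∈ range₂ p r₁ r₂, (if s < p then 2 * p else p) = r₁ * r₂ := by
  wlog h : r₁ ≤ r₂ generalizing r₁ r₂
  · rw [range₁_comm, range₂_comm, mul_comm r₁]
    exact this h2 h1 (by omega)
  rw [sum_range₁ h h2, sum_range₂ h1 h2]
  obtain ⟨k, rfl⟩ := Nat.exists_eq_add_of_le h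
  obtain ⟨m, rfl⟩ := Nat.exists_eq_add_of_le h2
  rw [Nat.add_sub_cancel_left, Nat.add_sub_cancel_left]
  rcases le_total r₁ m with h3 | h3
  · rw [min_eq_left h3, show r₁ + (r₁ + k) - (r₁ + k + m) = 0 by omega]
    ring
  · obtain ⟨j, rfl⟩ := Nat.exists_eq_add_of_le h3
    rw [min_eq_right h3, show m + j + (m + j + k) - (m + j + k + m) = j by omega]
    ring

/-! ### The theorem -/

lemma finrank_X (r : ℕ) (ν : ZMod 4) : Module.finrank ℂ (X p r ν).carrier = r := by
  have h : Module.finrank ℂ (Fin r → ℂ) = r := Module.finrank_fin_fun ℂ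
  exact h

lemma finrank_P [NeZero p] {r : ℕ} (hr : 1 ≤ r) (hrp : r ≤ p) (ν : ZMod 4) :
    Module.finrank ℂ (P p r ν).carrier = if r < p then 2 * p else p := by
  split_ifs with h
  · obtain ⟨f, d, T, u, t, hg⟩ := topPair_P hr h ν
    exact t.finrank_eq hg
  · obtain rfl : r = p := by omega
    rw [P_self, finrank_X]

lemma charge_of_coinvariant_X [NeZero p] {r : ℕ} (hr : 1 ≤ r) {ν : ZMod 4} {α : ZMod (4 * p)}
    {w : (X p r ν).carrier} (hα : (X p r ν).proj α w = w) (hw : w ≠ 0) (hd : oneD r w = 0) :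
    α = (label p r ν : ℤ) := by
  obtain ⟨c, rfl⟩ := oneD_ker hr hd
  by_contra h
  apply hw
  rw [← hα]
  have : oneProj p r (label p r ν) α (c • vtx r 0) = 0 := by
    rw [map_smul, oneProj_vtx, if_neg (by simpa using h), smul_zero]
  exact this

lemma add_eq_of_cast_label_eq [NeZero p] {s s' : ℕ} {ν : ZMod 4} {c c' : ℤ}
    (h : ((label p s ν + c : ℤ) : ZMod (4 * p)) = ((label p s' ν + c' : ℤ) : ZMod (4 * p)))
    (hlt : |(s' : ℤ) + c' - (s + c)| < 4 * p) : (s : ℤ) + c = s' + c' := by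
  rw [ZMod.intCast_eq_intCast_iff_dvd_sub, label, label] at h
  by_contra hne
  refine TopPair.not_dvd_of_lt (p := p) (k := (s' : ℤ) + c' - (s + c)) (by omega) hlt ?_
  convert h using 1
  ring

/-- The charges of the homogeneous coinvariants of the summands. -/
def coinvariantCharges (p r₁ r₂ : ℕ) (ν : ZMod 4) :
    {s // s ∈ range₁ p r₁ r₂} ⊕ {s // s ∈ range₂ p r₁ r₂} → Set (ZMod (4 * p)) :=
  Sum.elim (fun s => {((label p s ν + 0 : ℤ) : ZMod (4 * p))})
    fun s => {((label p s ν + 0 : ℤ) : ZMod (4 * p)),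
      ((label p s ν + 2 * (p - s.val : ℕ) : ℤ) : ZMod (4 * p))}

/-- Up to the common shift −1 − νp, the charges are s for X(s), and s and 2p − s for P[s]. The first
family has s < p and s ≤ 2p − 1 − r₁ − r₂, the second has s ≥ 2p + 1 − r₁ − r₂, and 2p − s is at
least p. All these numbers differ by less than 4p, and s = 2p − s' with s, s' ≤ p only if s = s' =
p. -/
lemma disjoint_coinvariantCharges [NeZero p] (r₁ r₂ : ℕ) (ν : ZMod 4)
    (i j : {s // s ∈ range₁ p r₁ r₂} ⊕ {s // s ∈ range₂ p r₁ r₂}) (hij : i ≠ j) :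
    Disjoint (coinvariantCharges p r₁ r₂ ν i) (coinvariantCharges p r₁ r₂ ν j) := by
  have hb₁ : ∀ s ∈ range₁ p r₁ r₂, 1 ≤ s ∧ s ≤ p ∧ (s : ℤ) ≤ 2 * p - 1 - r₁ - r₂ ∧ s < p := by
    intro s hs
    simp only [range₁, Finset.mem_filter, Finset.mem_Icc] at hs
    have h1 := le_abs_self ((r₁ : ℤ) + r₂ - p)
    have h2 := abs_nonneg ((r₁ : ℤ) + r₂ - p)
    omega
  have hb₂ : ∀ s ∈ range₂ p r₁ r₂, 1 ≤ s ∧ s ≤ p ∧ 2 * (p : ℤ) - r₁ - r₂ + 1 ≤ s := by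
    intro s hs
    simp only [range₂, Finset.mem_filter, Finset.mem_Icc] at hs
    omega
  rw [Set.disjoint_left]
  rintro α hi hj
  apply hij
  rcases i with ⟨s, hs⟩ | ⟨s, hs⟩ <;> rcases j with ⟨s', hs'⟩ | ⟨s', hs'⟩ <;>
    simp only [coinvariantCharges, Sum.elim_inl, Sum.elim_inr, Set.mem_insert_iff,
      Set.mem_singleton_iff] at hi hj
  · have b := hb₁ s hs; have b' := hb₁ s' hs'
    have := add_eq_of_cast_label_eq (hi.symm.trans hj) (by rw [abs_lt]; omega)
    obtain rfl : s = s' := by omega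
    rfl
  · have b := hb₁ s hs; have b' := hb₂ s' hs'
    rcases hj with hj | hj
    · have := add_eq_of_cast_label_eq (hi.symm.trans hj) (by rw [abs_lt]; omega)
      omega
    · have := add_eq_of_cast_label_eq (hi.symm.trans hj) (by rw [abs_lt]; omega)
      omega
  · have b := hb₂ s hs; have b' := hb₁ s' hs'
    rcases hi with hi | hi
    · have := add_eq_of_cast_label_eq (hi.symm.trans hj) (by rw [abs_lt]; omega)
      omega
    · have := add_eq_of_cast_label_eq (hi.symm.trans hj) (by rw [abs_lt]; omega)
      omega
  · have b := hb₂ s hs; have b' := hb₂ s' hs'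
    have : s = s' := by
      rcases hi with hi | hi <;> rcases hj with hj | hj <;>
      · have := add_eq_of_cast_label_eq (hi.symm.trans hj) (by rw [abs_lt]; omega)
        omega
    subst this
    rfl

theorem iso_tensor_X [NeZero p] (hp : 2 ≤ p) {r₁ r₂ : ℕ} (ν₁ ν₂ : ZMod 4) (h1 : 1 ≤ r₁)
    (h1' : r₁ ≤ p) (h2 : 1 ≤ r₂) (h2' : r₂ ≤ p) :
    Iso (tensor (X p r₁ ν₁) (X p r₂ ν₂))
      (directSum (Sum.elim
        (fun s : {s // s ∈ range₁ p r₁ r₂} => X p s (ν₁ + ν₂))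
        (fun s : {s // s ∈ range₂ p r₁ r₂} => P p s (ν₁ + ν₂)))) := by
  have hX : ∀ s, (s ∈ range₁ p r₁ r₂ ∨ s = p ∧ s ∈ range₂ p r₁ r₂) → 1 ≤ s ∧ s ≤ p := by
    intro s hs
    simp only [range₁, range₂, Finset.mem_filter, Finset.mem_Icc] at hs
    rcases hs with hs | hs
    · exact hs.1
    · exact hs.2.1
  have hXs : ∀ s, (s ∈ range₁ p r₁ r₂ ∨ s = p ∧ s ∈ range₂ p r₁ r₂) →
      ∃ (f d : Module.End ℂ (X p s (ν₁ + ν₂)).carrier)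
        (φ : (X p s (ν₁ + ν₂)).carrier →ₗ[ℂ] (tensor (X p r₁ ν₁) (X p r₂ ν₂)).carrier),
        HasOps (X p s (ν₁ + ν₂)) f d ∧
        IsHom (Y := X p s (ν₁ + ν₂)) (Z := tensor (X p r₁ ν₁) (X p r₂ ν₂)) φ ∧
        Function.Injective φ ∧ ∀ α w, (X p s (ν₁ + ν₂)).proj α w = w → w ≠ 0 → d w = 0 →
          α = ((label p s (ν₁ + ν₂) + 0 : ℤ) : ZMod (4 * p)) := by
    intro s hs
    obtain ⟨φ, hφ, hinj⟩ := exists_isHom_X hp h1 h1' h2 h2' ν₁ ν₂ hs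
    refine ⟨_, _, φ, ops_X hp (hX s hs).2 _, hφ, hinj, fun α w hα hw hd => ?_⟩
    rw [add_zero]
    exact charge_of_coinvariant_X (hX s hs).1 hα hw hd
  refine iso_directSum hp (ops_tensor_X hp h1' h2' ν₁ ν₂)
    (S := coinvariantCharges p r₁ r₂ (ν₁ + ν₂)) ?_ (disjoint_coinvariantCharges r₁ r₂ (ν₁ + ν₂))
    ?_ ?_
  · rintro (⟨s, hs⟩ | ⟨s, hs⟩)
    · exact hXs s (Or.inl hs)
    · have hs' := hs
      simp only [range₂, Finset.mem_filter, Finset.mem_Icc] at hs'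
      rcases Nat.lt_or_ge s p with hsp | hsp
      · obtain ⟨f, d, T, u, t, hg⟩ := topPair_P hs'.1.1 hsp (ν₁ + ν₂)
        obtain ⟨T', u', t'⟩ := exists_topPair hp h1 h1' h2 h2' ν₁ ν₂ hs hsp
        obtain ⟨φ, hφ, hinj⟩ := t.exists_isHom hg t'
        refine ⟨f, d, φ, t.ops, hφ, hinj, fun α w hα hw hd => ?_⟩
        rcases t.charge_of_coinvariant hg hα hw hd with h | h
        · exact Or.inl (by rw [h, add_zero])
        · exact Or.inr h
      -- The end point s = p of the second family: the summand is X(p), with a single charge of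
      -- coinvariants.
      · obtain rfl : s = p := by omega
        obtain ⟨f, d, φ, e1, e2, e3, e4⟩ := hXs s (Or.inr ⟨rfl, hs⟩)
        have key : ∀ Z : YDData s, Z = X s s (ν₁ + ν₂) →
            ∃ (f d : Module.End ℂ Z.carrier)
              (φ : Z.carrier →ₗ[ℂ] (tensor (X s r₁ ν₁) (X s r₂ ν₂)).carrier),
              HasOps Z f d ∧
              IsHom (Y := Z) (Z := tensor (X s r₁ ν₁) (X s r₂ ν₂)) φ ∧
              Function.Injective φ ∧ ∀ α w, Z.proj α w = w → w ≠ 0 → d w = 0 →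
                α ∈ coinvariantCharges s r₁ r₂ (ν₁ + ν₂) (Sum.inr ⟨s, hs⟩) := by
          rintro _ rfl
          exact ⟨f, d, φ, e1, e2, e3, fun α w hα hw hd => Or.inl (e4 α w hα hw hd)⟩
        exact key _ (P_self _)
  · have : Module.Finite ℂ ((Fin r₁ → ℂ) ⊗[ℂ] (Fin r₂ → ℂ)) := inferInstance
    exact this
  · have e1 : Module.finrank ℂ ((Fin r₁ → ℂ) ⊗[ℂ] (Fin r₂ → ℂ)) = r₁ * r₂ := by simp
    refine (Eq.trans e1 ?_)
    rw [← sum_dim h1' h2', Fintype.sum_sum_type]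
    congr 1
    · rw [← Finset.sum_coe_sort]
      exact Finset.sum_congr rfl fun s _ => (finrank_X _ _).symm
    · rw [← Finset.sum_coe_sort]
      refine Finset.sum_congr rfl fun s _ => (finrank_P ?_ ?_ _).symm
      · have := s.2
        simp only [range₂, Finset.mem_filter, Finset.mem_Icc] at this
        exact this.1.1
      · have := s.2
        simp only [range₂, Finset.mem_filter, Finset.mem_Icc] at this
        exact this.1.2

end RankOneNichols

end

open RankOneNichols

theorem mainTheorem1 (p : ℕ) [NeZero p] (hp : 2 ≤ p) :
    (∀ (r : ℕ) (ν : ZMod 4), 1 ≤ r → r ≤ p →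
      IsYD (X p r ν) ∧ IsSimpleYD (X p r ν) ∧ Module.finrank ℂ (X p r ν).carrier = r) ∧
    (∀ (r : ℕ) (ν : ZMod 4), 1 ≤ r → r ≤ p - 1 →
      IsYD (P p r ν) ∧ Module.finrank ℂ (P p r ν).carrier = 2 * p ∧
      IsIndecomposableYD (P p r ν) ∧
      HasDiamond (P p r ν) (X p r ν) (X p (p - r) (ν - 1)) (X p (p - r) (ν + 1))) ∧
    (∀ ν : ZMod 4, P p p ν = X p p ν) ∧
    (∀ (r₁ r₂ : ℕ) (ν₁ ν₂ : ZMod 4), 1 ≤ r₁ → r₁ ≤ p → 1 ≤ r₂ → r₂ ≤ p →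
      IsYD (tensor (X p r₁ ν₁) (X p r₂ ν₂)) ∧
      (IsHom (Y := tensor (X p r₁ ν₁) (X p r₂ ν₂))
          (Z := twoVertex p (label p r₁ ν₁) (label p r₂ ν₂))
          (fusionMap p r₁ r₂ (label p r₁ ν₁) (label p r₂ ν₂)) ∧
        Function.Injective (fusionMap p r₁ r₂ (label p r₁ ν₁) (label p r₂ ν₂))) ∧
      Iso (tensor (X p r₁ ν₁) (X p r₂ ν₂))
        (directSum (Sum.elim
          (fun s : {s // s ∈ range₁ p r₁ r₂} => X p s (ν₁ + ν₂))
          (fun s : {s // s ∈ range₂ p r₁ r₂} => P p s (ν₁ + ν₂))))) := by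
  refine ⟨fun r ν h1 h2 => ⟨HasOps.isYD (ops_X hp h2 ν) hp,
    isSimple_oneVertex hp h1 h2 (dvd_label p r ν), finrank_X r ν⟩, fun r ν h1 h2 => ?_, P_self,
    fun r₁ r₂ ν₁ ν₂ h1 h1' h2 h2' => ⟨HasOps.isYD (ops_tensor_X hp h1' h2' ν₁ ν₂) hp,
      ⟨isHom_fusionMap hp h1' h2' (qint_mul_eq_zero_of_dvd hp (dvd_label p r₁ ν₁))
        (qint_mul_eq_zero_of_dvd hp (dvd_label p r₂ ν₂)), fusionMap_injective hp h1' h2'⟩,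
      iso_tensor_X hp ν₁ ν₂ h1 h1' h2 h2'⟩⟩
  have hlt : r < p := by omega
  obtain ⟨f, d, T, u, t, hg⟩ := topPair_P h1 hlt ν
  exact ⟨HasOps.isYD t.ops hp, t.finrank_eq hg, t.isIndecomposable hg, hasDiamond_P h1 hlt ν⟩
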